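/- Let $\tau\in i\mathbb R_{>0}$, let $N\ge 0$ be an integer and $\eta\in\mathbb C$. Put $p=e^{2\pi i\tau}$ and $q=e^{4\pi i\eta}$, and let $p^c=e^{2\pi i c\tau}$, $q^c=e^{4\pi i c\eta}$, $\log q=4\pi i\eta$. Let $(a_1,\dots,a_n;p)_\infty=\prod_{j\ge 0}(1-a_1p^j)\cdots(1-a_np^j)$, and for $|q|<1$ let $$\Gamma(x;p,q)=\prod_{j,k=0}^\infty\frac{1-p^{j+1}q^{k+1}/x}{1-p^jq^kx}$$ be Ruijsenaars' elliptic gamma function, extended to $|q|>1$ by $\Gamma(x;p,q)=1/\Gamma(x/q;p,1/q)$. It satisfies $\Gamma(qx;p,q)=(x,p/x;p)_\infty\,\Gamma(x;p,q)$ and $\Gamma(x;p,q)\,\Gamma(pq/x;p,q)=1$. Write $\Gamma(x_1,\dots,x_n;p,q)=\Gamma(x_1;p,q)\cdots\Gamma(x_n;p,q)$ and $\Gamma(ax^\pm y^\pm;p,q)=\Gamma(axy,axy^{-1},ax^{-1}y,ax^{-1}y^{-1};p,q)$. **(1)** Suppose that $$|\operatorname{Re}\eta|<\frac1{2(N+1)},\qquad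 |\operatorname{Im}\eta|<\frac{\tau}{2(N+1)i},$$ equivalently $p^{1/(N+1)}<|q|<p^{-1/(N+1)}$ and $|\arg q|<2\pi/(N+1)$, where $\arg q=4\pi\operatorname{Re}\eta$. Then for all $v,w\in\mathbb C\setminus\{0\}$ the integral below converges absolutely and $$\iint_{p<|z|<1}\frac{\Gamma(-p^{\frac12}q^{\frac{N+1}2}v^\pm\bar z^\pm,\,-p^{\frac12}q^{\frac{N+1}2}\bar w^\pm z^\pm;p,q)}{\Gamma(z^2,\bar z^2,pz^{-2},p\bar z^{-2},\,-p^{\frac12}q^{\frac{N+3}2}z^\pm\bar z^\pm;p,q)}\,\frac{dx\,dy}{|z|^4} =-\frac{2\pi\log(q)\,p^{-\frac12}q^{\frac{N+1}2}}{(p,p,q^{N+1},pq^{-N-1};p)_\infty}\,\Gamma(-p^{\frac12}q^{\frac{N+1}2}v^\pm\bar w^\pm;p,q),$$ where $z=x+iy$. At $\eta=0$ the constant is to be read as its limit $2\pi p^{-1/2}/\big((N+1)(p;p)_\infty^4\big)$. The products of gamma functions are understood through the two functional equations, that is, $$\frac1{\Gamma(x,p/x;p,q)}=(x,p/x;p)_\infty,\qquad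 \Gamma(-p^{\frac12}q^{\frac{m+1}2}y,\,-p^{\frac12}q^{\frac{m+1}2}y^{-1};p,q)=\prod_{k=0}^{m-1}\big(-p^{\frac12}q^{k-\frac{m-1}2}y,\,-p^{\frac12}q^{\frac{m-1}2-k}y^{-1};p\big)_\infty,$$ which gives them a meaning for all $q$ in the region, including $|q|=1$, and fills in removable singularities. For $|q|\neq1$ the identity, with absolute convergence, also holds with the function $\Gamma(x;p,q)$ itself, provided that none of the four arguments $-p^{\frac12}q^{\frac{N+1}2}v^{\pm1}\bar w^{\pm1}$ is a pole of $\Gamma(\cdot;p,q)$. **(2)** Let $\theta(x)=ip^{1/8}e^{-\pi ix}(p,e^{2\pi ix},pe^{-2\pi ix};p)_\infty$ and $\theta(a\pm b)=\theta(a+b)\theta(a-b)$. Let $\Theta_N$ be the space of entire functions $f$ with $f(x+1)=f(x)$, $f(x+\tau)=e^{-2\pi iN(2x+\tau)}f(x)$ and $f(-x)=f(x)$, with the scalar product $$\langle f,g\rangle=\iint_{\mathbb C/(\mathbb Z+\tau\mathbb Z)}f(u)\overline{g(u)}M(u,\bar u)\,dx\,dy,\qquad u=x+iy,\qquad M(u,v)=\frac{\theta(2u)\theta(2v)}{e^{2\pi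 iu(N+2)}\prod_{k=0}^{N+1}\theta(u\pm v+(2k-N-1)\eta+\frac12+\frac\tau2)}.$$ If $\eta$ is real with $|\eta|<\frac1{2(N+1)}$, or purely imaginary with $|\eta|<\frac{\tau}{2(N+1)i}$, then the evaluation in (1), for all $v,w\ne0$, is equivalent to the statement that the reproducing kernel of $\Theta_N$ is $C^{-1}K_v$, where $$K_v(u)=e^{2\pi iuN}\prod_{k=0}^{N-1}\theta\big(u\pm\bar v+(2k-N+1)\eta+\tfrac12+\tfrac\tau2\big),\qquad C=\frac{2\eta p^{3/8}}{\theta(2(N+1)\eta)(p;p)_\infty^3},$$ with $C=p^{1/4}/\big(2\pi(N+1)(p;p)_\infty^6\big)$ if $\eta=0$. That is, every $C^{-1}K_v$ lies in $\Theta_N$, and for all $f\in\Theta_N$ and $v\in\mathbb C$ the integral $\langle f,C^{-1}K_v\rangle$ converges absolutely and equals $f(v)$. -/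

import Mathlib

open MeasureTheory ComplexConjugate

noncomputable section

namespace SklyaninIntegral

/-- The infinite shifted factorial `(a; p)_∞ = ∏_{j ≥ 0} (1 - a p ^ j)`. -/
def qPoch (a p : ℂ) : ℂ := ∏' j : ℕ, (1 - a * p ^ j)

/-- The multiplicative theta function `(x, p / x; p)_∞`. -/
def mTheta (p x : ℂ) : ℂ := qPoch x p * qPoch (p / x) p

/-- The double product `∏_{j,k ≥ 0} (1 - p ^ (j+1) q ^ (k+1) / x) / (1 - p ^ j q ^ k x)`,
which converges for `‖p‖ < 1` and `‖q‖ < 1`. -/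
def ellGammaProd (p q x : ℂ) : ℂ :=
  ∏' jk : ℕ × ℕ, (1 - p ^ (jk.1 + 1) * q ^ (jk.2 + 1) / x) / (1 - p ^ jk.1 * q ^ jk.2 * x)

open Classical in
/-- The elliptic gamma function `Γ(x; p, q)` for `‖q‖ ≠ 1`: the double product if `‖q‖ < 1`, and
`Γ(x; p, q) = 1 / Γ(x / q; p, 1 / q)` if `‖q‖ > 1`. In both regimes
`Γ(q x) = (x, p / x; p)_∞ Γ(x)` and `Γ(x) Γ(p q / x) = 1`. -/
def ellGamma (p q x : ℂ) : ℂ :=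
  if ‖q‖ < 1 then ellGammaProd p q x else (ellGammaProd p q⁻¹ (x / q))⁻¹

open Classical in
/-- `x` is a pole of `Γ(·; p, q)`, `‖q‖ ≠ 1`. -/
def IsEllGammaPole (p q x : ℂ) : Prop :=
  if ‖q‖ < 1 then ∃ j k : ℕ, p ^ j * q ^ k * x = 1 else ∃ j k : ℕ, q ^ k * x = p ^ (j + 1)

/-- `Γ(a x^± y^±; p, q)`, the product over the four choices of signs. -/
def ellGammaQuad (p q a x y : ℂ) : ℂ :=
  ellGamma p q (a * x * y) * ellGamma p q (a * x * y⁻¹) *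
    ellGamma p q (a * x⁻¹ * y) * ellGamma p q (a * x⁻¹ * y⁻¹)

/-- `p = exp (2 π i τ)`. -/
def pOf (τ : ℂ) : ℂ := Complex.exp (2 * Real.pi * Complex.I * τ)

/-- `p ^ c = exp (2 π i c τ)`. -/
def pPow (τ c : ℂ) : ℂ := Complex.exp (2 * Real.pi * Complex.I * c * τ)

/-- `q = exp (4 π i η)`. -/
def qOf (η : ℂ) : ℂ := Complex.exp (4 * Real.pi * Complex.I * η)

/-- `log q = 4 π i η`. -/
def logQ (η : ℂ) : ℂ := 4 * Real.pi * Complex.I * η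

/-- `q ^ c = exp (4 π i c η)`. -/
def qPow (η c : ℂ) : ℂ := Complex.exp (4 * Real.pi * Complex.I * c * η)

/-- The annulus `|p| < |z| < 1`. -/
def annulus (τ : ℂ) : Set ℂ := {z : ℂ | ‖pOf τ‖ < ‖z‖ ∧ ‖z‖ < 1}

/-- The integrand written with elliptic gamma functions (meaningful for `‖q‖ ≠ 1`). -/
def gammaIntegrand (τ η : ℂ) (N : ℕ) (v w z : ℂ) : ℂ :=
  ellGammaQuad (pOf τ) (qOf η) (-pPow τ (1 / 2) * qPow η ((N + 1) / 2)) v (conj z) *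
      ellGammaQuad (pOf τ) (qOf η) (-pPow τ (1 / 2) * qPow η ((N + 1) / 2)) (conj w) z /
    (ellGamma (pOf τ) (qOf η) (z ^ 2) * ellGamma (pOf τ) (qOf η) (conj z ^ 2) *
      ellGamma (pOf τ) (qOf η) (pOf τ / z ^ 2) * ellGamma (pOf τ) (qOf η) (pOf τ / conj z ^ 2) *
      ellGammaQuad (pOf τ) (qOf η) (-pPow τ (1 / 2) * qPow η ((N + 3) / 2)) z (conj z)) /
    (‖z‖ : ℂ) ^ 4

/-- The value of `Γ(-p^(1/2) q^((m+1)/2) y; p, q) Γ(-p^(1/2) q^((m+1)/2) / y; p, q)` given by the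
two functional equations of `Γ`, namely
`∏_{k < m} (-p^(1/2) q^(k-(m-1)/2) y, -p^(1/2) q^((m-1)/2-k) / y; p)_∞`.
It makes sense for all `q`, unimodular `q` included. -/
def gammaPair (τ η : ℂ) (m : ℕ) (y : ℂ) : ℂ :=
  ∏ k ∈ Finset.range m, mTheta (pOf τ) (-pPow τ (1 / 2) * qPow η (k - (m - 1) / 2) * y)

/-- The value of `Γ(-p^(1/2) q^((m+1)/2) x^± y^±; p, q)` in the sense of `gammaPair`. -/
def gammaQuad (τ η : ℂ) (m : ℕ) (x y : ℂ) : ℂ :=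
  gammaPair τ η m (x * y) * gammaPair τ η m (x * y⁻¹)

/-- The integrand for arbitrary `q`, where the elliptic gamma functions are paired as in
`gammaPair` and `1 / (Γ(x) Γ(p / x))` is `(x, p / x; p)_∞`. -/
def pairedIntegrand (τ η : ℂ) (N : ℕ) (v w z : ℂ) : ℂ :=
  gammaQuad τ η N v (conj z) * gammaQuad τ η N (conj w) z *
      (mTheta (pOf τ) (z ^ 2) * mTheta (pOf τ) (conj z ^ 2)) /
    gammaQuad τ η (N + 2) z (conj z) / (‖z‖ : ℂ) ^ 4

open Classical in
/-- `-2π log(q) p^(-1/2) q^((N+1)/2) / (p, p, q^(N+1), p q^(-N-1); p)_∞`, with the removable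
singularity at `η = 0` filled in by its limit `2π p^(-1/2) / ((N+1) (p; p)_∞^4)`. -/
def integralConst (τ η : ℂ) (N : ℕ) : ℂ :=
  if η = 0 then
    2 * Real.pi * pPow τ (-1 / 2) / ((N + 1) * qPoch (pOf τ) (pOf τ) ^ 4)
  else
    -(2 * Real.pi * logQ η * pPow τ (-1 / 2) * qPow η ((N + 1) / 2)) /
      (qPoch (pOf τ) (pOf τ) * qPoch (pOf τ) (pOf τ) * qPoch (qPow η (N + 1)) (pOf τ) *
        qPoch (pOf τ * qPow η (-N - 1)) (pOf τ))

/-- The evaluation of the double integral, for all nonzero `v` and `w`. -/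
def DoubleIntegralEvaluation (τ η : ℂ) (N : ℕ) : Prop :=
  ∀ v w : ℂ, v ≠ 0 → w ≠ 0 →
    IntegrableOn (pairedIntegrand τ η N v w) (annulus τ) volume ∧
      ∫ z in annulus τ, pairedIntegrand τ η N v w z =
        integralConst τ η N * gammaQuad τ η N v (conj w)

/-- Jacobi's theta function
`θ(x) = θ₁(x | τ) = i p^(1/8) exp(-π i x) (p, exp(2π i x), p exp(-2π i x); p)_∞`. -/
def theta (τ x : ℂ) : ℂ :=
  Complex.I * pPow τ (1 / 8) * Complex.exp (-(Real.pi * Complex.I * x)) *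
    (qPoch (pOf τ) (pOf τ) * qPoch (Complex.exp (2 * Real.pi * Complex.I * x)) (pOf τ) *
      qPoch (pOf τ * Complex.exp (-(2 * Real.pi * Complex.I * x))) (pOf τ))

/-- The space `Θ_N` of even theta functions of order `2N`, quasi-period `(1, τ)` and zero
characteristics. -/
def evenTheta (τ : ℂ) (N : ℕ) : Set (ℂ → ℂ) :=
  {f | Differentiable ℂ f ∧ (∀ x, f (x + 1) = f x) ∧
    (∀ x, f (x + τ) = Complex.exp (-(2 * Real.pi * Complex.I * N * (2 * x + τ))) * f x) ∧
    ∀ x, f (-x) = f x}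

/-- The weight `M(u, v)`. -/
def weight (τ η : ℂ) (N : ℕ) (u v : ℂ) : ℂ :=
  theta τ (2 * u) * theta τ (2 * v) /
    (Complex.exp (2 * Real.pi * Complex.I * u * (N + 2)) *
      ∏ k ∈ Finset.range (N + 2),
        (theta τ (u + v + (2 * k - N - 1) * η + 1 / 2 + τ / 2) *
          theta τ (u - v + (2 * k - N - 1) * η + 1 / 2 + τ / 2)))

/-- A fundamental domain for `ℂ / (ℤ + τ ℤ)`, where `τ` is purely imaginary. -/
def fundDomain (τ : ℂ) : Set ℂ := {u : ℂ | 0 ≤ u.re ∧ u.re < 1 ∧ 0 ≤ u.im ∧ u.im < τ.im}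

/-- The integrand of Sklyanin's scalar product of `f` and `g`. -/
def metricIntegrand (τ η : ℂ) (N : ℕ) (f g : ℂ → ℂ) (u : ℂ) : ℂ :=
  f u * conj (g u) * weight τ η N u (conj u)

/-- Sklyanin's scalar product `⟨f, g⟩`, linear in `f`. -/
def metric (τ η : ℂ) (N : ℕ) (f g : ℂ → ℂ) : ℂ :=
  ∫ u in fundDomain τ, metricIntegrand τ η N f g u

/-- `K_v(u) = exp(2π i u N) ∏_{k<N} θ(u ± conj v + (2k-N+1)η + 1/2 + τ/2)`. -/
def kernel (τ η : ℂ) (N : ℕ) (v u : ℂ) : ℂ :=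
  Complex.exp (2 * Real.pi * Complex.I * u * N) *
    ∏ k ∈ Finset.range N,
      (theta τ (u + conj v + (2 * k - N + 1) * η + 1 / 2 + τ / 2) *
        theta τ (u - conj v + (2 * k - N + 1) * η + 1 / 2 + τ / 2))

open Classical in
/-- `C = 2 η p^(3/8) / (θ(2(N+1)η) (p; p)_∞^3)`, with the removable singularity at `η = 0` filled
in by its limit `p^(1/4) / (2π (N+1) (p; p)_∞^6)`. -/
def kernelConst (τ η : ℂ) (N : ℕ) : ℂ :=
  if η = 0 then pPow τ (1 / 4) / (2 * Real.pi * (N + 1) * qPoch (pOf τ) (pOf τ) ^ 6)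
  else 2 * η * pPow τ (3 / 8) / (theta τ (2 * (N + 1) * η) * qPoch (pOf τ) (pOf τ) ^ 3)

/-- The family `k v` is the reproducing kernel of `Θ_N` for Sklyanin's scalar product: each `k v`
lies in `Θ_N`, and `⟨f, k v⟩ = f v` for all `f` in `Θ_N`. -/
def IsReproducingKernel (τ η : ℂ) (N : ℕ) (k : ℂ → ℂ → ℂ) : Prop :=
  (∀ v, k v ∈ evenTheta τ N) ∧
    ∀ f ∈ evenTheta τ N, ∀ v : ℂ,
      IntegrableOn (metricIntegrand τ η N f (k v)) (fundDomain τ) volume ∧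
        metric τ η N f (k v) = f v

end SklyaninIntegral

end

noncomputable section

namespace SklyaninIntegral

open Complex Filter Topology

/-! ### Infinite shifted factorials -/

/-! Write K_m(a, v) = P_m(v + a) P_m(v - a) (`thetaKernel`), where P_m (`thetaProd`) is a product of
m even theta functions along an arithmetic progression of step 2η. The substitution z = exp(2πiu)
carries a period cell to the annulus and turns the double integral into a constant times the
bilinear pairing ⟨f, h⟩ = ∫ f(u) h(ū) θ(2u) θ(2ū) / K_{N+2}(ū, u) of two kernels K_N. Everything
rests on the reproducing property ⟨f, K_N(a, ·)⟩ = c_N f(a) for f in Θ_N (`pairing_thetaKernel`).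
Taking another kernel for f gives the integral evaluation; inserting a complex conjugation, harmless
when conj η = ±η, gives the reproducing kernel statement. The asserted equivalence holds because
both of its sides do.

For η ≠ 0 the reproducing property goes by induction on N. A difference operator with a free
parameter b, built from f(u + η) and f(u - η), sends f in Θ_{N+1} to F in Θ_N (`exists_lower`). In
⟨F, h⟩ the variables u and ū are treated as independent and the contour is moved in u alone by ±η
(`setIntegral_fundDomain_shift`); the bounds on η keep the poles away. Weierstrass's addition
formula (`theta3_theta_addition`) then recombines the two terms, so the adjoint of the operator is,
up to a constant, multiplication of h by θ₃(v + b) θ₃(v - b) (`pairing_lower`). For b = a + Nη this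
multiplication turns K_N(a - η, ·) into K_{N+1}(a, ·), while one of the two terms of F vanishes at a
- η, leaving a multiple of f(a).

For N = 0 the function f is constant. Differentiating the addition formula writes the weight as a
sum of logarithmic derivatives of θ₃ depending on Re u alone or on Im u alone
(`pairingIntegrand_zero`). The former integrate to zero, and the latter give 4πη by
quasi-periodicity. The value η = 0 follows by continuity.

For ‖q‖ ≠ 1, away from poles, the paired elliptic gamma functions collapse to finite theta products,
and the points z at which a pole interferes form a null set (`gammaIntegrand_ae_eq`). -/

lemma summable_norm_mul_pow {p : ℂ} (hp : ‖p‖ < 1) (a : ℂ) :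
    Summable fun j : ℕ => ‖-(a * p ^ j)‖ := by
  simp only [norm_neg, norm_mul, norm_pow]
  exact (summable_geometric_of_lt_one (norm_nonneg _) hp).mul_left _

lemma qPoch_eq (a p : ℂ) : qPoch a p = ∏' j : ℕ, (1 + -(a * p ^ j)) := by
  simp [qPoch, sub_eq_add_neg]

lemma multipliable_qPoch {p : ℂ} (hp : ‖p‖ < 1) (a : ℂ) :
    Multipliable fun j : ℕ => (1 - a * p ^ j) := by
  simpa [sub_eq_add_neg] using multipliable_one_add_of_summable (summable_norm_mul_pow hp a)

lemma qPoch_eq_zero_iff {p : ℂ} (hp : ‖p‖ < 1) (a : ℂ) :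
    qPoch a p = 0 ↔ ∃ j : ℕ, a * p ^ j = 1 := by
  constructor
  · intro h
    by_contra! hne
    refine tprod_one_add_ne_zero_of_summable (fun j => ?_) (summable_norm_mul_pow hp a)
      (qPoch_eq a p ▸ h)
    rw [← sub_eq_add_neg, sub_ne_zero]
    exact (hne j).symm
  · rintro ⟨j, hj⟩
    exact tprod_of_exists_eq_zero ⟨j, by simp [hj]⟩

lemma qPoch_eq_mul {p : ℂ} (hp : ‖p‖ < 1) (a : ℂ) :
    qPoch a p = (1 - a) * qPoch (a * p) p := by
  have h : Multipliable fun j : ℕ => (1 - a * p ^ (j + 1)) := by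
    simpa [pow_succ', mul_assoc] using multipliable_qPoch hp (a * p)
  have h2 : qPoch a p = (1 - a * p ^ 0) * ∏' j : ℕ, (1 - a * p ^ (j + 1)) := tprod_eq_zero_mul' h
  rw [h2, pow_zero, mul_one, qPoch]
  simp only [pow_succ', mul_assoc]

lemma differentiable_qPoch {p : ℂ} (hp : ‖p‖ < 1) : Differentiable ℂ fun a => qPoch a p := by
  intro a
  have hball : IsOpen (Metric.ball (0 : ℂ) (‖a‖ + 1)) := Metric.isOpen_ball
  have hsum : Summable fun j : ℕ => (‖a‖ + 1) * ‖p‖ ^ j :=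
    (summable_geometric_of_lt_one (norm_nonneg _) hp).mul_left _
  have h := hsum.hasProdLocallyUniformlyOn_nat_one_add (f := fun j x => -(x * p ^ j)) hball
    (Eventually.of_forall fun j x hx => by
      simp only [norm_neg, norm_mul, norm_pow]
      gcongr
      simpa using (mem_ball_zero_iff.1 hx).le)
    (fun j => by fun_prop)
  have hd : DifferentiableOn ℂ (fun x => ∏' j : ℕ, (1 + -(x * p ^ j)))
      (Metric.ball (0 : ℂ) (‖a‖ + 1)) :=
    h.tendstoLocallyUniformlyOn_finsetRange.differentiableOn
      (Eventually.of_forall fun n => by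
        have := DifferentiableOn.fun_finsetProd (𝕜 := ℂ) (u := Finset.range n)
          (f := fun j x => (1 + -(x * p ^ j))) (s := Metric.ball (0 : ℂ) (‖a‖ + 1))
          (fun j _ => by fun_prop)
        simpa using this) hball
  have := hd.differentiableAt (hball.mem_nhds (show a ∈ _ by simp))
  simpa [qPoch_eq] using this

/-! ### The nome -/

lemma norm_pOf_lt_one {τ : ℂ} (hτ : 0 < τ.im) : ‖pOf τ‖ < 1 := by
  rw [pOf, Complex.norm_exp, Real.exp_lt_one_iff]
  have : (2 * Real.pi * Complex.I * τ).re = -(2 * Real.pi * τ.im) := by simp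
  rw [this]
  have := mul_pos Real.two_pi_pos hτ
  linarith

lemma pOf_ne_zero (τ : ℂ) : pOf τ ≠ 0 := Complex.exp_ne_zero _

lemma pPow_ne_zero (τ c : ℂ) : pPow τ c ≠ 0 := Complex.exp_ne_zero _

lemma pPow_add (τ a b : ℂ) : pPow τ (a + b) = pPow τ a * pPow τ b := by
  rw [pPow, pPow, pPow, ← Complex.exp_add]; ring_nf

lemma pPow_one (τ : ℂ) : pPow τ 1 = pOf τ := by simp [pPow, pOf]

lemma qPoch_self_ne_zero {τ : ℂ} (hτ : 0 < τ.im) : qPoch (pOf τ) (pOf τ) ≠ 0 := by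
  rw [Ne, qPoch_eq_zero_iff (norm_pOf_lt_one hτ)]
  rintro ⟨j, hj⟩
  have h1 : ‖pOf τ‖ ^ (j + 1) = 1 := by
    rw [← norm_pow, pow_succ', hj, norm_one]
  exact (pow_lt_one₀ (norm_nonneg _) (norm_pOf_lt_one hτ) j.succ_ne_zero).ne h1

/-! ### The theta function -/

lemma theta_eq (τ x : ℂ) : theta τ x = Complex.I * pPow τ (1 / 8) *
    Complex.exp (-(Real.pi * Complex.I * x)) * qPoch (pOf τ) (pOf τ) *
      (qPoch (Complex.exp (2 * Real.pi * Complex.I * x)) (pOf τ) *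
      qPoch (pOf τ * Complex.exp (-(2 * Real.pi * Complex.I * x))) (pOf τ)) := by
  rw [theta]; ring

lemma differentiable_theta {τ : ℂ} (hτ : 0 < τ.im) : Differentiable ℂ (theta τ) := by
  have h := differentiable_qPoch (norm_pOf_lt_one hτ)
  have h1 : Differentiable ℂ fun x : ℂ =>
      qPoch (Complex.exp (2 * Real.pi * Complex.I * x)) (pOf τ) := h.comp (by fun_prop)
  have h2 : Differentiable ℂ fun x : ℂ =>
      qPoch (pOf τ * Complex.exp (-(2 * Real.pi * Complex.I * x))) (pOf τ) := h.comp (by fun_prop)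
  unfold theta
  fun_prop

lemma theta_neg {τ : ℂ} (hτ : 0 < τ.im) (x : ℂ) : theta τ (-x) = -theta τ x := by
  have hp := norm_pOf_lt_one hτ
  rw [theta_eq, theta_eq, qPoch_eq_mul hp (cexp (2 * Real.pi * I * x)),
    qPoch_eq_mul hp (cexp (2 * Real.pi * I * -x))]
  have e1 : cexp (-(2 * Real.pi * I * -x)) = cexp (2 * Real.pi * I * x) := by ring_nf
  have e2 : cexp (2 * Real.pi * I * -x) = cexp (-(2 * Real.pi * I * x)) := by ring_nf
  rw [e1, e2, mul_comm (pOf τ) (cexp (2 * Real.pi * I * x)),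
    mul_comm (pOf τ) (cexp (-(2 * Real.pi * I * x)))]
  have e3 : cexp (-(Real.pi * I * -x)) * (1 - cexp (-(2 * Real.pi * I * x))) =
      -(cexp (-(Real.pi * I * x)) * (1 - cexp (2 * Real.pi * I * x))) := by
    simp only [mul_sub, mul_one, ← Complex.exp_add]
    ring_nf
  linear_combination (I * pPow τ (1 / 8) * qPoch (pOf τ) (pOf τ) *
    qPoch (cexp (2 * Real.pi * I * x) * pOf τ) (pOf τ) *
    qPoch (cexp (-(2 * Real.pi * I * x)) * pOf τ) (pOf τ)) * e3

lemma exp_two_pi_I_add_one (x : ℂ) :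
    cexp (2 * Real.pi * I * (x + 1)) = cexp (2 * Real.pi * I * x) := by
  rw [mul_add, mul_one, Complex.exp_add, Complex.exp_two_pi_mul_I, mul_one]

lemma theta_add_one (τ x : ℂ) : theta τ (x + 1) = -theta τ x := by
  rw [theta_eq, theta_eq, Complex.exp_neg (2 * Real.pi * I * (x + 1)), exp_two_pi_I_add_one,
    ← Complex.exp_neg]
  have : cexp (-(Real.pi * I * (x + 1))) = -cexp (-(Real.pi * I * x)) := by
    rw [mul_add, mul_one, neg_add, Complex.exp_add, Complex.exp_neg (Real.pi * I),
      Complex.exp_pi_mul_I]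
    norm_num
  rw [this]; ring

lemma theta_add_tau {τ : ℂ} (hτ : 0 < τ.im) (x : ℂ) :
    theta τ (x + τ) = -cexp (-(Real.pi * I * (2 * x + τ))) * theta τ x := by
  have hp := norm_pOf_lt_one hτ
  rw [theta_eq, theta_eq, qPoch_eq_mul hp (cexp (2 * Real.pi * I * x)),
    qPoch_eq_mul hp (pOf τ * cexp (-(2 * Real.pi * I * (x + τ))))]
  have e1 : pOf τ * cexp (-(2 * Real.pi * I * (x + τ))) = cexp (-(2 * Real.pi * I * x)) := by
    rw [pOf, ← Complex.exp_add]; ring_nf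
  have e2 : cexp (2 * Real.pi * I * (x + τ)) = cexp (2 * Real.pi * I * x) * pOf τ := by
    rw [pOf, ← Complex.exp_add]; ring_nf
  rw [e1, e2, mul_comm (pOf τ) (cexp (-(2 * Real.pi * I * x)))]
  have e3 : cexp (-(Real.pi * I * (x + τ))) * (1 - cexp (-(2 * Real.pi * I * x))) =
      -cexp (-(Real.pi * I * (2 * x + τ))) * (cexp (-(Real.pi * I * x)) *
        (1 - cexp (2 * Real.pi * I * x))) := by
    simp only [mul_sub, mul_one, ← Complex.exp_add, neg_mul]
    ring_nf
  linear_combination (I * pPow τ (1 / 8) * qPoch (pOf τ) (pOf τ) *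
    qPoch (cexp (2 * Real.pi * I * x) * pOf τ) (pOf τ) *
    qPoch (cexp (-(2 * Real.pi * I * x)) * pOf τ) (pOf τ)) * e3

/-- The period lattice `ℤ + τ ℤ`. -/
def IsPeriod (τ x : ℂ) : Prop := ∃ m n : ℤ, x = m + n * τ

lemma exp_mul_pOf_pow_eq_one_iff (τ x : ℂ) (n : ℕ) :
    cexp (2 * Real.pi * I * x) * pOf τ ^ n = 1 ↔ ∃ m : ℤ, x = m - n * τ := by
  rw [pOf, ← Complex.exp_nat_mul, ← Complex.exp_add, Complex.exp_eq_one_iff]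
  refine exists_congr fun m => ?_
  have : (2 * Real.pi * I : ℂ) ≠ 0 := Complex.two_pi_I_ne_zero
  constructor
  · intro h
    have : (2 * Real.pi * I : ℂ) * (x - (m - n * τ)) = 0 := by linear_combination h
    simpa [sub_eq_zero] using this
  · rintro rfl; ring

lemma theta_eq_zero_iff {τ : ℂ} (hτ : 0 < τ.im) (x : ℂ) : theta τ x = 0 ↔ IsPeriod τ x := by
  have hp := norm_pOf_lt_one hτ
  rw [theta_eq, mul_eq_zero, mul_eq_zero (a := qPoch _ _),
    qPoch_eq_zero_iff hp (cexp _), qPoch_eq_zero_iff hp (_ * cexp _)]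
  have h0 : Complex.I * pPow τ (1 / 8) * Complex.exp (-(Real.pi * Complex.I * x)) *
      qPoch (pOf τ) (pOf τ) ≠ 0 := by
    simp [pPow_ne_zero, qPoch_self_ne_zero hτ]
  simp only [h0, false_or]
  have e : ∀ j : ℕ, pOf τ * cexp (-(2 * Real.pi * I * x)) * pOf τ ^ j =
      cexp (2 * Real.pi * I * (-x)) * pOf τ ^ (j + 1) := by
    intro j; rw [pow_succ]; ring_nf
  simp only [e, exp_mul_pOf_pow_eq_one_iff]
  constructor
  · rintro (⟨n, m, h⟩ | ⟨n, m, h⟩)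
    · exact ⟨m, -n, by rw [h]; push_cast; ring⟩
    · exact ⟨-m, n + 1, by rw [← neg_neg x, h]; push_cast; ring⟩
  · rintro ⟨m, n, h⟩
    rcases le_or_gt n 0 with hn | hn
    · obtain ⟨k, rfl⟩ : ∃ k : ℕ, n = -k := ⟨n.natAbs, by omega⟩
      exact Or.inl ⟨k, m, by rw [h]; push_cast; ring⟩
    · obtain ⟨k, rfl⟩ : ∃ k : ℕ, n = k + 1 := ⟨n.natAbs - 1, by omega⟩
      exact Or.inr ⟨k, -m, by rw [h]; push_cast; ring⟩

lemma theta_zero {τ : ℂ} (hτ : 0 < τ.im) : theta τ 0 = 0 :=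
  (theta_eq_zero_iff hτ 0).2 ⟨0, 0, by simp⟩

/-- The zero at the origin sits in the single factor 1 - exp(2πix); the remaining factor is entire,
so the derivative is -2πi times its value at 0. -/
lemma deriv_theta_zero {τ : ℂ} (hτ : 0 < τ.im) :
    deriv (theta τ) 0 = 2 * Real.pi * pPow τ (1 / 8) * qPoch (pOf τ) (pOf τ) ^ 3 := by
  have hp := norm_pOf_lt_one hτ
  have hq := differentiable_qPoch hp
  have e : theta τ = fun x => (1 - cexp (2 * Real.pi * I * x)) * (Complex.I * pPow τ (1 / 8) *
    Complex.exp (-(Real.pi * Complex.I * x)) * qPoch (pOf τ) (pOf τ) *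
      (qPoch (Complex.exp (2 * Real.pi * Complex.I * x) * pOf τ) (pOf τ) *
      qPoch (pOf τ * Complex.exp (-(2 * Real.pi * Complex.I * x))) (pOf τ))) := by
    funext x
    rw [theta_eq, qPoch_eq_mul hp (cexp (2 * Real.pi * I * x))]; ring
  have h1 : Differentiable ℂ fun x : ℂ =>
      qPoch (Complex.exp (2 * Real.pi * Complex.I * x) * pOf τ) (pOf τ) := hq.comp (by fun_prop)
  have h2 : Differentiable ℂ fun x : ℂ =>
      qPoch (pOf τ * Complex.exp (-(2 * Real.pi * Complex.I * x))) (pOf τ) := hq.comp (by fun_prop)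
  have hg : Differentiable ℂ fun x : ℂ => (Complex.I * pPow τ (1 / 8) *
    Complex.exp (-(Real.pi * Complex.I * x)) * qPoch (pOf τ) (pOf τ) *
      (qPoch (Complex.exp (2 * Real.pi * Complex.I * x) * pOf τ) (pOf τ) *
      qPoch (pOf τ * Complex.exp (-(2 * Real.pi * Complex.I * x))) (pOf τ))) := by
    fun_prop
  have hf : HasDerivAt (fun x : ℂ => 1 - cexp (2 * Real.pi * I * x)) (-(2 * Real.pi * I)) 0 := by
    have := (((hasDerivAt_id (0 : ℂ)).const_mul (2 * Real.pi * I : ℂ)).cexp).const_sub 1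
    simpa using this
  rw [e, (hf.fun_mul (hg 0).hasDerivAt).deriv]
  simp
  linear_combination (-2 * Real.pi * pPow τ 8⁻¹ * qPoch (pOf τ) (pOf τ) ^ 3) * Complex.I_mul_I

lemma deriv_theta_zero_ne_zero {τ : ℂ} (hτ : 0 < τ.im) : deriv (theta τ) 0 ≠ 0 := by
  rw [deriv_theta_zero hτ]
  have := qPoch_self_ne_zero hτ
  simp [this, pPow_ne_zero]

/-- Only the existence of a nowhere vanishing factor matters: it transports the simple zero at the
origin to every period. -/
lemma IsPeriod.theta_add {τ : ℂ} (hτ : 0 < τ.im) {l : ℂ} (hl : IsPeriod τ l) :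
    ∃ a b : ℂ, ∀ x, theta τ (x + l) = cexp (a * x + b) * theta τ x := by
  have h1 : ∀ m : ℤ, ∃ b : ℂ, ∀ x, theta τ (x + m) = cexp b * theta τ x := by
    intro m
    induction m using Int.induction_on with
    | zero => exact ⟨0, by simp⟩
    | succ k ih =>
      obtain ⟨b, h⟩ := ih
      refine ⟨b + Real.pi * I, fun x => ?_⟩
      push_cast at h ⊢
      rw [← add_assoc, theta_add_one, h, Complex.exp_add, Complex.exp_pi_mul_I]; ring
    | pred k ih =>
      obtain ⟨b, h⟩ := ih
      refine ⟨b + Real.pi * I, fun x => ?_⟩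
      push_cast at h ⊢
      have := theta_add_one τ (x + (-k - 1))
      rw [show x + (-(k : ℂ) - 1) + 1 = x + -k by ring, h] at this
      rw [Complex.exp_add, Complex.exp_pi_mul_I]
      linear_combination this
  have h2 : ∀ m : ℤ, ∃ a b : ℂ, ∀ x, theta τ (x + m * τ) = cexp (a * x + b) * theta τ x := by
    intro m
    induction m using Int.induction_on with
    | zero => exact ⟨0, 0, by simp⟩
    | succ k ih =>
      obtain ⟨a, b, h⟩ := ih
      refine ⟨a - 2 * Real.pi * I, b + Real.pi * I - Real.pi * I * (2 * k + 1) * τ, fun x => ?_⟩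
      push_cast at h ⊢
      have e : cexp ((a - 2 * Real.pi * I) * x +
          (b + Real.pi * I - Real.pi * I * (2 * k + 1) * τ)) =
          cexp (-(Real.pi * I * (2 * (x + k * τ) + τ))) * cexp (a * x + b) *
            cexp (Real.pi * I) := by
        simp only [← Complex.exp_add]; ring_nf
      rw [show x + ((k : ℂ) + 1) * τ = x + k * τ + τ by ring, theta_add_tau hτ, h, e,
        Complex.exp_pi_mul_I]
      ring
    | pred k ih =>
      obtain ⟨a, b, h⟩ := ih
      refine ⟨a + 2 * Real.pi * I, b + Real.pi * I + Real.pi * I * (2 * (-k - 1) + 1) * τ,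
        fun x => ?_⟩
      push_cast at h ⊢
      have := theta_add_tau hτ (x + (-k - 1) * τ)
      rw [show x + (-(k : ℂ) - 1) * τ + τ = x + -k * τ by ring, h] at this
      have e : cexp ((a + 2 * Real.pi * I) * x +
          (b + Real.pi * I + Real.pi * I * (2 * (-k - 1) + 1) * τ)) =
          cexp (Real.pi * I * (2 * (x + (-k - 1) * τ) + τ)) * cexp (a * x + b) *
            cexp (Real.pi * I) := by
        simp only [← Complex.exp_add]; ring_nf
      rw [e, Complex.exp_pi_mul_I, mul_assoc, mul_assoc, mul_left_comm (cexp (a * x + b)), this,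
        Complex.exp_neg]
      field_simp
  obtain ⟨m, n, rfl⟩ := hl
  obtain ⟨b, hb⟩ := h1 m
  obtain ⟨a', b', hb'⟩ := h2 n
  refine ⟨a', a' * m + b' + b, fun x => ?_⟩
  rw [← add_assoc, hb', hb, ← mul_assoc, ← Complex.exp_add]
  ring_nf

lemma deriv_theta_ne_zero {τ : ℂ} (hτ : 0 < τ.im) {l : ℂ} (hl : theta τ l = 0) :
    deriv (theta τ) l ≠ 0 := by
  obtain ⟨a, b, h⟩ := ((theta_eq_zero_iff hτ l).1 hl).theta_add hτ
  have h1 : deriv (fun x => theta τ (x + l)) 0 = deriv (theta τ) l := by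
    rw [deriv_comp_add_const, zero_add]
  have hd : HasDerivAt (fun x : ℂ => cexp (a * x + b)) (cexp (a * 0 + b) * a) 0 := by
    simpa using (((hasDerivAt_id (0 : ℂ)).const_mul a).add_const b).cexp
  rw [← h1, funext h, (hd.fun_mul (differentiable_theta hτ 0).hasDerivAt).deriv, theta_zero hτ]
  simp [deriv_theta_zero_ne_zero hτ]

lemma IsPeriod.add {τ x y : ℂ} (hx : IsPeriod τ x) (hy : IsPeriod τ y) : IsPeriod τ (x + y) := by
  obtain ⟨m, n, rfl⟩ := hx
  obtain ⟨m', n', rfl⟩ := hy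
  exact ⟨m + m', n + n', by push_cast; ring⟩

lemma IsPeriod.neg {τ x : ℂ} (hx : IsPeriod τ x) : IsPeriod τ (-x) := by
  obtain ⟨m, n, rfl⟩ := hx
  exact ⟨-m, -n, by push_cast; ring⟩

lemma IsPeriod.sub {τ x y : ℂ} (hx : IsPeriod τ x) (hy : IsPeriod τ y) : IsPeriod τ (x - y) :=
  sub_eq_add_neg x y ▸ hx.add hy.neg

/-- Two continuous functions that agree off the zeros of a nonzero entire function are equal. -/
lemma eq_of_eq_of_ne_zero {f g h : ℂ → ℂ} (hf : Continuous f) (hg : Continuous g)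
    (hh : Differentiable ℂ h) {x₀ : ℂ} (hx₀ : h x₀ ≠ 0) (H : ∀ x, h x ≠ 0 → f x = g x) :
    f = g := by
  have hA : AnalyticOnNhd ℂ h Set.univ := fun x _ => hh.analyticAt x
  have hd : Dense {x | h x ≠ 0} := by
    intro x
    rw [mem_closure_iff_frequently]
    by_contra hc
    rw [Filter.not_frequently] at hc
    have := hA.eqOn_zero_of_preconnected_of_eventuallyEq_zero isPreconnected_univ (Set.mem_univ x)
      (by filter_upwards [hc] with y hy using by simpa using hy)
    exact hx₀ (this (Set.mem_univ x₀))
  exact hf.ext_on hd hg H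

/-! ### Entire quotients and doubly periodic functions -/

/-- Near a zero x of `h` the quotient equals `dslope g x / dslope h x`, whose denominator at x is
the nonzero derivative of `h`; the singularity is therefore removable. -/
lemma exists_entire_quotient {g h : ℂ → ℂ} (hg : Differentiable ℂ g) (hh : Differentiable ℂ h)
    (hz : ∀ x, h x = 0 → deriv h x ≠ 0 ∧ g x = 0) :
    ∃ F : ℂ → ℂ, Differentiable ℂ F ∧ ∀ x, g x = F x * h x := by
  classical
  refine ⟨fun x => if h x = 0 then deriv g x / deriv h x else g x / h x, fun x => ?_, fun x => ?_⟩
  · by_cases hx : h x = 0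
    · obtain ⟨hd, hgx⟩ := hz x hx
      have dg : Differentiable ℂ (dslope g x) := fun y =>
        (((Complex.differentiableOn_dslope (s := Set.univ) univ_mem).2 hg.differentiableOn) y
          trivial).differentiableAt univ_mem
      have dh : Differentiable ℂ (dslope h x) := fun y =>
        (((Complex.differentiableOn_dslope (s := Set.univ) univ_mem).2 hh.differentiableOn) y
          trivial).differentiableAt univ_mem
      have hne : dslope h x x ≠ 0 := by simpa using hd
      have hev : ∀ᶠ y in 𝓝 x, dslope h x y ≠ 0 := dh.continuous.continuousAt.eventually_ne hne
      refine ((dg x).div (dh x) hne).congr_of_eventuallyEq ?_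
      filter_upwards [hev] with y hy
      by_cases hxy : y = x
      · subst hxy; simp [hx]
      · have e1 := sub_smul_dslope g x y
        have e2 := sub_smul_dslope h x y
        rw [hgx, sub_zero, smul_eq_mul] at e1
        rw [hx, sub_zero, smul_eq_mul] at e2
        have hyx : y - x ≠ 0 := sub_ne_zero.2 hxy
        have : h y ≠ 0 := by rw [← e2]; exact mul_ne_zero hyx hy
        simp only [this, if_false, Pi.div_apply]
        rw [← e1, ← e2, mul_div_mul_left _ _ hyx]
    · have hev : ∀ᶠ y in 𝓝 x, h y ≠ 0 := hh.continuous.continuousAt.eventually_ne hx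
      refine ((hg x).div (hh x) hx).congr_of_eventuallyEq ?_
      filter_upwards [hev] with y hy
      simp [hy]
  · by_cases hx : h x = 0
    · simp [hx, (hz x hx).2]
    · simp [hx]

/-- Liouville's theorem: all values are already taken on the compact parallelogram spanned by 1 and
τ. -/
lemma apply_eq_apply_of_doubly_periodic {τ : ℂ} (hτ : 0 < τ.im) {F : ℂ → ℂ}
    (hF : Differentiable ℂ F) (h1 : Function.Periodic F 1) (h2 : Function.Periodic F τ)
    (x y : ℂ) : F x = F y := by
  refine hF.apply_eq_apply_of_bounded ?_ x y
  have hK : IsCompact ((fun ab : ℝ × ℝ => (ab.1 + ab.2 * τ : ℂ)) ''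
      (Set.Icc (0 : ℝ) 1 ×ˢ Set.Icc (0 : ℝ) 1)) :=
    (isCompact_Icc.prod isCompact_Icc).image (by fun_prop)
  refine (hK.image hF.continuous).isBounded.subset ?_
  rintro _ ⟨z, rfl⟩
  set b : ℝ := z.im / τ.im with hb
  set a : ℝ := z.re - b * τ.re with ha
  have hz : z = a + b * τ := by
    apply Complex.ext
    · simp [ha]
    · simp [hb, hτ.ne']
  have hper : F (Int.fract a + Int.fract b * τ) = F z := by
    rw [hz]
    nth_rw 2 [← Int.fract_add_floor a, ← Int.fract_add_floor b]
    have e : (((Int.fract a + ⌊a⌋ : ℝ) : ℂ) + ((Int.fract b + ⌊b⌋ : ℝ) : ℂ) * τ) =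
      (Int.fract a + Int.fract b * τ) + ⌊a⌋ * 1 + ⌊b⌋ * τ := by push_cast; ring
    rw [e, (h2.int_mul _ _), (h1.int_mul _ _)]
  exact ⟨_, ⟨(Int.fract a, Int.fract b), ⟨⟨Int.fract_nonneg a, (Int.fract_lt_one a).le⟩,
    ⟨Int.fract_nonneg b, (Int.fract_lt_one b).le⟩⟩, rfl⟩, hper⟩

lemma quasi_periodic_int {τ : ℂ} {M : ℕ} {g : ℂ → ℂ} (h1 : ∀ x, g (x + 1) = g x)
    (h2 : ∀ x, g (x + τ) = cexp (-(2 * Real.pi * I * M * (2 * x + τ))) * g x) (m n : ℤ) (x : ℂ) :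
    g (x + (m + n * τ)) = cexp (-(2 * Real.pi * I * M * (2 * n * x + n ^ 2 * τ))) * g x := by
  have hper : Function.Periodic g 1 := h1
  have e1 : g (x + (m + n * τ)) = g (x + n * τ) := by
    rw [show x + (m + n * τ) = x + n * τ + m * 1 by ring, hper.int_mul]
  rw [e1]
  clear e1
  induction n using Int.induction_on with
  | zero => simp
  | succ k ih =>
    push_cast at ih ⊢
    rw [show x + ((k : ℂ) + 1) * τ = x + k * τ + τ by ring, h2, ih, ← mul_assoc, ← Complex.exp_add]
    ring_nf
  | pred k ih =>
    push_cast at ih ⊢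
    have := h2 (x + (-k - 1) * τ)
    rw [show x + (-(k : ℂ) - 1) * τ + τ = x + -k * τ by ring, ih] at this
    have h3 := congrArg (cexp (2 * Real.pi * I * M * (2 * (x + (-k - 1) * τ) + τ)) * ·) this
    simp only [← mul_assoc, ← Complex.exp_add, add_neg_cancel, Complex.exp_zero, one_mul] at h3
    rw [← h3]
    ring_nf

/-- An odd function with the quasi-periodicity of even theta functions vanishes at half periods. -/
lemma odd_quasi_periodic_eq_zero {τ : ℂ} {M : ℕ} {g : ℂ → ℂ} (h1 : ∀ x, g (x + 1) = g x)
    (h2 : ∀ x, g (x + τ) = cexp (-(2 * Real.pi * I * M * (2 * x + τ))) * g x)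
    (hodd : ∀ x, g (-x) = -g x) {x : ℂ} (hx : IsPeriod τ (2 * x)) : g x = 0 := by
  obtain ⟨m, n, hx⟩ := hx
  have h := quasi_periodic_int h1 h2 m n (-x)
  rw [← hx, show -x + 2 * x = x by ring, hodd] at h
  -- Since 2x = m + nτ, the exponent reduces to 2πi M n m.
  have e : cexp (-(2 * Real.pi * I * M * (2 * n * -x + n ^ 2 * τ))) = 1 := by
    rw [Complex.exp_eq_one_iff]
    refine ⟨M * n * m, ?_⟩
    push_cast
    linear_combination (2 * Real.pi * I * M * n) * hx
  rw [e] at h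
  linear_combination h / 2

/-! ### Weierstrass's addition formula -/

lemma theta_mul_add_one (τ x z : ℂ) :
    theta τ (x + 1 + z) * theta τ (x + 1 - z) = theta τ (x + z) * theta τ (x - z) := by
  rw [show x + 1 + z = x + z + 1 by ring, show x + 1 - z = x - z + 1 by ring, theta_add_one,
    theta_add_one]; ring

lemma theta_mul_add_tau {τ : ℂ} (hτ : 0 < τ.im) (x z : ℂ) :
    theta τ (x + τ + z) * theta τ (x + τ - z) =
      cexp (-(2 * Real.pi * I * (2 * x + τ))) * (theta τ (x + z) * theta τ (x - z)) := by
  have e : cexp (-(2 * Real.pi * I * (2 * x + τ))) =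
      cexp (-(Real.pi * I * (2 * (x + z) + τ))) * cexp (-(Real.pi * I * (2 * (x - z) + τ))) := by
    rw [← Complex.exp_add]; ring_nf
  rw [show x + τ + z = x + z + τ by ring, show x + τ - z = x - z + τ by ring, theta_add_tau hτ,
    theta_add_tau hτ, e]
  ring

lemma theta_mul_neg {τ : ℂ} (hτ : 0 < τ.im) (x z : ℂ) :
    theta τ (-x + z) * theta τ (-x - z) = theta τ (x + z) * theta τ (x - z) := by
  rw [show -x + z = -(x - z) by ring, show -x - z = -(x + z) by ring, theta_neg hτ, theta_neg hτ]
  ring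

/-- As functions of x, both sides are even with the same quasi-periodicity, and the left side
vanishes at all zeros ±y + periods of the right. These zeros are simple because θ(2y) ≠ 0, so the
quotient is entire and doubly periodic, hence constant. Its value is read off at x = w, where the
conditions on y ± w keep the denominator nonzero. -/
lemma weierstrass_aux {τ : ℂ} (hτ : 0 < τ.im) (x y z w : ℂ) (hy : theta τ (2 * y) ≠ 0)
    (hyw : theta τ (y + w) ≠ 0) (hyw' : theta τ (y - w) ≠ 0) :
    theta τ (x + z) * theta τ (x - z) * (theta τ (y + w) * theta τ (y - w)) -
      theta τ (x + w) * theta τ (x - w) * (theta τ (y + z) * theta τ (y - z)) =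
    theta τ (x + y) * theta τ (x - y) * (theta τ (z + w) * theta τ (z - w)) := by
  have hθ := differentiable_theta hτ
  have hdd : ∀ z, Differentiable ℂ fun x => theta τ (x + z) * theta τ (x - z) := fun z =>
    (hθ.comp (by fun_prop : Differentiable ℂ fun x : ℂ => x + z)).mul
      (hθ.comp (by fun_prop : Differentiable ℂ fun x : ℂ => x - z))
  set h : ℂ → ℂ := fun x => theta τ (x + y) * theta τ (x - y) with hh
  set g : ℂ → ℂ := fun x =>
    theta τ (x + z) * theta τ (x - z) * (theta τ (y + w) * theta τ (y - w)) -
      theta τ (x + w) * theta τ (x - w) * (theta τ (y + z) * theta τ (y - z)) with hg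
  have dg : Differentiable ℂ g := ((hdd z).mul_const _).sub ((hdd w).mul_const _)
  have g1 : ∀ x, g (x + 1) = g x := fun x => by simp only [hg, theta_mul_add_one]
  have g2 : ∀ x, g (x + τ) = cexp (-(2 * Real.pi * I * (1 : ℕ) * (2 * x + τ))) * g x := fun x => by
    simp only [hg, theta_mul_add_tau hτ, Nat.cast_one, mul_one]; ring
  have gneg : ∀ x, g (-x) = g x := fun x => by simp only [hg, theta_mul_neg hτ]
  have gy : g y = 0 := by simp only [hg]; ring
  have gper : ∀ l, IsPeriod τ l → g (y + l) = 0 := by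
    rintro l ⟨m, n, rfl⟩
    rw [quasi_periodic_int g1 g2, gy, mul_zero]
  have h1 : ∀ x, h (x + 1) = h x := fun x => by simp only [hh, theta_mul_add_one]
  have h2 : ∀ x, h (x + τ) = cexp (-(2 * Real.pi * I * (2 * x + τ))) * h x := fun x => by
    simp only [hh, theta_mul_add_tau hτ]
  have hquot : ∀ x, h x = 0 → deriv h x ≠ 0 ∧ g x = 0 := by
    intro x hx
    have hder : deriv h x = deriv (theta τ) (x + y) * theta τ (x - y) +
        theta τ (x + y) * deriv (theta τ) (x - y) := by
      have a1 : HasDerivAt (fun x => theta τ (x + y)) (deriv (theta τ) (x + y)) x := by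
        simpa using (hθ (x + y)).hasDerivAt.comp_add_const x y
      have a2 : HasDerivAt (fun x => theta τ (x - y)) (deriv (theta τ) (x - y)) x := by
        simpa using (hθ (x - y)).hasDerivAt.comp_sub_const x y
      exact (a1.fun_mul a2).deriv
    have key : ¬ (theta τ (x + y) = 0 ∧ theta τ (x - y) = 0) := by
      rintro ⟨ha, hb⟩
      rw [theta_eq_zero_iff hτ] at ha hb
      have := ha.sub hb
      rw [show x + y - (x - y) = 2 * y by ring, ← theta_eq_zero_iff hτ] at this
      exact hy this
    rcases mul_eq_zero.1 hx with ha | ha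
    · have hb : theta τ (x - y) ≠ 0 := fun hb => key ⟨ha, hb⟩
      refine ⟨by rw [hder, ha, zero_mul, add_zero]
                 exact mul_ne_zero (deriv_theta_ne_zero hτ ha) hb,
        ?_⟩
      rw [← gneg, show -x = y + -(x + y) by ring]
      exact gper _ ((theta_eq_zero_iff hτ _).1 ha).neg
    · have hb : theta τ (x + y) ≠ 0 := fun hb => key ⟨hb, ha⟩
      refine ⟨by rw [hder, ha, mul_zero, zero_add]
                 exact mul_ne_zero hb (deriv_theta_ne_zero hτ ha),
        ?_⟩
      rw [show x = y + (x - y) by ring]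
      exact gper _ ((theta_eq_zero_iff hτ _).1 ha)
  obtain ⟨F, dF, hF⟩ := exists_entire_quotient dg (hdd y) hquot
  have h0 : h w ≠ 0 := by
    refine mul_ne_zero (by rwa [add_comm]) ?_
    rw [← neg_sub, theta_neg hτ]; exact neg_ne_zero.2 hyw'
  have F1 : Function.Periodic F 1 := by
    refine congrFun (eq_of_eq_of_ne_zero (f := fun x => F (x + 1)) (g := F)
      (dF.continuous.comp (by fun_prop)) dF.continuous (hdd y) h0 fun x hx => ?_)
    have := hF (x + 1)
    rw [g1, hF x] at this
    change F x * h x = F (x + 1) * h (x + 1) at this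
    rw [h1] at this
    exact (mul_right_cancel₀ hx this).symm
  have F2 : Function.Periodic F τ := by
    refine congrFun (eq_of_eq_of_ne_zero (f := fun x => F (x + τ)) (g := F)
      (dF.continuous.comp (by fun_prop)) dF.continuous (hdd y) h0 fun x hx => ?_)
    have := hF (x + τ)
    rw [g2, hF x] at this
    change _ * (F x * h x) = F (x + τ) * h (x + τ) at this
    rw [h2, Nat.cast_one, mul_one] at this
    have h3 : cexp (-(2 * Real.pi * I * (2 * x + τ))) * h x ≠ 0 :=
      mul_ne_zero (Complex.exp_ne_zero _) hx
    refine (mul_right_cancel₀ h3 ?_).symm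
    linear_combination this
  have hFw : F w = theta τ (z + w) * theta τ (z - w) := by
    have := hF w
    change g w = F w * h w at this
    refine mul_right_cancel₀ h0 ?_
    rw [← this]
    simp only [hg, hh, sub_self, theta_zero hτ]
    rw [show w - y = -(y - w) by ring, show w - z = -(z - w) by ring, theta_neg hτ, theta_neg hτ]
    ring_nf
  change g x = h x * _
  rw [hF x, apply_eq_apply_of_doubly_periodic hτ dF F1 F2 x w, hFw]
  simp only [hh]; ring

lemma countable_theta_zeros {τ : ℂ} (hτ : 0 < τ.im) : {x | theta τ x = 0}.Countable := by
  refine (Set.countable_range fun mn : ℤ × ℤ => (mn.1 + mn.2 * τ : ℂ)).mono ?_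
  intro x hx
  obtain ⟨m, n, rfl⟩ := (theta_eq_zero_iff hτ x).1 hx
  exact ⟨(m, n), rfl⟩

/-- Weierstrass's three-term addition formula. -/
lemma weierstrass_addition {τ : ℂ} (hτ : 0 < τ.im) (x y z w : ℂ) :
    theta τ (x + z) * theta τ (x - z) * (theta τ (y + w) * theta τ (y - w)) -
      theta τ (x + w) * theta τ (x - w) * (theta τ (y + z) * theta τ (y - z)) =
    theta τ (x + y) * theta τ (x - y) * (theta τ (z + w) * theta τ (z - w)) := by
  have hc := countable_theta_zeros hτ
  -- The exceptional y form a countable set, whose complement is dense; continuity in y does the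
  -- rest.
  have hS : ({y | theta τ (2 * y) = 0} ∪ {y | theta τ (y + w) = 0} ∪
      {y | theta τ (y - w) = 0}).Countable := by
    refine (Set.Countable.union ?_ ?_).union ?_
    · exact hc.preimage_of_injOn (f := fun y => 2 * y) fun a _ b _ h => by simpa using h
    · exact hc.preimage_of_injOn (f := fun y => y + w) fun a _ b _ h => by simpa using h
    · exact hc.preimage_of_injOn (f := fun y => y - w) fun a _ b _ h => by simpa using h
  have hθ := (differentiable_theta hτ).continuous
  refine congrFun (Continuous.ext_on (hS.dense_compl ℂ) (f := fun y =>
    theta τ (x + z) * theta τ (x - z) * (theta τ (y + w) * theta τ (y - w)) -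
      theta τ (x + w) * theta τ (x - w) * (theta τ (y + z) * theta τ (y - z)))
    (g := fun y => theta τ (x + y) * theta τ (x - y) * (theta τ (z + w) * theta τ (z - w)))
    (by fun_prop) (by fun_prop) fun y hy => ?_) y
  simp only [Set.mem_compl_iff, Set.mem_union, Set.mem_ofPred_eq, not_or] at hy
  exact weierstrass_aux hτ x y z w hy.1.1 hy.1.2 hy.2

/-! ### The even theta function -/

/-- The theta function `(p, -p^(1/2) exp(2π i x), -p^(1/2) exp(-2π i x); p)_∞`. -/
def theta3 (τ x : ℂ) : ℂ :=
  qPoch (pOf τ) (pOf τ) * (qPoch (-pPow τ (1 / 2) * cexp (2 * Real.pi * I * x)) (pOf τ) *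
    qPoch (-pPow τ (1 / 2) * cexp (-(2 * Real.pi * I * x))) (pOf τ))

lemma theta3_neg (τ x : ℂ) : theta3 τ (-x) = theta3 τ x := by
  simp only [theta3, mul_neg, neg_neg]; ring

lemma theta3_add_one (τ x : ℂ) : theta3 τ (x + 1) = theta3 τ x := by
  rw [theta3, theta3, Complex.exp_neg, exp_two_pi_I_add_one, ← Complex.exp_neg]

/-- All theta factors in the kernel and in the denominator of the weight carry the offset 1/2 + τ/2.
Passing to `theta3` absorbs it and gives factors that are even and exactly 1-periodic. -/
lemma theta_add_half (τ x : ℂ) : theta τ (x + (1 / 2 + τ / 2)) =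
    pPow τ (-1 / 8) * cexp (-(Real.pi * I * x)) * theta3 τ x := by
  have e1 : cexp (2 * Real.pi * I * (x + (1 / 2 + τ / 2))) =
      -pPow τ (1 / 2) * cexp (2 * Real.pi * I * x) := by
    rw [pPow, neg_mul, ← Complex.exp_add, neg_eq_neg_one_mul, ← Complex.exp_pi_mul_I,
      ← Complex.exp_add]
    ring_nf
  have e2 : pOf τ * cexp (-(2 * Real.pi * I * (x + (1 / 2 + τ / 2)))) =
      -pPow τ (1 / 2) * cexp (-(2 * Real.pi * I * x)) := by
    rw [Complex.exp_neg, e1, Complex.exp_neg, ← pPow_one, show (1 : ℂ) = 1 / 2 + 1 / 2 by norm_num,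
      pPow_add]
    have := pPow_ne_zero τ (1 / 2)
    field_simp
    norm_num
    field_simp
  have e3 : I * pPow τ (1 / 8) * cexp (-(Real.pi * I * (x + (1 / 2 + τ / 2)))) =
      pPow τ (-1 / 8) * cexp (-(Real.pi * I * x)) := by
    have : (-(Real.pi * I * (x + (1 / 2 + τ / 2)))) =
      -(Real.pi / 2 * I) + (-(Real.pi * I * τ / 2) + -(Real.pi * I * x)) := by ring
    rw [this, Complex.exp_add, Complex.exp_neg (Real.pi / 2 * I), Complex.exp_pi_div_two_mul_I,
      Complex.exp_add, pPow, pPow]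
    have h : cexp (2 * Real.pi * I * (1 / 8) * τ) * cexp (-(Real.pi * I * τ / 2)) =
      cexp (2 * Real.pi * I * (-1 / 8) * τ) := by
      rw [← Complex.exp_add]; ring_nf
    rw [← h, Complex.inv_I]
    linear_combination (-(cexp (2 * Real.pi * I * (1 / 8) * τ) * cexp (-(Real.pi * I * τ / 2)) *
      cexp (-(Real.pi * I * x)))) * I_mul_I
  rw [theta_eq, e1, e2, e3, theta3]; ring

lemma theta_sub_half {τ : ℂ} (hτ : 0 < τ.im) (x : ℂ) : theta τ (x - (1 / 2 + τ / 2)) =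
    -(pPow τ (-1 / 8) * cexp (Real.pi * I * x) * theta3 τ x) := by
  rw [show x - (1 / 2 + τ / 2) = -(-x + (1 / 2 + τ / 2)) by ring, theta_neg hτ, theta_add_half,
    theta3_neg]
  ring_nf

lemma theta3_eq (τ x : ℂ) : theta3 τ x =
    pPow τ (1 / 8) * cexp (Real.pi * I * x) * theta τ (x + (1 / 2 + τ / 2)) := by
  have h1 : pPow τ (1 / 8) * pPow τ (-1 / 8) = 1 := by
    rw [← pPow_add]; simp [pPow, neg_div]
  have h2 : cexp (Real.pi * I * x) * cexp (-(Real.pi * I * x)) = 1 := by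
    rw [← Complex.exp_add]; simp
  rw [theta_add_half]
  linear_combination (-theta3 τ x) * h1 - (theta3 τ x * (pPow τ (1 / 8) * pPow τ (-1 / 8))) * h2

lemma differentiable_theta3 {τ : ℂ} (hτ : 0 < τ.im) : Differentiable ℂ (theta3 τ) := by
  have h : Differentiable ℂ fun x => theta τ (x + (1 / 2 + τ / 2)) :=
    (differentiable_theta hτ).comp (by fun_prop)
  rw [show theta3 τ = fun x => _ from funext (theta3_eq τ)]
  fun_prop

lemma theta3_add_tau {τ : ℂ} (hτ : 0 < τ.im) (x : ℂ) :
    theta3 τ (x + τ) = cexp (-(Real.pi * I * (2 * x + τ))) * theta3 τ x := by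
  have e : -(cexp (Real.pi * I * (x + τ)) *
      cexp (-(Real.pi * I * (2 * (x + (1 / 2 + τ / 2)) + τ)))) =
      cexp (-(Real.pi * I * (2 * x + τ))) * cexp (Real.pi * I * x) := by
    rw [neg_eq_neg_one_mul, ← Complex.exp_pi_mul_I]
    simp only [← Complex.exp_add]; ring_nf
  rw [theta3_eq, theta3_eq, show x + τ + (1 / 2 + τ / 2) = x + (1 / 2 + τ / 2) + τ by ring,
    theta_add_tau hτ]
  linear_combination (pPow τ (1 / 8) * theta τ (x + (1 / 2 + τ / 2))) * e

lemma isPeriod_of_theta3_eq_zero {τ : ℂ} (hτ : 0 < τ.im) {x : ℂ} (h : theta3 τ x = 0) :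
    IsPeriod τ (x + (1 / 2 + τ / 2)) := by
  rw [← theta_eq_zero_iff hτ, theta_add_half, h, mul_zero]

/-- The zeros are the points (1 + τ)/2 + periods, so their imaginary parts are odd multiples of Im τ
/ 2. For purely imaginary τ their real parts are likewise odd multiples of 1/2. -/
lemma theta3_ne_zero_of_im {τ : ℂ} (hτ : 0 < τ.im) {x : ℂ} (h : |x.im| < τ.im / 2) :
    theta3 τ x ≠ 0 := by
  intro h0
  obtain ⟨m, n, e⟩ := isPeriod_of_theta3_eq_zero hτ h0
  have him := congrArg Complex.im e
  simp at him
  rw [abs_lt] at h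
  have h1 : (n : ℝ) * τ.im > 0 := by linarith
  have h2 : (n : ℝ) * τ.im < 1 * τ.im := by linarith
  have h3 : (0 : ℝ) < n := pos_of_mul_pos_left h1 hτ.le
  have h4 : (n : ℝ) < 1 := lt_of_mul_lt_mul_right h2 hτ.le
  have h5 : (0 : ℤ) < n := by exact_mod_cast h3
  have h6 : n < 1 := by exact_mod_cast h4
  omega

lemma theta3_ne_zero_of_re {τ : ℂ} (hτ : 0 < τ.im) (hre : τ.re = 0) {x : ℂ}
    (h : |x.re| < 1 / 2) : theta3 τ x ≠ 0 := by
  intro h0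
  obtain ⟨m, n, e⟩ := isPeriod_of_theta3_eq_zero hτ h0
  have her := congrArg Complex.re e
  simp [hre] at her
  rw [abs_lt] at h
  have h3 : (0 : ℝ) < m := by linarith
  have h4 : (m : ℝ) < 1 := by linarith
  have h5 : (0 : ℤ) < m := by exact_mod_cast h3
  have h6 : m < 1 := by exact_mod_cast h4
  omega

/-- Weierstrass's addition formula with four even theta functions on either side. -/
lemma theta3_addition {τ : ℂ} (hτ : 0 < τ.im) (x y z w : ℂ) :
    theta3 τ (x + z) * theta3 τ (x - z) * (theta3 τ (y + w) * theta3 τ (y - w)) -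
      theta3 τ (x + w) * theta3 τ (x - w) * (theta3 τ (y + z) * theta3 τ (y - z)) =
    theta τ (x + y) * theta τ (x - y) * (theta τ (z + w) * theta τ (z - w)) := by
  -- Moving both x and y by the half period turns every factor on the left into `theta3`, while x -
  -- y is unchanged and x + y moves by the full period 1 + τ.
  have W := weierstrass_addition hτ (x + (1 / 2 + τ / 2)) (y + (1 / 2 + τ / 2)) z w
  have sh : ∀ a b : ℂ, a + (1 / 2 + τ / 2) + b = a + b + (1 / 2 + τ / 2) := fun a b => by ring
  have sh' : ∀ a b : ℂ, a + (1 / 2 + τ / 2) - b = a - b + (1 / 2 + τ / 2) := fun a b => by ring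
  rw [show x + (1 / 2 + τ / 2) - (y + (1 / 2 + τ / 2)) = x - y by ring,
    show x + (1 / 2 + τ / 2) + (y + (1 / 2 + τ / 2)) = x + y + τ + 1 by ring,
    sh, sh, sh, sh, sh', sh', sh', sh'] at W
  simp only [theta_add_half, theta_add_one, theta_add_tau hτ] at W
  have e : ∀ a b : ℂ, cexp (-(Real.pi * I * (a + b))) * cexp (-(Real.pi * I * (a - b))) =
      cexp (-(2 * Real.pi * I * a)) := fun a b => by rw [← Complex.exp_add]; ring_nf
  have e4 : pPow τ (-1 / 8) ^ 4 * cexp (-(2 * Real.pi * I * x)) * cexp (-(2 * Real.pi * I * y)) =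
      cexp (-(Real.pi * I * (2 * (x + y) + τ))) := by
    rw [pPow, ← Complex.exp_nat_mul, ← Complex.exp_add, ← Complex.exp_add]
    push_cast; ring_nf
  have hne := Complex.exp_ne_zero (-(Real.pi * I * (2 * (x + y) + τ)))
  refine mul_left_cancel₀ hne ?_
  have exz := e x z
  have exw := e x w
  have eyz := e y z
  have eyw := e y w
  have E1 : cexp (-(Real.pi * I * (x + z))) * cexp (-(Real.pi * I * (x - z))) *
      (cexp (-(Real.pi * I * (y + w))) * cexp (-(Real.pi * I * (y - w)))) * pPow τ (-1 / 8) ^ 4 =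
      cexp (-(Real.pi * I * (2 * (x + y) + τ))) := by
    rw [exz, eyw, ← e4]; ring
  have E2 : cexp (-(Real.pi * I * (x + w))) * cexp (-(Real.pi * I * (x - w))) *
      (cexp (-(Real.pi * I * (y + z))) * cexp (-(Real.pi * I * (y - z)))) * pPow τ (-1 / 8) ^ 4 =
      cexp (-(Real.pi * I * (2 * (x + y) + τ))) := by
    rw [exw, eyz, ← e4]; ring
  linear_combination W - (theta3 τ (x + z) * theta3 τ (x - z) *
    (theta3 τ (y + w) * theta3 τ (y - w))) * E1 + (theta3 τ (x + w) * theta3 τ (x - w) *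
    (theta3 τ (y + z) * theta3 τ (y - z))) * E2

/-- Weierstrass's addition formula with two even theta functions in each term. -/
lemma theta3_theta_addition {τ : ℂ} (hτ : 0 < τ.im) (u v c a : ℂ) :
    theta3 τ (u + v + c) * theta3 τ (u - v + c) * (theta τ (u - c + a) * theta τ (u - c - a)) -
      theta3 τ (u + v - c) * theta3 τ (u - v - c) * (theta τ (u + c + a) * theta τ (u + c - a)) =
    -(theta τ (2 * u) * theta τ (2 * c) * (theta3 τ (v + a) * theta3 τ (v - a))) := by
  -- Here only the third variable is moved by the half period, so each term acquires exactly two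
  -- `theta3` factors.
  have W := weierstrass_addition hτ (u + c) (u - c) (v + (1 / 2 + τ / 2)) a
  rw [show u + c + (v + (1 / 2 + τ / 2)) = u + v + c + (1 / 2 + τ / 2) by ring,
    show u + c - (v + (1 / 2 + τ / 2)) = u - v + c - (1 / 2 + τ / 2) by ring,
    show u - c + (v + (1 / 2 + τ / 2)) = u + v - c + (1 / 2 + τ / 2) by ring,
    show u - c - (v + (1 / 2 + τ / 2)) = u - v - c - (1 / 2 + τ / 2) by ring,
    show v + (1 / 2 + τ / 2) + a = v + a + (1 / 2 + τ / 2) by ring,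
    show v + (1 / 2 + τ / 2) - a = v - a + (1 / 2 + τ / 2) by ring,
    show u + c + (u - c) = 2 * u by ring, show u + c - (u - c) = 2 * c by ring] at W
  simp only [theta_add_half, theta_sub_half hτ] at W
  have e : ∀ b : ℂ, cexp (-(Real.pi * I * (u + v + b))) * cexp (Real.pi * I * (u - v + b)) =
      cexp (-(2 * Real.pi * I * v)) := fun b => by rw [← Complex.exp_add]; ring_nf
  have e3 : cexp (-(Real.pi * I * (v + a))) * cexp (-(Real.pi * I * (v - a))) =
      cexp (-(2 * Real.pi * I * v)) := by rw [← Complex.exp_add]; ring_nf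
  have e1 := e c
  have e2 := e (-c)
  rw [← sub_eq_add_neg, ← sub_eq_add_neg] at e2
  have hne : pPow τ (-1 / 8) ^ 2 * cexp (-(2 * Real.pi * I * v)) ≠ 0 :=
    mul_ne_zero (pow_ne_zero _ (pPow_ne_zero _ _)) (Complex.exp_ne_zero _)
  refine mul_left_cancel₀ hne ?_
  linear_combination -W - (pPow τ (-1 / 8) ^ 2 * (theta3 τ (u + v + c) * theta3 τ (u - v + c) *
    (theta τ (u - c + a) * theta τ (u - c - a)))) * e1 +
    (pPow τ (-1 / 8) ^ 2 * (theta3 τ (u + v - c) * theta3 τ (u - v - c) *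
    (theta τ (u + c + a) * theta τ (u + c - a)))) * e2 -
    (pPow τ (-1 / 8) ^ 2 * (theta τ (2 * u) * theta τ (2 * c) *
    (theta3 τ (v + a) * theta3 τ (v - a)))) * e3

/-! ### Contour shifts -/

/-- Cauchy's theorem on a rectangle of width T and height Im a: the vertical sides cancel by
periodicity. The remaining shift by Re a is a translation of a periodic function. -/
lemma integral_add_eq_of_periodic {T : ℝ} {g : ℂ → ℂ} (hper : ∀ z, g (z + T) = g z) (a : ℂ)
    (hd : ∀ z : ℂ, z.im ∈ Set.uIcc 0 a.im → DifferentiableAt ℂ g z) :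
    ∫ x in (0 : ℝ)..T, g (x + a) = ∫ x in (0 : ℝ)..T, g x := by
  have hrect := integral_boundary_rect_eq_zero_of_differentiableOn g 0 (T + a.im * I) (by
    intro z hz
    refine (hd z ?_).differentiableWithinAt
    simpa using hz.2)
  have e : ∀ y : ℝ, g (T + y * I) = g (y * I) := fun y => by rw [add_comm, hper]
  simp [e] at hrect
  have hp : Function.Periodic (fun x : ℝ => g (x + a.im * I)) T := fun x => by
    simp only [ofReal_add]
    rw [add_right_comm, hper]
  have h2 := hp.intervalIntegral_add_eq 0 a.re
  rw [zero_add] at h2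
  have h3 : ∫ x in (0 : ℝ)..T, g (x + a) =
      ∫ x in (0 : ℝ)..T, (fun x : ℝ => g (x + a.im * I)) (x + a.re) := by
    refine intervalIntegral.integral_congr fun x _ => ?_
    simp only [ofReal_add, add_assoc, Complex.re_add_im]
  rw [h3, intervalIntegral.integral_comp_add_right (fun x : ℝ => g (x + a.im * I)) a.re,
    zero_add, add_comm T, ← h2]
  linear_combination -hrect

/-! ### Integrals over the fundamental domain -/

lemma fundDomain_eq_preimage (τ : ℂ) : fundDomain τ =
    Complex.measurableEquivRealProd ⁻¹' (Set.Ico 0 1 ×ˢ Set.Ico 0 τ.im) := by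
  ext u
  simp [fundDomain, and_assoc]

lemma measurableSet_fundDomain (τ : ℂ) : MeasurableSet (fundDomain τ) := by
  rw [fundDomain_eq_preimage]
  exact Complex.measurableEquivRealProd.measurable (measurableSet_Ico.prod measurableSet_Ico)

lemma fundDomain_subset (τ : ℂ) : fundDomain τ ⊆ Set.Icc 0 1 ×ℂ Set.Icc 0 τ.im :=
  fun _ hu => ⟨⟨hu.1, hu.2.1.le⟩, ⟨hu.2.2.1, hu.2.2.2.le⟩⟩

lemma isCompact_closedCell (τ : ℂ) : IsCompact (Set.Icc 0 1 ×ℂ Set.Icc 0 τ.im) :=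
  isCompact_Icc.reProdIm isCompact_Icc

lemma volume_fundDomain_lt_top (τ : ℂ) : volume (fundDomain τ) < ⊤ :=
  (measure_mono (fundDomain_subset τ)).trans_lt (isCompact_closedCell τ).measure_lt_top

lemma integrableOn_fundDomain (τ : ℂ) {F : ℂ → ℂ} (hF : Continuous F) :
    IntegrableOn F (fundDomain τ) :=
  (hF.continuousOn.integrableOn_compact (isCompact_closedCell τ)).mono_set (fundDomain_subset τ)

lemma setIntegral_fundDomain_eq_prod (τ : ℂ) (F : ℂ → ℂ) : ∫ u in fundDomain τ, F u =
    ∫ z in Set.Ico (0 : ℝ) 1 ×ˢ Set.Ico 0 τ.im, F (z.1 + z.2 * I) := by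
  rw [fundDomain_eq_preimage, ← Complex.volume_preserving_equiv_real_prod.setIntegral_preimage_emb
    Complex.measurableEquivRealProd.measurableEmbedding]
  simp

lemma integrableOn_prod_Ico (τ : ℂ) {F : ℂ → ℂ} (hF : Continuous F) :
    IntegrableOn (fun z : ℝ × ℝ => F (z.1 + z.2 * I)) (Set.Ico (0 : ℝ) 1 ×ˢ Set.Ico 0 τ.im) :=
  ((hF.comp (by fun_prop : Continuous fun z : ℝ × ℝ =>
    (z.1 + z.2 * I : ℂ))).continuousOn.integrableOn_compact
      (isCompact_Icc.prod isCompact_Icc)).mono_set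
        (Set.prod_mono Set.Ico_subset_Icc_self Set.Ico_subset_Icc_self)

lemma setIntegral_Ico_eq {T : ℝ} (hT : 0 ≤ T) (g : ℝ → ℂ) :
    ∫ x in Set.Ico 0 T, g x = ∫ x in (0 : ℝ)..T, g x := by
  rw [intervalIntegral.integral_of_le hT, integral_Ico_eq_integral_Ioo,
    integral_Ioc_eq_integral_Ioo]

lemma setIntegral_fundDomain {τ : ℂ} (hτ : 0 < τ.im) {F : ℂ → ℂ} (hF : Continuous F) :
    ∫ u in fundDomain τ, F u = ∫ x in (0 : ℝ)..1, ∫ y in (0 : ℝ)..τ.im, F (x + y * I) := by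
  rw [setIntegral_fundDomain_eq_prod, ← setIntegral_Ico_eq zero_le_one]
  simp_rw [← setIntegral_Ico_eq hτ.le]
  exact setIntegral_prod _ (integrableOn_prod_Ico τ hF)

lemma setIntegral_fundDomain_swap {τ : ℂ} (hτ : 0 < τ.im) {F : ℂ → ℂ} (hF : Continuous F) :
    ∫ u in fundDomain τ, F u = ∫ y in (0 : ℝ)..τ.im, ∫ x in (0 : ℝ)..1, F (x + y * I) := by
  rw [setIntegral_fundDomain hτ hF]
  simp_rw [← setIntegral_Ico_eq hτ.le, ← setIntegral_Ico_eq zero_le_one]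
  refine integral_integral_swap ?_
  have := integrableOn_prod_Ico τ hF
  rwa [IntegrableOn, Measure.volume_eq_prod, ← Measure.prod_restrict] at this

/-- Shifting the first argument of a doubly periodic integrand. -/
lemma setIntegral_fundDomain_shift {τ : ℂ} (hre : τ.re = 0) (hτ : 0 < τ.im) (G : ℂ → ℂ → ℂ)
    (ε : ℂ) (h1 : ∀ u v, G (u + 1) (v + 1) = G u v) (h2 : ∀ u v, G (u + τ) (v - τ) = G u v)
    (hd : ∀ u v : ℂ, (u + v).im ∈ Set.uIcc 0 ε.im → (u - v).re ∈ Set.uIcc 0 ε.re →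
      DifferentiableAt ℂ (fun p : ℂ × ℂ => G p.1 p.2) (u, v)) :
    ∫ u in fundDomain τ, G (u + ε) (conj u) = ∫ u in fundDomain τ, G u (conj u) := by
  have hτI : τ = τ.im * I := by apply Complex.ext <;> simp [hre]
  have c1 : Continuous fun u => G (u + ε) (conj u) := by
    rw [continuous_iff_continuousAt]
    intro u
    have := (hd (u + ε) (conj u) (by simp) (by simp)).continuousAt
    exact ContinuousAt.comp (f := fun u : ℂ => (u + ε, conj u))
      (g := fun p : ℂ × ℂ => G p.1 p.2) this (by fun_prop)
  have c2 : Continuous fun u => G (u + ε / 2) (conj u + ε / 2) := by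
    rw [continuous_iff_continuousAt]
    intro u
    have := (hd (u + ε / 2) (conj u + ε / 2) (by
      rw [show u + ε / 2 + (conj u + ε / 2) = u + conj u + ε by ring]; simp) (by simp)).continuousAt
    exact ContinuousAt.comp (f := fun u : ℂ => (u + ε / 2, conj u + ε / 2))
      (g := fun p : ℂ × ℂ => G p.1 p.2) this (by fun_prop)
  have c3 : Continuous fun u => G u (conj u) := by
    rw [continuous_iff_continuousAt]
    intro u
    have := (hd u (conj u) (by simp) (by simp)).continuousAt
    exact ContinuousAt.comp (f := fun u : ℂ => (u, conj u))
      (g := fun p : ℂ × ℂ => G p.1 p.2) this (by fun_prop)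
  rw [setIntegral_fundDomain hτ c1]
  -- With u = x + iy and v = x - iy made independent by complexifying x and y, the shift of u alone
  -- by ε splits in two. Shifting x by ε/2 moves both arguments by ε/2; shifting y by -iε/2 then
  -- moves u by another ε/2 and v back. The first uses the period (1, 1), the second the period (τ,
  -- -τ). On these paths Im (u + v) and Re (u - v) stay in the intervals allowed by `hd`.
  trans ∫ u in fundDomain τ, G (u + ε / 2) (conj u + ε / 2)
  · rw [setIntegral_fundDomain hτ c2]
    refine intervalIntegral.integral_congr fun x _ => ?_
    have := integral_add_eq_of_periodic (T := τ.im)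
      (g := fun Y : ℂ => G (x + Y * I + ε / 2) (x - Y * I + ε / 2)) (fun Y => by
        have ea : x + (Y + τ.im) * I + ε / 2 = x + Y * I + ε / 2 + τ := by
          linear_combination -hτI
        have eb : x - (Y + τ.im) * I + ε / 2 = x - Y * I + ε / 2 - τ := by
          linear_combination hτI
        simp only [ea, eb, h2]) (-(I * ε / 2)) (fun Y hY => by
          have hd' := hd (x + Y * I + ε / 2) (x - Y * I + ε / 2)
            (by
              rw [show (x + Y * I + ε / 2) + (x - Y * I + ε / 2) = x + x + ε by ring]
              simp)
            (by
              have e1 : (-(I * ε / 2)).im = -(ε.re / 2) := by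
                rw [show -(I * ε / 2) = I * (-(1 / 2 : ℝ) * ε) by push_cast; ring]
                simp; ring
              rw [e1, Set.mem_uIcc] at hY
              rw [show (x + Y * I + ε / 2) - (x - Y * I + ε / 2) = 2 * (Y * I) by ring,
                Set.mem_uIcc]
              simp
              rcases hY with hY | hY
              · right; constructor <;> linarith
              · left; constructor <;> linarith)
          exact DifferentiableAt.comp (f := fun Y : ℂ => (x + Y * I + ε / 2, x - Y * I + ε / 2))
            (g := fun p : ℂ × ℂ => G p.1 p.2) Y hd' (by fun_prop))
    have e : ∀ y : ℝ, (x + (y + -(I * ε / 2)) * I + ε / 2 : ℂ) = x + y * I + ε := fun y => by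
      linear_combination (-(ε / 2)) * I_mul_I
    have e' : ∀ y : ℝ, (x - (y + -(I * ε / 2)) * I + ε / 2 : ℂ) = x - y * I := fun y => by
      linear_combination (ε / 2) * I_mul_I
    simp only [e, e'] at this
    simpa [sub_eq_add_neg] using this
  · rw [setIntegral_fundDomain_swap hτ c2, setIntegral_fundDomain_swap hτ c3]
    refine intervalIntegral.integral_congr fun y _ => ?_
    have := integral_add_eq_of_periodic (T := 1)
      (g := fun X : ℂ => G (X + y * I) (X - y * I)) (fun X => by
        rw [← h1 (X + y * I) (X - y * I)]
        push_cast
        ring_nf) (ε / 2) (fun X hX => by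
          have hd' := hd (X + y * I) (X - y * I)
            (by
              rw [show (X + y * I) + (X - y * I) = 2 * X by ring]
              rw [show ε / 2 = ((1 / 2 : ℝ) : ℂ) * ε by push_cast; ring] at hX
              rw [Set.mem_uIcc] at hX ⊢
              simp at hX ⊢
              rcases hX with hX | hX
              · left; constructor <;> linarith
              · right; constructor <;> linarith)
            (by simp)
          exact DifferentiableAt.comp (f := fun X : ℂ => (X + y * I, X - y * I))
            (g := fun p : ℂ × ℂ => G p.1 p.2) X hd' (by fun_prop))
    simp only [add_right_comm _ (ε / 2), add_sub_right_comm _ (ε / 2)] at this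
    simpa [sub_eq_add_neg] using this

/-! ### Products of theta functions along an arithmetic progression -/

/-- The product `∏_{k < m} theta3 (x + (2k - m + 1) η)`. -/
def thetaProd (τ η : ℂ) (m : ℕ) (x : ℂ) : ℂ :=
  ∏ k ∈ Finset.range m, theta3 τ (x + (2 * k - m + 1) * η)

lemma thetaProd_zero (τ η x : ℂ) : thetaProd τ η 0 x = 1 := by simp [thetaProd]

/-- The progression of shifts is symmetric about 0. This allows the contour shift to be reused with
-η, and later handles conjugation for imaginary η. -/
lemma thetaProd_neg_eta (τ η : ℂ) (m : ℕ) (x : ℂ) :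
    thetaProd τ (-η) m x = thetaProd τ η m x := by
  rw [thetaProd, ← Finset.prod_range_reflect, thetaProd]
  refine Finset.prod_congr rfl fun k hk => ?_
  have hk := Finset.mem_range.1 hk
  rw [Nat.cast_sub (by omega), Nat.cast_sub (by omega)]
  push_cast
  ring_nf

lemma thetaProd_neg (τ η : ℂ) (m : ℕ) (x : ℂ) : thetaProd τ η m (-x) = thetaProd τ η m x := by
  rw [← thetaProd_neg_eta]
  refine Finset.prod_congr rfl fun k _ => ?_
  rw [← theta3_neg]
  ring_nf

lemma thetaProd_succ (τ η : ℂ) (m : ℕ) (x : ℂ) :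
    thetaProd τ η (m + 1) x = thetaProd τ η m (x - η) * theta3 τ (x + m * η) := by
  rw [thetaProd, Finset.prod_range_succ, thetaProd]
  congr 1
  · refine Finset.prod_congr rfl fun k _ => ?_
    push_cast; ring_nf
  · push_cast; ring_nf

lemma thetaProd_succ' (τ η : ℂ) (m : ℕ) (x : ℂ) :
    thetaProd τ η (m + 1) x = thetaProd τ η m (x + η) * theta3 τ (x - m * η) := by
  rw [← thetaProd_neg_eta, thetaProd_succ, thetaProd_neg_eta]
  ring_nf

lemma differentiable_thetaProd {τ : ℂ} (hτ : 0 < τ.im) (η : ℂ) (m : ℕ) :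
    Differentiable ℂ (thetaProd τ η m) := by
  have := Differentiable.fun_finsetProd (𝕜 := ℂ) (u := Finset.range m)
    (f := fun (k : ℕ) x => theta3 τ (x + (2 * k - m + 1) * η))
    (fun k _ => (differentiable_theta3 hτ).comp
      (by fun_prop : Differentiable ℂ fun x : ℂ => x + (2 * k - m + 1) * η))
  exact this

lemma thetaProd_add_one (τ η : ℂ) (m : ℕ) (x : ℂ) :
    thetaProd τ η m (x + 1) = thetaProd τ η m x := by
  refine Finset.prod_congr rfl fun k _ => ?_
  rw [add_right_comm, theta3_add_one]

lemma thetaProd_add_tau {τ : ℂ} (hτ : 0 < τ.im) (η : ℂ) (m : ℕ) (x : ℂ) :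
    thetaProd τ η m (x + τ) = cexp (-(Real.pi * I * m * (2 * x + τ))) * thetaProd τ η m x := by
  induction m generalizing x with
  | zero => simp [thetaProd_zero]
  | succ m ih =>
    rw [thetaProd_succ, thetaProd_succ, show x + τ - η = x - η + τ by ring, ih,
      show x + τ + m * η = x + m * η + τ by ring, theta3_add_tau hτ]
    have e : cexp (-(Real.pi * I * (m + 1 : ℕ) * (2 * x + τ))) =
        cexp (-(Real.pi * I * m * (2 * (x - η) + τ))) *
          cexp (-(Real.pi * I * (2 * (x + m * η) + τ))) := by
      rw [← Complex.exp_add]; push_cast; ring_nf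
    rw [e]; ring

lemma abs_two_mul_sub_le {k m : ℕ} (h : k < m) : |(2 * k - m + 1 : ℝ)| ≤ m - 1 := by
  have h1 : (k : ℝ) + 1 ≤ m := by exact_mod_cast h
  have h2 : (0 : ℝ) ≤ k := k.cast_nonneg
  rw [abs_le]; constructor <;> linarith

lemma thetaProd_ne_zero_of_im {τ : ℂ} (hτ : 0 < τ.im) {η : ℂ} {m : ℕ} {x : ℂ}
    (h : |x.im| + (m - 1) * |η.im| < τ.im / 2) : thetaProd τ η m x ≠ 0 := by
  refine Finset.prod_ne_zero_iff.2 fun k hk => theta3_ne_zero_of_im hτ (lt_of_le_of_lt ?_ h)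
  have e : (x + (2 * k - m + 1) * η).im = x.im + (2 * k - m + 1 : ℝ) * η.im := by simp
  rw [e]
  refine (abs_add_le _ _).trans ?_
  rw [abs_mul]
  gcongr
  exact abs_two_mul_sub_le (Finset.mem_range.1 hk)

lemma thetaProd_ne_zero_of_re {τ : ℂ} (hτ : 0 < τ.im) (hre : τ.re = 0) {η : ℂ} {m : ℕ} {x : ℂ}
    (h : |x.re| + (m - 1) * |η.re| < 1 / 2) : thetaProd τ η m x ≠ 0 := by
  refine Finset.prod_ne_zero_iff.2 fun k hk => theta3_ne_zero_of_re hτ hre (lt_of_le_of_lt ?_ h)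
  have e : (x + (2 * k - m + 1) * η).re = x.re + (2 * k - m + 1 : ℝ) * η.re := by simp
  rw [e]
  refine (abs_add_le _ _).trans ?_
  rw [abs_mul]
  gcongr
  exact abs_two_mul_sub_le (Finset.mem_range.1 hk)

/-! ### Even theta functions -/

/-- The kernel `thetaProd (v + a) * thetaProd (v - a)`, without normalization. -/
def thetaKernel (τ η : ℂ) (N : ℕ) (a v : ℂ) : ℂ :=
  thetaProd τ η N (v + a) * thetaProd τ η N (v - a)

lemma thetaKernel_mem_evenTheta {τ : ℂ} (hτ : 0 < τ.im) (η : ℂ) (N : ℕ) (a : ℂ) :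
    thetaKernel τ η N a ∈ evenTheta τ N := by
  have hd := differentiable_thetaProd hτ η N
  refine ⟨?_, fun x => ?_, fun x => ?_, fun x => ?_⟩
  · exact (hd.comp (by fun_prop : Differentiable ℂ fun v : ℂ => v + a)).mul
      (hd.comp (by fun_prop : Differentiable ℂ fun v : ℂ => v - a))
  · rw [thetaKernel, thetaKernel, add_right_comm, add_sub_right_comm, thetaProd_add_one,
      thetaProd_add_one]
  · rw [thetaKernel, thetaKernel, add_right_comm, add_sub_right_comm, thetaProd_add_tau hτ,
      thetaProd_add_tau hτ]
    have e : cexp (-(2 * Real.pi * I * N * (2 * x + τ))) =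
        cexp (-(Real.pi * I * N * (2 * (x + a) + τ))) *
        cexp (-(Real.pi * I * N * (2 * (x - a) + τ))) := by
      rw [← Complex.exp_add]; ring_nf
    rw [e]; ring
  · rw [thetaKernel, thetaKernel, ← thetaProd_neg _ _ _ (-x + a), ← thetaProd_neg _ _ _ (-x - a)]
    ring_nf

lemma thetaKernel_neg (τ η : ℂ) (N : ℕ) (a v : ℂ) :
    thetaKernel τ η N (-a) v = thetaKernel τ η N a v := by
  rw [thetaKernel, thetaKernel, sub_neg_eq_add, ← sub_eq_add_neg, mul_comm]

lemma thetaKernel_comm (τ η : ℂ) (N : ℕ) (a v : ℂ) :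
    thetaKernel τ η N a v = thetaKernel τ η N v a := by
  rw [thetaKernel, thetaKernel, ← thetaProd_neg _ _ _ (v - a), add_comm, neg_sub]

/-- The recursion behind the induction on N: the extra factors are exactly those produced by
`pairing_lower` with parameter a + nη. -/
lemma thetaKernel_succ (τ η : ℂ) (n : ℕ) (a v : ℂ) : thetaKernel τ η (n + 1) a v =
    thetaKernel τ η n (a - η) v * (theta3 τ (v + (a + n * η)) * theta3 τ (v - (a + n * η))) := by
  rw [thetaKernel, thetaKernel, thetaProd_succ, thetaProd_succ']
  ring_nf

/-- The parameter region. -/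
def InRegion (τ η : ℂ) (N : ℕ) : Prop :=
  |η.re| < 1 / (2 * ((N : ℝ) + 1)) ∧ |η.im| < τ.im / (2 * ((N : ℝ) + 1))

lemma InRegion.mul_lt {τ η : ℂ} {N : ℕ} (h : InRegion τ η N) :
    ((N : ℝ) + 1) * |η.re| < 1 / 2 ∧ ((N : ℝ) + 1) * |η.im| < τ.im / 2 := by
  have hN : (0 : ℝ) < (N : ℝ) + 1 := by positivity
  obtain ⟨h1, h2⟩ := h
  rw [lt_div_iff₀ (by positivity)] at h1 h2
  constructor <;> linarith

lemma InRegion.of_succ {τ η : ℂ} {N : ℕ} (h : InRegion τ η (N + 1)) : InRegion τ η N := by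
  obtain ⟨h1, h2⟩ := h.mul_lt
  have hN : (0 : ℝ) < (N : ℝ) + 1 := by positivity
  push_cast at h1 h2
  constructor
  · rw [lt_div_iff₀ (by positivity)]
    nlinarith [abs_nonneg η.re]
  · rw [lt_div_iff₀ (by positivity)]
    nlinarith [abs_nonneg η.im]

lemma InRegion.neg {τ η : ℂ} {N : ℕ} (h : InRegion τ η N) : InRegion τ (-η) N := by
  simpa [InRegion] using h

/-- Since u + ū is real and u - ū imaginary, the shifts by at most (N + 1)η must avoid zeros
vertically in one product and horizontally in the other. These are precisely the two bounds of
`InRegion`; they make the integrand free of poles. -/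
lemma thetaKernel_conj_ne_zero {τ : ℂ} (hre : τ.re = 0) (hτ : 0 < τ.im) {η : ℂ} {N : ℕ}
    (h : InRegion τ η N) (u : ℂ) : thetaKernel τ η (N + 2) (conj u) u ≠ 0 := by
  obtain ⟨h1, h2⟩ := h.mul_lt
  refine mul_ne_zero (thetaProd_ne_zero_of_im hτ ?_) (thetaProd_ne_zero_of_re hτ hre ?_)
  · simp; linarith
  · simp; linarith

lemma theta_two_mul_ne_zero {τ : ℂ} (hre : τ.re = 0) (hτ : 0 < τ.im) {η : ℂ} {N : ℕ}
    (h : InRegion τ η N) (hη : η ≠ 0) : theta τ (2 * (N + 1) * η) ≠ 0 := by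
  obtain ⟨h1, h2⟩ := h.mul_lt
  rw [Ne, theta_eq_zero_iff hτ]
  rintro ⟨m, n, e⟩
  have hN : (0 : ℝ) < (N : ℝ) + 1 := by positivity
  have er : 2 * ((N : ℝ) + 1) * η.re = m := by
    have := congrArg Complex.re e
    simpa [hre] using this
  have ei : 2 * ((N : ℝ) + 1) * η.im = n * τ.im := by
    have := congrArg Complex.im e
    simpa [hre] using this
  have hm : |(m : ℝ)| < 1 := by
    rw [← er, abs_mul, abs_of_pos (by positivity)]; linarith
  have hn : |(n : ℝ)| < 1 := by
    have : |(n : ℝ)| * τ.im < 1 * τ.im := by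
      rw [← abs_of_pos hτ, ← abs_mul, abs_of_pos hτ, ← ei, abs_mul, abs_of_pos (by positivity)]
      linarith
    exact lt_of_mul_lt_mul_right this hτ.le
  have hm0 : m = 0 := Int.abs_lt_one_iff.1 (by exact_mod_cast hm)
  have hn0 : n = 0 := Int.abs_lt_one_iff.1 (by exact_mod_cast hn)
  subst hm0 hn0
  apply hη
  apply Complex.ext
  · simpa [hN.ne'] using er
  · simpa [hN.ne'] using ei

/-! ### The bilinear pairing -/

/-- The integrand of the bilinear version of Sklyanin's scalar product. -/
def pairingIntegrand (τ η : ℂ) (N : ℕ) (f h : ℂ → ℂ) (u : ℂ) : ℂ :=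
  f u * h (conj u) * (theta τ (2 * u) * theta τ (2 * conj u)) /
    thetaKernel τ η (N + 2) (conj u) u

/-- The bilinear version of Sklyanin's scalar product. -/
def pairing (τ η : ℂ) (N : ℕ) (f h : ℂ → ℂ) : ℂ :=
  ∫ u in fundDomain τ, pairingIntegrand τ η N f h u

lemma continuous_pairingIntegrand {τ : ℂ} (hre : τ.re = 0) (hτ : 0 < τ.im) {η : ℂ} {N : ℕ}
    (hη : InRegion τ η N) {f h : ℂ → ℂ} (hf : Continuous f) (hh : Continuous h) :
    Continuous (pairingIntegrand τ η N f h) := by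
  have h1 := (differentiable_theta hτ).continuous
  have h2 := (differentiable_thetaProd hτ η (N + 2)).continuous
  refine Continuous.div ?_ ?_ (thetaKernel_conj_ne_zero hre hτ hη)
  · fun_prop
  · unfold thetaKernel; fun_prop

lemma evenTheta.sub_tau {τ : ℂ} {n : ℕ} {h : ℂ → ℂ} (hh : h ∈ evenTheta τ n) (v : ℂ) :
    h (v - τ) = cexp (2 * Real.pi * I * n * (2 * v - τ)) * h v := by
  have := hh.2.2.1 (v - τ)
  rw [sub_add_cancel] at this
  rw [this, ← mul_assoc, ← Complex.exp_add]
  ring_nf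
  simp

lemma theta_two_mul_sub_tau {τ : ℂ} (hτ : 0 < τ.im) (v : ℂ) :
    theta τ (2 * (v - τ)) = cexp (2 * Real.pi * I * (4 * v - 2 * τ)) * theta τ (2 * v) := by
  have h1 := theta_add_tau hτ (2 * v - τ - τ)
  have h2 := theta_add_tau hτ (2 * v - τ)
  rw [sub_add_cancel] at h1 h2
  rw [h2, h1, show 2 * v - τ - τ = 2 * (v - τ) by ring]
  have e : cexp (2 * Real.pi * I * (4 * v - 2 * τ)) *
      (cexp (-(Real.pi * I * (2 * (2 * v - τ) + τ))) *
      cexp (-(Real.pi * I * (2 * (2 * (v - τ)) + τ)))) = 1 := by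
    rw [← Complex.exp_add, ← Complex.exp_add, Complex.exp_eq_one_iff]
    exact ⟨0, by push_cast; ring⟩
  linear_combination (-theta τ (2 * (v - τ))) * e

lemma theta_two_mul_add_tau {τ : ℂ} (hτ : 0 < τ.im) (v : ℂ) :
    theta τ (2 * (v + τ)) = cexp (-(2 * Real.pi * I * (4 * v + 2 * τ))) * theta τ (2 * v) := by
  rw [show 2 * (v + τ) = 2 * v + τ + τ by ring, theta_add_tau hτ, theta_add_tau hτ]
  have e : cexp (-(2 * Real.pi * I * (4 * v + 2 * τ))) =
      (cexp (-(Real.pi * I * (2 * (2 * v + τ) + τ))) *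
      cexp (-(Real.pi * I * (2 * (2 * v) + τ)))) := by
    rw [← Complex.exp_add]; ring_nf
  rw [e]; ring

lemma theta_two_mul_add_one (τ v : ℂ) : theta τ (2 * (v + 1)) = theta τ (2 * v) := by
  rw [show 2 * (v + 1) = 2 * v + 1 + 1 by ring, theta_add_one, theta_add_one, neg_neg]

/-- The integrand obtained by lowering the first argument of the pairing. -/
def lowerIntegrand (τ η : ℂ) (n : ℕ) (a : ℂ) (f h : ℂ → ℂ) (u v : ℂ) : ℂ :=
  theta τ (u - (n + 2) * η + a) * theta τ (u - (n + 2) * η - a) * f u * h v * theta τ (2 * v) /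
    thetaKernel τ η (n + 2) v (u - η)

lemma setIntegral_lowerIntegrand_shift {τ : ℂ} (hre : τ.re = 0) (hτ : 0 < τ.im) {η : ℂ} {n : ℕ}
    (hη : InRegion τ η (n + 1)) (a : ℂ) {f h : ℂ → ℂ} (hf : f ∈ evenTheta τ (n + 1))
    (hh : h ∈ evenTheta τ n) :
    (∀ u : ℂ, ContinuousAt (fun u => lowerIntegrand τ η n a f h u (conj u)) u) ∧
    (∀ u : ℂ, ContinuousAt (fun u => lowerIntegrand τ η n a f h (u + η) (conj u)) u) ∧
    ∫ u in fundDomain τ, lowerIntegrand τ η n a f h (u + η) (conj u) =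
      ∫ u in fundDomain τ, lowerIntegrand τ η n a f h u (conj u) := by
  have hd : ∀ u v : ℂ, (u + v).im ∈ Set.uIcc 0 η.im → (u - v).re ∈ Set.uIcc 0 η.re →
      DifferentiableAt ℂ (fun p : ℂ × ℂ => lowerIntegrand τ η n a f h p.1 p.2) (u, v) := by
    intro u v h1 h2
    have hθ := differentiable_theta hτ
    have hP := differentiable_thetaProd hτ η (n + 2)
    have hf1 := hf.1
    have hh1 := hh.1
    have d1 : Differentiable ℂ fun p : ℂ × ℂ => theta τ (p.1 - (n + 2) * η + a) :=
      hθ.comp (by fun_prop)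
    have d2 : Differentiable ℂ fun p : ℂ × ℂ => theta τ (p.1 - (n + 2) * η - a) :=
      hθ.comp (by fun_prop)
    have d3 : Differentiable ℂ fun p : ℂ × ℂ => f p.1 := hf1.comp (by fun_prop)
    have d4 : Differentiable ℂ fun p : ℂ × ℂ => h p.2 := hh1.comp (by fun_prop)
    have d5 : Differentiable ℂ fun p : ℂ × ℂ => theta τ (2 * p.2) := hθ.comp (by fun_prop)
    have d6 : Differentiable ℂ fun p : ℂ × ℂ => thetaProd τ η (n + 2) (p.1 - η + p.2) :=
      hP.comp (by fun_prop)
    have d7 : Differentiable ℂ fun p : ℂ × ℂ => thetaProd τ η (n + 2) (p.1 - η - p.2) :=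
      hP.comp (by fun_prop)
    obtain ⟨r1, r2⟩ := hη.mul_lt
    push_cast at r1 r2
    -- During the shift, u - η ± v stays within |Im η| (plus sign) or |Re η| (minus sign) of the
    -- unshifted position. The n + 2 factors add n + 1 more, for a total of n + 2, which is the
    -- bound for level n + 1.
    suffices hne : thetaKernel τ η (n + 2) v (u - η) ≠ 0 by
      have d8 := (((((d1.fun_mul d2).fun_mul d3).fun_mul d4).fun_mul d5) (u, v))
      have d9 := DifferentiableAt.comp (u, v) (differentiableAt_inv hne)
        ((d6.fun_mul d7) (u, v))
      exact (d8.fun_mul d9).congr_of_eventuallyEq (Eventually.of_forall fun p => div_eq_mul_inv _ _)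
    refine mul_ne_zero ?_ ?_
    · refine thetaProd_ne_zero_of_im hτ ?_
      have : |(u - η + v).im| ≤ |η.im| := by
        have e : (u - η + v).im = (u + v).im - η.im := by simp; ring
        rw [e]
        rcases Set.mem_uIcc.1 h1 with h | h
        · rw [abs_of_nonneg (h.1.trans h.2), abs_le]; constructor <;> linarith
        · rw [abs_of_nonpos (h.1.trans h.2), abs_le]; constructor <;> linarith
      push_cast
      linarith
    · refine thetaProd_ne_zero_of_re hτ hre ?_
      have : |(u - η - v).re| ≤ |η.re| := by
        have e : (u - η - v).re = (u - v).re - η.re := by simp; ring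
        rw [e]
        rcases Set.mem_uIcc.1 h2 with h | h
        · rw [abs_of_nonneg (h.1.trans h.2), abs_le]; constructor <;> linarith
        · rw [abs_of_nonpos (h.1.trans h.2), abs_le]; constructor <;> linarith
      push_cast
      linarith
  refine ⟨fun u => ?_, fun u => ?_, ?_⟩
  · exact ContinuousAt.comp (f := fun u : ℂ => (u, conj u))
      (g := fun p : ℂ × ℂ => lowerIntegrand τ η n a f h p.1 p.2)
      (hd u (conj u) (by simp) (by simp)).continuousAt (by fun_prop)
  · exact ContinuousAt.comp (f := fun u : ℂ => (u + η, conj u))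
      (g := fun p : ℂ × ℂ => lowerIntegrand τ η n a f h p.1 p.2)
      (hd (u + η) (conj u) (by simp) (by simp)).continuousAt (by fun_prop)
  refine setIntegral_fundDomain_shift hre hτ (lowerIntegrand τ η n a f h) η (fun u v => ?_)
    (fun u v => ?_) hd
  · simp only [lowerIntegrand, thetaKernel]
    rw [show u + 1 - (n + 2) * η = u - (n + 2) * η + 1 by ring, theta_mul_add_one,
      hf.2.1, hh.2.1, theta_two_mul_add_one, show u + 1 - η + (v + 1) = u - η + v + 1 + 1 by ring,
      show u + 1 - η - (v + 1) = u - η - v by ring, thetaProd_add_one, thetaProd_add_one]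
  · simp only [lowerIntegrand, thetaKernel]
    rw [show u + τ - (n + 2) * η = u - (n + 2) * η + τ by ring, theta_mul_add_tau hτ,
      hf.2.2.1, evenTheta.sub_tau hh, theta_two_mul_sub_tau hτ,
      show u + τ - η + (v - τ) = u - η + v by ring,
      show u + τ - η - (v - τ) = u - η - v + τ + τ by ring, thetaProd_add_tau hτ,
      thetaProd_add_tau hτ]
    have e : cexp (-(2 * Real.pi * I * (2 * (u - (n + 2) * η) + τ))) *
        cexp (-(2 * Real.pi * I * (n + 1 : ℕ) * (2 * u + τ))) *
        cexp (2 * Real.pi * I * n * (2 * v - τ)) * cexp (2 * Real.pi * I * (4 * v - 2 * τ)) =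
        cexp (-(Real.pi * I * (n + 2 : ℕ) * (2 * (u - η - v + τ) + τ))) *
        cexp (-(Real.pi * I * (n + 2 : ℕ) * (2 * (u - η - v) + τ))) := by
      simp only [← Complex.exp_add]; push_cast; ring_nf
    have hE : cexp (-(Real.pi * I * (n + 2 : ℕ) * (2 * (u - η - v + τ) + τ))) *
        cexp (-(Real.pi * I * (n + 2 : ℕ) * (2 * (u - η - v) + τ))) ≠ 0 :=
      mul_ne_zero (Complex.exp_ne_zero _) (Complex.exp_ne_zero _)
    symm
    rw [← mul_div_mul_left _ _ hE]
    congr 1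
    · linear_combination (-theta τ (u - (n + 2) * η + a) * theta τ (u - (n + 2) * η - a) * f u *
        h v * theta τ (2 * v)) * e
    · ring

/-- Lowering the first argument of the pairing corresponds to a multiplication in the second. -/
lemma pairing_lower {τ : ℂ} (hre : τ.re = 0) (hτ : 0 < τ.im) {η : ℂ} {n : ℕ}
    (hη : InRegion τ η (n + 1)) (a : ℂ) {f h F : ℂ → ℂ} (hf : f ∈ evenTheta τ (n + 1))
    (hh : h ∈ evenTheta τ n)
    (hF : ∀ u, theta τ (u - (n + 1) * η + a) * theta τ (u - (n + 1) * η - a) * f (u + η) -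
      theta τ (u + (n + 1) * η + a) * theta τ (u + (n + 1) * η - a) * f (u - η) =
      F u * theta τ (2 * u)) :
    pairing τ η n F h = -theta τ (2 * (n + 2) * η) *
      pairing τ η (n + 1) f (fun v => h v * (theta3 τ (v + a) * theta3 τ (v - a))) := by
  obtain ⟨c1, c2, e1⟩ := setIntegral_lowerIntegrand_shift hre hτ hη a hf hh
  obtain ⟨c3, c4, e2⟩ := setIntegral_lowerIntegrand_shift hre hτ hη.neg a hf hh
  have i1 := integrableOn_fundDomain τ (continuous_iff_continuousAt.2 c1)
  have i2 := integrableOn_fundDomain τ (continuous_iff_continuousAt.2 c2)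
  have i3 := integrableOn_fundDomain τ (continuous_iff_continuousAt.2 c3)
  have i4 := integrableOn_fundDomain τ (continuous_iff_continuousAt.2 c4)
  -- The factor θ(2u) in the weight is what the division in F needs: F(u) θ(2u) is a difference of
  -- two terms exchanged by η ↦ -η, each a shifted `lowerIntegrand`.
  have l : pairing τ η n F h = ∫ u in fundDomain τ,
      (lowerIntegrand τ η n a f h (u + η) (conj u) -
        lowerIntegrand τ (-η) n a f h (u + -η) (conj u)) := by
    refine integral_congr_ae (Eventually.of_forall fun u => ?_)
    simp only [pairingIntegrand, lowerIntegrand, thetaKernel, thetaProd_neg_eta]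
    rw [add_sub_cancel_right, add_sub_cancel_right, ← sub_div,
      show u + η - (n + 2) * η = u - (n + 1) * η by ring,
      show u + -η - (n + 2) * -η = u + (n + 1) * η by ring, ← sub_eq_add_neg]
    congr 1
    linear_combination (-(h (conj u) * theta τ (2 * conj u))) * hF u
  -- With the shifts undone, both denominators divide the kernel of order n + 3 (`k1`, `k2`). Over
  -- this common denominator the numerators combine by `theta3_theta_addition` with c = (n + 2)η.
  have r : -theta τ (2 * (n + 2) * η) *
      pairing τ η (n + 1) f (fun v => h v * (theta3 τ (v + a) * theta3 τ (v - a))) =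
      ∫ u in fundDomain τ, (lowerIntegrand τ η n a f h u (conj u) -
        lowerIntegrand τ (-η) n a f h u (conj u)) := by
    rw [pairing, ← integral_const_mul]
    refine integral_congr_ae (Eventually.of_forall fun u => ?_)
    have hne := thetaKernel_conj_ne_zero hre hτ hη u
    have k1 : thetaKernel τ η (n + 1 + 2) (conj u) u = thetaKernel τ η (n + 2) (conj u) (u - η) *
        (theta3 τ (u + conj u + (n + 2) * η) * theta3 τ (u - conj u + (n + 2) * η)) := by
      rw [show n + 1 + 2 = n + 2 + 1 by ring, thetaKernel, thetaKernel,
        thetaProd_succ τ η (n + 2) (u + _),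
        thetaProd_succ τ η (n + 2) (u - _)]
      push_cast; ring_nf
    have k2 : thetaKernel τ η (n + 1 + 2) (conj u) u = thetaKernel τ η (n + 2) (conj u) (u + η) *
        (theta3 τ (u + conj u - (n + 2) * η) * theta3 τ (u - conj u - (n + 2) * η)) := by
      rw [show n + 1 + 2 = n + 2 + 1 by ring, thetaKernel, thetaKernel,
        thetaProd_succ' τ η (n + 2) (u + _),
        thetaProd_succ' τ η (n + 2) (u - _)]
      push_cast; ring_nf
    have k3 : thetaKernel τ (-η) (n + 2) (conj u) (u - -η) =
        thetaKernel τ η (n + 2) (conj u) (u + η) := by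
      simp only [thetaKernel, thetaProd_neg_eta, sub_neg_eq_add]
    have n1 := left_ne_zero_of_mul (k1 ▸ hne)
    have n2 := left_ne_zero_of_mul (k2 ▸ hne)
    have W := theta3_theta_addition hτ u (conj u) ((n + 2) * η) a
    simp only [pairingIntegrand, lowerIntegrand]
    rw [k3, show u - (n + 2) * -η = u + (n + 2) * η by ring, div_sub_div _ _ n1 n2, ← mul_div_assoc,
      div_eq_div_iff hne (mul_ne_zero n1 n2)]
    rw [← mul_assoc 2 ((n : ℂ) + 2) η] at W
    set K := thetaKernel τ η (n + 1 + 2) (conj u) u with hK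
    linear_combination (-(f u * h (conj u) * theta τ (2 * conj u) *
      thetaKernel τ η (n + 2) (conj u) (u - η) * thetaKernel τ η (n + 2) (conj u) (u + η))) * W -
      (theta τ (u - (n + 2) * η + a) * theta τ (u - (n + 2) * η - a) * f u * h (conj u) *
        theta τ (2 * conj u) * thetaKernel τ η (n + 2) (conj u) (u + η)) * k1 +
      (theta τ (u + (n + 2) * η + a) * theta τ (u + (n + 2) * η - a) * f u * h (conj u) *
        theta τ (2 * conj u) * thetaKernel τ η (n + 2) (conj u) (u - η)) * k2
  rw [l, r, integral_sub i2 i4, integral_sub i1 i3, e1, e2]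

/-! ### The lowering operator -/

lemma theta_two_mul_one_fourth_ne_zero {τ : ℂ} (hτ : 0 < τ.im) : theta τ (2 * (1 / 4)) ≠ 0 := by
  rw [Ne, theta_eq_zero_iff hτ]
  rintro ⟨m, n, h⟩
  have him := congrArg Complex.im h
  have : n = 0 := by simpa [hτ.ne'] using him
  subst this
  have hre := congrArg Complex.re h
  simp at hre
  have h2 : (2 * m : ℤ) = 1 := by
    have : (2 * m : ℝ) = 1 := by linarith
    exact_mod_cast this
  omega

lemma differentiable_theta_two_mul {τ : ℂ} (hτ : 0 < τ.im) :
    Differentiable ℂ fun u => theta τ (2 * u) :=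
  (differentiable_theta hτ).comp (by fun_prop : Differentiable ℂ fun u : ℂ => 2 * u)

lemma eq_of_mul_theta_eq {τ : ℂ} (hτ : 0 < τ.im) {f g : ℂ → ℂ} (hf : Continuous f)
    (hg : Continuous g) (H : ∀ x, f x * theta τ (2 * x) = g x * theta τ (2 * x)) (x : ℂ) :
    f x = g x :=
  congrFun (eq_of_eq_of_ne_zero hf hg (differentiable_theta_two_mul hτ)
    (theta_two_mul_one_fourth_ne_zero hτ) fun x hx => mul_right_cancel₀ hx (H x)) x

/-- The lowering operator maps `Θ_{n+1}` to `Θ_n`. -/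
lemma exists_lower {τ : ℂ} (hτ : 0 < τ.im) (η : ℂ) {n : ℕ} (a : ℂ) {f : ℂ → ℂ}
    (hf : f ∈ evenTheta τ (n + 1)) : ∃ F ∈ evenTheta τ n, ∀ u,
      theta τ (u - (n + 1) * η + a) * theta τ (u - (n + 1) * η - a) * f (u + η) -
      theta τ (u + (n + 1) * η + a) * theta τ (u + (n + 1) * η - a) * f (u - η) =
      F u * theta τ (2 * u) := by
  have hθ := differentiable_theta hτ
  have hf1 := hf.1
  set g : ℂ → ℂ := fun u =>
    theta τ (u - (n + 1) * η + a) * theta τ (u - (n + 1) * η - a) * f (u + η) -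
      theta τ (u + (n + 1) * η + a) * theta τ (u + (n + 1) * η - a) * f (u - η) with hg
  have d1 : ∀ b, Differentiable ℂ fun u : ℂ => theta τ (u + b) := fun b => hθ.comp (by fun_prop)
  have d2 : ∀ b, Differentiable ℂ fun u : ℂ => f (u + b) := fun b => hf1.comp (by fun_prop)
  have dg : Differentiable ℂ g := by
    have := (((d1 (-(n + 1) * η + a)).fun_mul (d1 (-(n + 1) * η - a))).fun_mul (d2 η)).fun_sub
      (((d1 ((n + 1) * η + a)).fun_mul (d1 ((n + 1) * η - a))).fun_mul (d2 (-η)))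
    refine (funext fun u => ?_ : _ = g) ▸ this
    simp only [hg]
    ring_nf
  have g1 : ∀ u, g (u + 1) = g u := fun u => by
    simp only [hg]
    rw [show u + 1 - (n + 1) * η = u - (n + 1) * η + 1 by ring,
      show u + 1 + (n + 1) * η = u + (n + 1) * η + 1 by ring, theta_mul_add_one, theta_mul_add_one,
      add_right_comm u 1 η, add_sub_right_comm u 1 η, hf.2.1, hf.2.1]
  have g2 : ∀ u, g (u + τ) = cexp (-(2 * Real.pi * I * (n + 2 : ℕ) * (2 * u + τ))) * g u :=
    fun u => by
    simp only [hg]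
    rw [show u + τ - (n + 1) * η = u - (n + 1) * η + τ by ring,
      show u + τ + (n + 1) * η = u + (n + 1) * η + τ by ring, theta_mul_add_tau hτ,
      theta_mul_add_tau hτ, add_right_comm u τ η, add_sub_right_comm u τ η, hf.2.2.1, hf.2.2.1]
    have e1 : cexp (-(2 * Real.pi * I * (n + 2 : ℕ) * (2 * u + τ))) =
        cexp (-(2 * Real.pi * I * (2 * (u - (n + 1) * η) + τ))) *
        cexp (-(2 * Real.pi * I * (n + 1 : ℕ) * (2 * (u + η) + τ))) := by
      rw [← Complex.exp_add]; push_cast; ring_nf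
    have e2 : cexp (-(2 * Real.pi * I * (n + 2 : ℕ) * (2 * u + τ))) =
        cexp (-(2 * Real.pi * I * (2 * (u + (n + 1) * η) + τ))) *
        cexp (-(2 * Real.pi * I * (n + 1 : ℕ) * (2 * (u - η) + τ))) := by
      rw [← Complex.exp_add]; push_cast; ring_nf
    linear_combination
      (-(theta τ (u - (n + 1) * η + a) * theta τ (u - (n + 1) * η - a) * f (u + η))) * e1 +
      (theta τ (u + (n + 1) * η + a) * theta τ (u + (n + 1) * η - a) * f (u - η)) * e2
  have g3 : ∀ u, g (-u) = -g u := fun u => by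
    simp only [hg]
    rw [show -u - (n + 1) * η = -(u + (n + 1) * η) by ring,
      show -u + (n + 1) * η = -(u - (n + 1) * η) by ring, theta_mul_neg hτ, theta_mul_neg hτ,
      show -u + η = -(u - η) by ring, show -u - η = -(u + η) by ring, hf.2.2.2, hf.2.2.2]
    ring
  -- The numerator is odd with the multiplier of Θ_{n+2}, so it vanishes at the half periods, which
  -- are the zeros, all simple, of θ(2u). The multiplier of θ(2u) is that of Θ_2, leaving Θ_n for
  -- the quotient.
  obtain ⟨F, dF, hF⟩ := exists_entire_quotient dg (differentiable_theta_two_mul hτ) fun u hu => by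
    refine ⟨?_, odd_quasi_periodic_eq_zero g1 g2 g3 ((theta_eq_zero_iff hτ _).1 hu)⟩
    have : HasDerivAt (fun u => theta τ (2 * u)) (deriv (theta τ) (2 * u) * 2) u := by
      have h2 : HasDerivAt (fun u : ℂ => 2 * u) 2 u := by
        simpa using (hasDerivAt_id u).const_mul (2 : ℂ)
      exact (hθ (2 * u)).hasDerivAt.comp u h2
    rw [this.deriv]
    exact mul_ne_zero (deriv_theta_ne_zero hτ hu) two_ne_zero
  refine ⟨F, ⟨dF, ?_, ?_, ?_⟩, hF⟩
  · refine eq_of_mul_theta_eq hτ (dF.continuous.comp (by fun_prop)) dF.continuous fun u => ?_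
    have := hF (u + 1)
    rw [g1, hF, theta_two_mul_add_one] at this
    exact this.symm
  · have hc := dF.continuous
    refine eq_of_mul_theta_eq hτ (hc.comp (by fun_prop)) (by fun_prop) fun u => ?_
    have := hF (u + τ)
    rw [g2, hF, theta_two_mul_add_tau hτ] at this
    have e1 : cexp (-(2 * Real.pi * I * (n + 2 : ℕ) * (2 * u + τ))) =
        cexp (-(2 * Real.pi * I * n * (2 * u + τ))) *
        cexp (-(2 * Real.pi * I * (4 * u + 2 * τ))) := by
      rw [← Complex.exp_add]; push_cast; ring_nf
    rw [e1] at this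
    refine mul_left_cancel₀ (Complex.exp_ne_zero (-(2 * Real.pi * I * (4 * u + 2 * τ)))) ?_
    linear_combination -this
  · refine eq_of_mul_theta_eq hτ (dF.continuous.comp (by fun_prop)) dF.continuous fun u => ?_
    have := hF (-u)
    rw [g3, hF, mul_neg, theta_neg hτ] at this
    linear_combination this

/-! ### The case `N = 0` -/

/-- Put x = u + ū, y = u - ū, w = η in `theta3_addition` and differentiate in z at z = η. On the
right only the derivative of θ(z - η) survives, giving θ(2u) θ(2ū) θ(2η) θ'(0); dividing by the four
`theta3` factors yields logarithmic derivatives. -/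
lemma pairingIntegrand_zero {τ : ℂ} (hre : τ.re = 0) (hτ : 0 < τ.im) {η : ℂ}
    (hη : InRegion τ η 0) (u : ℂ) :
    theta τ (2 * u) * theta τ (2 * conj u) / thetaKernel τ η 2 (conj u) u *
        (deriv (theta τ) 0 * theta τ (2 * η)) =
      logDeriv (theta3 τ) (u + conj u + η) - logDeriv (theta3 τ) (u + conj u - η) -
        (logDeriv (theta3 τ) (u - conj u + η) - logDeriv (theta3 τ) (u - conj u - η)) := by
  have hne := thetaKernel_conj_ne_zero hre hτ hη u
  set x := u + conj u with hx
  set y := u - conj u with hy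
  have hk : thetaKernel τ η 2 (conj u) u = (theta3 τ (x - η) * theta3 τ (x + η)) *
      (theta3 τ (y - η) * theta3 τ (y + η)) := by
    simp only [thetaKernel, thetaProd, Finset.prod_range_succ, Finset.prod_range_zero]
    rw [hx, hy]
    push_cast
    ring_nf
  rw [zero_add, hk] at hne
  have n1 := left_ne_zero_of_mul (left_ne_zero_of_mul hne)
  have n2 := right_ne_zero_of_mul (left_ne_zero_of_mul hne)
  have n3 := left_ne_zero_of_mul (right_ne_zero_of_mul hne)
  have n4 := right_ne_zero_of_mul (right_ne_zero_of_mul hne)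
  have h3 := differentiable_theta3 hτ
  have hθ := differentiable_theta hτ
  have hp : ∀ c, HasDerivAt (fun z => theta3 τ (c + z)) (deriv (theta3 τ) (c + η)) η := fun c => by
    simpa using (h3 (c + η)).hasDerivAt.comp_const_add c η
  have hm : ∀ c, HasDerivAt (fun z => theta3 τ (c - z)) (-deriv (theta3 τ) (c - η)) η := fun c => by
    simpa using (h3 (c - η)).hasDerivAt.comp_const_sub c η
  have L := (((hp x).fun_mul (hm x)).mul_const (theta3 τ (y + η) * theta3 τ (y - η))).fun_sub
    (((hp y).fun_mul (hm y)).const_mul (theta3 τ (x + η) * theta3 τ (x - η)))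
  have ta : HasDerivAt (fun z => theta τ (z + η)) (deriv (theta τ) (η + η)) η := by
    simpa using (hθ (η + η)).hasDerivAt.comp_add_const η η
  have tb : HasDerivAt (fun z => theta τ (z - η)) (deriv (theta τ) (η - η)) η := by
    simpa using (hθ (η - η)).hasDerivAt.comp_sub_const η η
  have R := (ta.fun_mul tb).const_mul (theta τ (x + y) * theta τ (x - y))
  have key := L.unique (R.congr_of_eventuallyEq (Eventually.of_forall fun z =>
    theta3_addition hτ x y z η))
  rw [sub_self, theta_zero hτ, mul_zero, zero_add, show x + y = 2 * u by rw [hx, hy]; ring,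
    show x - y = 2 * conj u by rw [hx, hy]; ring, ← two_mul] at key
  rw [hk]
  simp only [logDeriv_apply]
  field_simp
  linear_combination -key

lemma differentiableAt_logDeriv_theta3 {τ : ℂ} (hτ : 0 < τ.im) {x : ℂ} (hx : theta3 τ x ≠ 0) :
    DifferentiableAt ℂ (logDeriv (theta3 τ)) x := by
  have h3 := differentiable_theta3 hτ
  have := (h3.analyticAt x).deriv.differentiableAt.div (h3 x) hx
  exact this

lemma integral_logDeriv_re {τ : ℂ} (hτ : 0 < τ.im) {η : ℂ} (hη : |η.im| < τ.im / 2) :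
    ∫ x in (0 : ℝ)..1, logDeriv (theta3 τ) (2 * x + η) =
      ∫ x in (0 : ℝ)..1, logDeriv (theta3 τ) (2 * x - η) := by
  have hper : ∀ z, logDeriv (theta3 τ) (z + 1) = logDeriv (theta3 τ) z := fun z => by
    have : deriv (theta3 τ) (z + 1) = deriv (theta3 τ) z := by
      rw [← deriv_comp_add_const, funext (theta3_add_one τ)]
    rw [logDeriv_apply, logDeriv_apply, this, theta3_add_one]
  have := integral_add_eq_of_periodic (T := 1)
    (g := fun z => logDeriv (theta3 τ) (2 * z - η)) (fun z => by
      simp only [ofReal_one]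
      rw [show 2 * (z + 1) - η = 2 * z - η + 1 + 1 by ring, hper, hper]) η (fun z hz => by
      have hne : theta3 τ (2 * z - η) ≠ 0 := by
        refine theta3_ne_zero_of_im hτ (lt_of_le_of_lt ?_ hη)
        have e : (2 * z - η).im = 2 * z.im - η.im := by simp
        rw [e]
        rcases Set.mem_uIcc.1 hz with h | h
        · rw [abs_of_nonneg (h.1.trans h.2), abs_le]; constructor <;> linarith
        · rw [abs_of_nonpos (h.1.trans h.2), abs_le]; constructor <;> linarith
      exact DifferentiableAt.comp (f := fun z : ℂ => 2 * z - η) z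
        (differentiableAt_logDeriv_theta3 hτ hne) (by fun_prop))
  rw [← this]
  refine intervalIntegral.integral_congr fun x _ => ?_
  ring_nf

/-- The logarithmic derivative of `theta3` changes by -2πi under z ↦ z + τ. Adding 2πi z / τ makes
it periodic, so that the contour can be shifted; the linear term accounts for the value. -/
lemma integral_logDeriv_im {τ : ℂ} (hre : τ.re = 0) (hτ : 0 < τ.im) {η : ℂ}
    (hη : |η.re| < 1 / 2) :
    (∫ y in (0 : ℝ)..τ.im, logDeriv (theta3 τ) (2 * (y * I) + η)) -
      ∫ y in (0 : ℝ)..τ.im, logDeriv (theta3 τ) (2 * (y * I) - η) = -(4 * Real.pi * η) := by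
  have hτI : τ = τ.im * I := by apply Complex.ext <;> simp [hre]
  have hτ0 : τ ≠ 0 := fun h => by simp [h] at hτ
  have h3 := differentiable_theta3 hτ
  set c : ℂ := 2 * Real.pi * I / τ with hc
  have hcτ : c * τ = 2 * Real.pi * I := by rw [hc]; field_simp
  -- Written as one quotient, so that periodicity also holds at the zeros of `theta3`, where
  -- division by zero gives 0.
  set G : ℂ → ℂ := fun z => (deriv (theta3 τ) z + c * z * theta3 τ z) / theta3 τ z with hG
  have hper : ∀ z, G (z + τ) = G z := fun z => by
    have hd : deriv (theta3 τ) (z + τ) = cexp (-(Real.pi * I * (2 * z + τ))) *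
        (deriv (theta3 τ) z - 2 * Real.pi * I * theta3 τ z) := by
      rw [← deriv_comp_add_const, funext (theta3_add_tau hτ)]
      have h1 : HasDerivAt (fun z => cexp (-(Real.pi * I * (2 * z + τ))))
          (cexp (-(Real.pi * I * (2 * z + τ))) * (-(2 * Real.pi * I))) z := by
        have h2 : HasDerivAt (fun z => -(Real.pi * I * (2 * z + τ))) (-(2 * Real.pi * I)) z :=
          ((((hasDerivAt_id z).const_mul (2 : ℂ)).add_const τ).const_mul
            (Real.pi * I : ℂ)).fun_neg.congr_deriv (by ring)
        exact h2.cexp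
      rw [(h1.fun_mul (h3 z).hasDerivAt).deriv]
      ring
    simp only [hG]
    rw [hd, theta3_add_tau hτ, ← mul_div_mul_left (deriv (theta3 τ) z + _) _ (Complex.exp_ne_zero
      (-(Real.pi * I * (2 * z + τ))))]
    congr 1
    linear_combination (cexp (-(Real.pi * I * (2 * z + τ))) * theta3 τ z) * hcτ
  have hGd : ∀ z, theta3 τ z ≠ 0 → G z = logDeriv (theta3 τ) z + c * z := fun z hz => by
    simp only [hG, logDeriv_apply]
    field_simp
  have hne : ∀ z : ℂ, z.im ∈ Set.uIcc 0 (-(I * η)).im → theta3 τ (2 * (z * I) - η) ≠ 0 := by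
    intro z hz
    refine theta3_ne_zero_of_re hτ hre (lt_of_le_of_lt ?_ hη)
    have e : (2 * (z * I) - η).re = -2 * z.im - η.re := by simp
    rw [e]
    simp only [neg_im, mul_im, I_re, zero_mul, I_im, one_mul, zero_add] at hz
    rcases Set.mem_uIcc.1 hz with h | h
    · rw [abs_of_nonpos (show η.re ≤ 0 by linarith), abs_le]; constructor <;> linarith
    · rw [abs_of_nonneg (show 0 ≤ η.re by linarith), abs_le]; constructor <;> linarith
  have := integral_add_eq_of_periodic (T := τ.im)
    (g := fun z => G (2 * (z * I) - η)) (fun z => by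
      rw [show 2 * ((z + τ.im) * I) - η = 2 * (z * I) - η + τ + τ by
        linear_combination (-2) * hτI, hper, hper]) (-(I * η)) (fun z hz => by
      have hne := hne z hz
      have d : DifferentiableAt ℂ G (2 * (z * I) - η) := by
        have d1 : DifferentiableAt ℂ (deriv (theta3 τ)) (2 * (z * I) - η) :=
          (h3.analyticAt _).deriv.differentiableAt
        have d2 := h3 (2 * (z * I) - η)
        have d3 : DifferentiableAt ℂ
          (fun z => deriv (theta3 τ) z + c * z * theta3 τ z) (2 * (z * I) - η) := by fun_prop
        exact d3.fun_div d2 hne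
      exact DifferentiableAt.comp (f := fun z : ℂ => 2 * (z * I) - η) z d (by fun_prop))
  have e1 : ∀ y : ℝ, 2 * ((y + -(I * η)) * I) - η = 2 * (y * I) + η := fun y => by
    linear_combination (-2 * η) * I_mul_I
  have e2 : ∀ y : ℝ, theta3 τ (2 * (y * I) + η) ≠ 0 := fun y => by
    rw [← e1]; refine hne _ ?_; simp
  have e3 : ∀ y : ℝ, theta3 τ (2 * (y * I) - η) ≠ 0 := fun y => by
    refine hne _ ?_; simp
  simp only [e1, hGd _ (e2 _), hGd _ (e3 _)] at this
  have cL : ∀ b : ℂ, (∀ y : ℝ, theta3 τ (2 * (y * I) + b) ≠ 0) →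
      Continuous fun y : ℝ => logDeriv (theta3 τ) (2 * (y * I) + b) := fun b hb => by
    rw [continuous_iff_continuousAt]
    intro y
    exact ContinuousAt.comp (f := fun y : ℝ => (2 * (y * I) + b : ℂ))
      (differentiableAt_logDeriv_theta3 hτ (hb y)).continuousAt (by fun_prop)
  have c1 := cL η e2
  have c2 := cL (-η) (by simpa [sub_eq_add_neg] using e3)
  simp only [← sub_eq_add_neg] at c2
  have c3 : ∀ b : ℂ, Continuous fun y : ℝ => c * (2 * (y * I) + b) := fun b => by fun_prop
  have c4 := c3 (-η)
  simp only [← sub_eq_add_neg] at c4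
  rw [intervalIntegral.integral_add (c1.intervalIntegrable _ _) ((c3 η).intervalIntegrable _ _),
    intervalIntegral.integral_add (c2.intervalIntegrable _ _) (c4.intervalIntegrable _ _)] at this
  have h5 : (∫ y in (0 : ℝ)..τ.im, c * (2 * (y * I) + η)) -
      ∫ y in (0 : ℝ)..τ.im, c * (2 * (y * I) - η) = 4 * Real.pi * η := by
    rw [← intervalIntegral.integral_sub ((c3 η).intervalIntegrable _ _)
      (c4.intervalIntegrable _ _)]
    have : ∀ y : ℝ, c * (2 * (y * I) + η) - c * (2 * (y * I) - η) = 2 * c * η := fun y => by ring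
    simp only [this]
    rw [intervalIntegral.integral_const, sub_zero, Complex.real_smul]
    rw [hτI] at hcτ
    have hI : I * I = -1 := I_mul_I
    linear_combination (-2 * η * I) * hcτ + (-4 * Real.pi * η + 2 * η * c * τ.im) * hI
  linear_combination this - h5

/-- The normalization constant of the pairing. -/
def pairingConst (τ η : ℂ) (N : ℕ) : ℂ :=
  2 * η * pPow τ (-1 / 8) / (theta τ (2 * (N + 1) * η) * qPoch (pOf τ) (pOf τ) ^ 3)

/-- Since u + ū = 2x and u - ū = 2iy, each logarithmic derivative depends on one real variable. The
x-part cancels by 1-periodicity and the y-part gives 4πη; division by θ'(0) θ(2η) gives the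
constant. -/
lemma integral_zero {τ : ℂ} (hre : τ.re = 0) (hτ : 0 < τ.im) {η : ℂ}
    (hη : InRegion τ η 0) (h0 : η ≠ 0) :
    ∫ u in fundDomain τ, theta τ (2 * u) * theta τ (2 * conj u) / thetaKernel τ η 2 (conj u) u =
      pairingConst τ η 0 := by
  have hθ2 := theta_two_mul_ne_zero hre hτ hη h0
  simp only [Nat.cast_zero, zero_add, mul_one] at hθ2
  have hD := deriv_theta_zero_ne_zero hτ
  obtain ⟨r1, r2⟩ := hη.mul_lt
  simp only [Nat.cast_zero, zero_add, one_mul] at r1 r2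
  have cs : ∀ b : ℂ, |b.im| < τ.im / 2 →
      Continuous fun u => logDeriv (theta3 τ) (u + conj u + b) := fun b hb => by
    rw [continuous_iff_continuousAt]
    intro u
    exact ContinuousAt.comp (f := fun u : ℂ => (u + conj u + b : ℂ))
      (differentiableAt_logDeriv_theta3 hτ (theta3_ne_zero_of_im hτ (by simpa))).continuousAt
      (by fun_prop)
  have cd : ∀ b : ℂ, |b.re| < 1 / 2 →
      Continuous fun u => logDeriv (theta3 τ) (u - conj u + b) := fun b hb => by
    rw [continuous_iff_continuousAt]
    intro u
    exact ContinuousAt.comp (f := fun u : ℂ => (u - conj u + b : ℂ))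
      (differentiableAt_logDeriv_theta3 hτ
        (theta3_ne_zero_of_re hτ hre (by simpa using hb))).continuousAt
      (by fun_prop)
  have c1 := cs η r2
  have c2 := cs (-η) (by simpa)
  have c3 := cd η r1
  have c4 := cd (-η) (by simpa using r1)
  have key : (∫ u in fundDomain τ,
      theta τ (2 * u) * theta τ (2 * conj u) / thetaKernel τ η 2 (conj u) u) *
        (deriv (theta τ) 0 * theta τ (2 * η)) = 4 * Real.pi * η := by
    rw [← integral_mul_const]
    simp only [pairingIntegrand_zero hre hτ hη]
    simp only [sub_eq_add_neg _ η]
    have c12 : Continuous fun u => logDeriv (theta3 τ) (u + conj u + η) -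
      logDeriv (theta3 τ) (u + conj u + -η) := c1.sub c2
    have c34 : Continuous fun u => logDeriv (theta3 τ) (u - conj u + η) -
      logDeriv (theta3 τ) (u - conj u + -η) := c3.sub c4
    rw [integral_sub (integrableOn_fundDomain τ c12) (integrableOn_fundDomain τ c34),
      integral_sub (integrableOn_fundDomain τ c1) (integrableOn_fundDomain τ c2),
      integral_sub (integrableOn_fundDomain τ c3) (integrableOn_fundDomain τ c4),
      setIntegral_fundDomain_swap hτ c1, setIntegral_fundDomain_swap hτ c2,
      setIntegral_fundDomain hτ c3, setIntegral_fundDomain hτ c4]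
    have es : ∀ (x y : ℝ) (b : ℂ), (x + y * I : ℂ) + conj (x + y * I : ℂ) + b = 2 * x + b :=
      fun x y b => by simp; ring
    have ed : ∀ (x y : ℝ) (b : ℂ), (x + y * I : ℂ) - conj (x + y * I : ℂ) + b = 2 * (y * I) + b :=
      fun x y b => by simp; ring
    simp only [es, ed]
    simp only [← sub_eq_add_neg]
    rw [integral_logDeriv_re hτ r2]
    have := integral_logDeriv_im hre hτ r1
    simp
    linear_combination -this
  rw [pairingConst]
  have hQ := qPoch_self_ne_zero hτ
  have hP := pPow_ne_zero τ (1 / 8)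
  have hpi : (Real.pi : ℂ) ≠ 0 := by exact_mod_cast Real.pi_ne_zero
  have h8 : pPow τ (1 / 8) * pPow τ (-1 / 8) = 1 := by
    rw [← pPow_add]; simp [pPow, neg_div]
  simp only [Nat.cast_zero, zero_add, mul_one]
  rw [eq_div_iff (mul_ne_zero hθ2 (pow_ne_zero _ hQ))]
  rw [deriv_theta_zero hτ] at key
  refine mul_left_cancel₀ (mul_ne_zero (mul_ne_zero two_ne_zero hpi) hP) ?_
  linear_combination key - 4 * Real.pi * η * h8

/-! ### The reproducing property -/

lemma InRegion.mono {τ η : ℂ} {m N : ℕ} (h : InRegion τ η N) (hmN : m ≤ N) : InRegion τ η m := by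
  induction hmN with
  | refl => exact h
  | step _ ih => exact ih h.of_succ

lemma pairing_thetaKernel_of_ne_zero {τ : ℂ} (hre : τ.re = 0) (hτ : 0 < τ.im) {η : ℂ}
    (h0 : η ≠ 0) {n : ℕ} (hη : InRegion τ η n) {f : ℂ → ℂ} (hf : f ∈ evenTheta τ n) (a : ℂ) :
    pairing τ η n f (thetaKernel τ η n a) = pairingConst τ η n * f a := by
  induction n generalizing f a with
  | zero =>
    have hconst := apply_eq_apply_of_doubly_periodic hτ hf.1 hf.2.1
      (fun x => by simpa using hf.2.2.1 x)
    rw [← integral_zero hre hτ hη h0, pairing, ← integral_mul_const]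
    refine integral_congr_ae (Eventually.of_forall fun u => ?_)
    simp only [pairingIntegrand]
    rw [hconst u a, thetaKernel, thetaProd_zero, thetaProd_zero]
    ring
  | succ n ih =>
    have hη' := hη.of_succ
    have hθ1 := theta_two_mul_ne_zero hre hτ hη' h0
    have hθ2 := theta_two_mul_ne_zero hre hτ hη h0
    have key : ∀ a, theta τ (2 * (a - η)) ≠ 0 →
        pairing τ η (n + 1) f (thetaKernel τ η (n + 1) a) = pairingConst τ η (n + 1) * f a := by
      intro a ha
      -- The parameter a + nη is the one for which `thetaKernel_succ` rebuilds the kernel of order n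
      -- + 1 from the one of order n at a - η.
      obtain ⟨F, hF, hFf⟩ := exists_lower hτ η (a + n * η) hf
      have h1 := pairing_lower hre hτ hη (a + n * η) hf (thetaKernel_mem_evenTheta hτ η n (a - η))
        hFf
      simp only [← thetaKernel_succ] at h1
      change _ = _ * pairing τ η (n + 1) f (thetaKernel τ η (n + 1) a) at h1
      rw [ih hη' hF] at h1
      -- At u = a - η the second term of the lowering operator contains θ(0) = 0, and the first
      -- contains θ(2u), which cancels.
      have h2 : F (a - η) = -theta τ (2 * (n + 1) * η) * f a := by
        have h3 := hFf (a - η)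
        rw [show a - η - (n + 1) * η + (a + n * η) = 2 * (a - η) by ring,
          show a - η - (n + 1) * η - (a + n * η) = -(2 * (n + 1) * η) by ring,
          show a - η + (n + 1) * η - (a + n * η) = 0 by ring, theta_zero hτ, theta_neg hτ,
          sub_add_cancel] at h3
        refine mul_right_cancel₀ ha ?_
        linear_combination -h3
      rw [h2] at h1
      push_cast at hθ2
      rw [show (n : ℂ) + 1 + 1 = n + 2 by ring] at hθ2
      have hQ := qPoch_self_ne_zero hτ
      refine mul_left_cancel₀ (neg_ne_zero.2 hθ2) ?_
      rw [← h1, pairingConst, pairingConst]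
      push_cast
      rw [show (n : ℂ) + 1 + 1 = n + 2 by ring]
      generalize theta τ (2 * (n + 1) * η) = A at hθ1 ⊢
      generalize theta τ (2 * (n + 2) * η) = B at hθ2 ⊢
      field_simp
    by_cases ha : theta τ (2 * (a - η)) = 0
    -- The kernel and f are even in a, so -a serves as well. Both choices can fail only if 4η is a
    -- period, which the region at level 1 excludes.
    · have ha' : theta τ (2 * (-a - η)) ≠ 0 := by
        intro h
        rw [theta_eq_zero_iff hτ] at ha h
        have h3 := (ha.add h).neg
        rw [show -(2 * (a - η) + 2 * (-a - η)) = 2 * ((1 : ℕ) + 1) * η by push_cast; ring,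
          ← theta_eq_zero_iff hτ] at h3
        exact theta_two_mul_ne_zero (N := 1) hre hτ (hη.mono (by omega)) h0 h3
      have := key (-a) ha'
      rwa [funext (thetaKernel_neg τ η (n + 1) a), hf.2.2.2] at this
    · exact key a ha

/-- The constant in the reproducing property, for all `η`. -/
def reproducingConst (τ η : ℂ) (N : ℕ) : ℂ :=
  pPow τ (-1 / 8) / ((N + 1) * dslope (theta τ) 0 (2 * (N + 1) * η) * qPoch (pOf τ) (pOf τ) ^ 3)

lemma mul_dslope_theta {τ : ℂ} (hτ : 0 < τ.im) (x : ℂ) : x * dslope (theta τ) 0 x = theta τ x := by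
  have := sub_smul_dslope (theta τ) 0 x
  rwa [theta_zero hτ, sub_zero, sub_zero, smul_eq_mul] at this

lemma pairingConst_eq {τ : ℂ} (hre : τ.re = 0) (hτ : 0 < τ.im) {η : ℂ} {N : ℕ}
    (hη : InRegion τ η N) (h0 : η ≠ 0) : pairingConst τ η N = reproducingConst τ η N := by
  have h1 := theta_two_mul_ne_zero hre hτ hη h0
  rw [pairingConst, reproducingConst]
  rw [← mul_dslope_theta hτ] at h1 ⊢
  have h2 := right_ne_zero_of_mul h1
  have hQ := qPoch_self_ne_zero hτ
  have hN : (N : ℂ) + 1 ≠ 0 := Nat.cast_add_one_ne_zero N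
  field_simp

lemma dslope_theta_ne_zero {τ : ℂ} (hre : τ.re = 0) (hτ : 0 < τ.im) {η : ℂ} {N : ℕ}
    (hη : InRegion τ η N) : dslope (theta τ) 0 (2 * (N + 1) * η) ≠ 0 := by
  by_cases h0 : η = 0
  · simpa [h0] using deriv_theta_zero_ne_zero hτ
  · have h1 := theta_two_mul_ne_zero hre hτ hη h0
    rw [← mul_dslope_theta hτ] at h1
    exact right_ne_zero_of_mul h1

lemma reproducingConst_ne_zero {τ : ℂ} (hre : τ.re = 0) (hτ : 0 < τ.im) {η : ℂ} {N : ℕ}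
    (hη : InRegion τ η N) : reproducingConst τ η N ≠ 0 :=
  div_ne_zero (pPow_ne_zero _ _) (mul_ne_zero (mul_ne_zero (Nat.cast_add_one_ne_zero N)
    (dslope_theta_ne_zero hre hτ hη)) (pow_ne_zero _ (qPoch_self_ne_zero hτ)))

/-! ### Continuity in η and the limit η → 0 -/

lemma continuous_thetaProd {τ : ℂ} (hτ : 0 < τ.im) (m : ℕ) :
    Continuous fun p : ℂ × ℂ => thetaProd τ p.1 m p.2 := by
  have := (differentiable_theta3 hτ).continuous
  unfold thetaProd
  fun_prop

lemma inRegion_zero {τ : ℂ} (hτ : 0 < τ.im) (N : ℕ) : InRegion τ 0 N := by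
  constructor
  · simp; positivity
  · simp; positivity

lemma isOpen_inRegion (τ : ℂ) (N : ℕ) : IsOpen {η | InRegion τ η N} :=
  IsOpen.and (isOpen_lt (by fun_prop) (by fun_prop)) (isOpen_lt (by fun_prop) (by fun_prop))

lemma continuousOn_pairingIntegrand {τ : ℂ} (hre : τ.re = 0) (hτ : 0 < τ.im) {N : ℕ} {f : ℂ → ℂ}
    (hf : Continuous f) (a : ℂ) : ContinuousOn (fun p : ℂ × ℂ =>
      pairingIntegrand τ p.1 N f (thetaKernel τ p.1 N a) p.2)
      ({η | InRegion τ η N} ×ˢ Set.univ) := by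
  have hθ := (differentiable_theta hτ).continuous
  have hP := continuous_thetaProd hτ
  have c1 : ∀ g : ℂ × ℂ → ℂ, Continuous g → ∀ m, Continuous fun p : ℂ × ℂ =>
      thetaProd τ p.1 m (g p) := fun g hg m =>
    Continuous.comp (g := fun p : ℂ × ℂ => thetaProd τ p.1 m p.2)
      (f := fun p : ℂ × ℂ => (p.1, g p)) (hP m) (continuous_fst.prodMk hg)
  have d1 := c1 (fun p => conj p.2 + a) (by fun_prop) N
  have d2 := c1 (fun p => conj p.2 - a) (by fun_prop) N
  have d3 := c1 (fun p => p.2 + conj p.2) (by fun_prop) (N + 2)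
  have d4 := c1 (fun p => p.2 - conj p.2) (by fun_prop) (N + 2)
  have d5 : Continuous fun p : ℂ × ℂ => f p.2 * (thetaProd τ p.1 N (conj p.2 + a) *
      thetaProd τ p.1 N (conj p.2 - a)) * (theta τ (2 * p.2) * theta τ (2 * conj p.2)) := by
    fun_prop
  refine d5.continuousOn.div (d3.mul d4).continuousOn ?_
  rintro ⟨η, u⟩ ⟨h, -⟩
  exact thetaKernel_conj_ne_zero hre hτ h u

/-- Dominated convergence: the integrand is jointly continuous, hence bounded, on a closed ball of η
times the closed period cell. -/
lemma continuousAt_pairing_zero {τ : ℂ} (hre : τ.re = 0) (hτ : 0 < τ.im) {N : ℕ} {f : ℂ → ℂ}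
    (hf : Continuous f) (a : ℂ) :
    ContinuousAt (fun η => pairing τ η N f (thetaKernel τ η N a)) 0 := by
  obtain ⟨δ, hδ, hball⟩ := Metric.nhds_basis_closedBall.mem_iff.1
    ((isOpen_inRegion τ N).mem_nhds (inRegion_zero hτ N))
  have hcont := continuousOn_pairingIntegrand hre hτ (N := N) hf a
  obtain ⟨C, hC⟩ := ((isCompact_closedBall (0 : ℂ) δ).prod
    (isCompact_closedCell τ)).exists_bound_of_continuousOn
      (hcont.mono (Set.prod_mono hball (Set.subset_univ _)))
  refine continuousAt_of_dominated (bound := fun _ => C) ?_ ?_ ?_ ?_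
  · filter_upwards [Metric.closedBall_mem_nhds (0 : ℂ) hδ] with η hη
    exact (continuous_pairingIntegrand hre hτ (hball hη) hf
      (thetaKernel_mem_evenTheta hτ η N a).1.continuous).aestronglyMeasurable
  · filter_upwards [Metric.closedBall_mem_nhds (0 : ℂ) hδ] with η hη
    filter_upwards [ae_restrict_mem (measurableSet_fundDomain τ)] with u hu
    exact hC (η, u) ⟨hη, fundDomain_subset τ hu⟩
  · exact integrableOn_const (volume_fundDomain_lt_top τ).ne
  · refine Eventually.of_forall fun u => ?_
    have := hcont.continuousAt (x := (0, u)) (prod_mem_nhds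
      ((isOpen_inRegion τ N).mem_nhds (inRegion_zero hτ N)) univ_mem)
    exact ContinuousAt.comp (f := fun η : ℂ => (η, u)) this (by fun_prop)

/-- The reproducing property for the bilinear pairing. -/
theorem pairing_thetaKernel {τ : ℂ} (hre : τ.re = 0) (hτ : 0 < τ.im) {η : ℂ}
    {N : ℕ} (hη : InRegion τ η N) {f : ℂ → ℂ} (hf : f ∈ evenTheta τ N) (a : ℂ) :
    pairing τ η N f (thetaKernel τ η N a) = reproducingConst τ η N * f a := by
  by_cases h0 : η = 0
  · subst h0
    have c1 := continuousAt_pairing_zero hre hτ (N := N) hf.1.continuous a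
    have hds : Continuous (dslope (theta τ) 0) := by
      have : Differentiable ℂ (dslope (theta τ) 0) := fun y =>
        (((Complex.differentiableOn_dslope (s := Set.univ) univ_mem).2
          (differentiable_theta hτ).differentiableOn) y trivial).differentiableAt univ_mem
      exact this.continuous
    have c2 : ContinuousAt (fun η => reproducingConst τ η N * f a) 0 := by
      refine ContinuousAt.mul (ContinuousAt.div continuousAt_const ?_ ?_) continuousAt_const
      · exact Continuous.continuousAt (by fun_prop)
      · exact mul_ne_zero (mul_ne_zero (Nat.cast_add_one_ne_zero N)
          (dslope_theta_ne_zero hre hτ (inRegion_zero hτ N)))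
            (pow_ne_zero _ (qPoch_self_ne_zero hτ))
    -- Both sides are continuous at η = 0 and agree on a punctured neighbourhood.
    have t1 : Tendsto (fun η => pairing τ η N f (thetaKernel τ η N a)) (𝓝[≠] 0)
        (𝓝 (pairing τ 0 N f (thetaKernel τ 0 N a))) := c1.tendsto.mono_left nhdsWithin_le_nhds
    have t2 : Tendsto (fun η => reproducingConst τ η N * f a) (𝓝[≠] 0)
        (𝓝 (reproducingConst τ 0 N * f a)) := c2.tendsto.mono_left nhdsWithin_le_nhds
    refine tendsto_nhds_unique_of_eventuallyEq t1 t2 ?_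
    filter_upwards [nhdsWithin_le_nhds ((isOpen_inRegion τ N).mem_nhds (inRegion_zero hτ N)),
      self_mem_nhdsWithin] with η h1 h2
    rw [pairing_thetaKernel_of_ne_zero hre hτ h2 h1 hf, pairingConst_eq hre hτ h1 h2]
  · rw [pairing_thetaKernel_of_ne_zero hre hτ h0 hη hf, pairingConst_eq hre hτ hη h0]

/-! ### Sklyanin's scalar product and its reproducing kernel -/

/-- The exponential factor is free of η because the shifts 2k - m + 1 sum to zero. -/
lemma prod_theta_add_half (τ η : ℂ) (m : ℕ) (x : ℂ) :
    ∏ k ∈ Finset.range m, theta τ (x + (2 * k - m + 1) * η + (1 / 2 + τ / 2)) =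
      pPow τ (-1 / 8) ^ m * cexp (-(Real.pi * I * m * x)) * thetaProd τ η m x := by
  have hs : ∀ (n : ℕ) (c : ℂ), ∑ k ∈ Finset.range n, (2 * (k : ℂ) - c) = n * (n - 1 - c) := by
    intro n c
    induction n with
    | zero => simp
    | succ n ih => rw [Finset.sum_range_succ, ih]; push_cast; ring
  have he : ∏ k ∈ Finset.range m, cexp (-(Real.pi * I * (x + (2 * k - m + 1) * η))) =
      cexp (-(Real.pi * I * m * x)) := by
    rw [← Complex.exp_sum]
    congr 1
    have h := hs m (m - 1)
    have : ∀ k : ℕ, -(Real.pi * I * (x + (2 * k - m + 1) * η)) =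
      -(Real.pi * I * x) + -(Real.pi * I * η) * (2 * k - (m - 1)) := fun k => by ring
    rw [Finset.sum_congr rfl fun k _ => this k, Finset.sum_add_distrib, ← Finset.mul_sum, h]
    simp
    ring
  simp only [theta_add_half]
  rw [Finset.prod_mul_distrib, Finset.prod_mul_distrib, he, thetaProd]
  simp

lemma exp_mul_prod_theta (τ η : ℂ) (m : ℕ) (u v : ℂ) :
    cexp (2 * Real.pi * I * u * m) * ∏ k ∈ Finset.range m,
      (theta τ (u + v + (2 * k - m + 1) * η + 1 / 2 + τ / 2) *
        theta τ (u - v + (2 * k - m + 1) * η + 1 / 2 + τ / 2)) =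
      pPow τ (-1 / 8) ^ (2 * m) * thetaKernel τ η m v u := by
  simp only [add_assoc _ (1 / 2 : ℂ) (τ / 2)]
  rw [Finset.prod_mul_distrib, prod_theta_add_half, prod_theta_add_half, thetaKernel]
  have e : cexp (2 * Real.pi * I * u * m) * cexp (-(Real.pi * I * m * (u + v))) *
      cexp (-(Real.pi * I * m * (u - v))) = 1 := by
    rw [← Complex.exp_add, ← Complex.exp_add, Complex.exp_eq_one_iff]
    exact ⟨0, by push_cast; ring⟩
  linear_combination (pPow τ (-1 / 8) ^ m * pPow τ (-1 / 8) ^ m * thetaProd τ η m (u + v) *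
    thetaProd τ η m (u - v)) * e

lemma weight_eq (τ η : ℂ) (N : ℕ) (u v : ℂ) : weight τ η N u v =
    theta τ (2 * u) * theta τ (2 * v) /
      (pPow τ (-1 / 8) ^ (2 * (N + 2)) * thetaKernel τ η (N + 2) v u) := by
  rw [weight, ← exp_mul_prod_theta]
  push_cast
  have : ∀ k : ℕ, (2 * (k : ℂ) - (N + 2) + 1) = 2 * k - N - 1 := fun k => by ring
  simp only [this]

lemma kernel_eq (τ η : ℂ) (N : ℕ) (v u : ℂ) : kernel τ η N v u =
    pPow τ (-1 / 8) ^ (2 * N) * thetaKernel τ η N (conj v) u := by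
  rw [kernel, exp_mul_prod_theta]

/-! ### Complex conjugation of the theta functions -/

lemma conj_pOf {τ : ℂ} (hre : τ.re = 0) : conj (pOf τ) = pOf τ := by
  have hτI : conj τ = -τ := by apply Complex.ext <;> simp [hre]
  rw [pOf, ← Complex.exp_conj]
  simp [hτI, map_ofNat]

lemma conj_pPow {τ : ℂ} (hre : τ.re = 0) {c : ℂ} (hc : conj c = c) :
    conj (pPow τ c) = pPow τ c := by
  have hτI : conj τ = -τ := by apply Complex.ext <;> simp [hre]
  rw [pPow, ← Complex.exp_conj]
  simp [hτI, hc, map_ofNat]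

lemma conj_qPoch {p : ℂ} (hp : ‖p‖ < 1) (a : ℂ) :
    conj (qPoch a p) = qPoch (conj a) (conj p) := by
  have := (multipliable_qPoch hp a).map_tprod (starRingEnd ℂ) Complex.continuous_conj
  rw [qPoch, this, qPoch]
  simp

lemma conj_theta {τ : ℂ} (hre : τ.re = 0) (hτ : 0 < τ.im) (x : ℂ) :
    conj (theta τ x) = theta τ (conj x) := by
  have hp := norm_pOf_lt_one hτ
  rw [← neg_neg (conj x), theta_neg hτ, theta_eq, theta_eq]
  simp only [map_mul, conj_qPoch hp, conj_pOf hre, ← Complex.exp_conj,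
    conj_pPow hre (c := 1 / 8) (by simp [map_ofNat])]
  simp [map_ofNat]

lemma conj_theta3 {τ : ℂ} (hre : τ.re = 0) (hτ : 0 < τ.im) (x : ℂ) :
    conj (theta3 τ x) = theta3 τ (conj x) := by
  have hp := norm_pOf_lt_one hτ
  rw [← theta3_neg, theta3, theta3]
  simp only [map_mul, map_neg, conj_qPoch hp, conj_pOf hre, ← Complex.exp_conj,
    conj_pPow hre (c := 1 / 2) (by simp [map_ofNat])]
  simp [map_ofNat]

lemma conj_thetaKernel {τ : ℂ} (hre : τ.re = 0) (hτ : 0 < τ.im) (η : ℂ) (m : ℕ) (a v : ℂ) :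
    conj (thetaKernel τ η m a v) = thetaKernel τ (conj η) m (conj a) (conj v) := by
  simp [thetaKernel, thetaProd, conj_theta3 hre hτ, map_ofNat]

/-- This is where real or purely imaginary η is needed: conj η = ±η leaves the kernel unchanged. -/
lemma thetaKernel_eq_of_eta {τ η η' : ℂ} (h : η' = η ∨ η' = -η) (m : ℕ) (a v : ℂ) :
    thetaKernel τ η' m a v = thetaKernel τ η m a v := by
  rcases h with rfl | rfl
  · rfl
  · simp only [thetaKernel, thetaProd_neg_eta]

lemma pPow_pow (τ c : ℂ) (n : ℕ) : pPow τ c ^ n = pPow τ (n * c) := by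
  rw [pPow, pPow, ← Complex.exp_nat_mul]; ring_nf

lemma kernelConst_eq {τ : ℂ} (hre : τ.re = 0) (hτ : 0 < τ.im) {η : ℂ} {N : ℕ}
    (hη : InRegion τ η N) : kernelConst τ η N = pPow τ (1 / 2) * reproducingConst τ η N := by
  by_cases h0 : η = 0
  · subst h0
    have h8 : pPow τ (1 / 2) * pPow τ (-1 / 8) = pPow τ (1 / 4) * pPow τ (1 / 8) := by
      rw [← pPow_add, ← pPow_add]; norm_num
    have hP := pPow_ne_zero τ (1 / 8)
    have hQ := qPoch_self_ne_zero hτ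
    have hN : (N : ℂ) + 1 ≠ 0 := Nat.cast_add_one_ne_zero N
    have hpi : (Real.pi : ℂ) ≠ 0 := by exact_mod_cast Real.pi_ne_zero
    rw [kernelConst, if_pos rfl, reproducingConst, mul_zero, dslope_same, deriv_theta_zero hτ,
      ← mul_div_assoc, h8]
    generalize pPow τ (1 / 8) = P at hP ⊢
    generalize pPow τ (1 / 4) = P'
    field_simp
  · have h8 : pPow τ (1 / 2) * pPow τ (-1 / 8) = pPow τ (3 / 8) := by
      rw [← pPow_add]; norm_num
    rw [kernelConst, if_neg h0, ← pairingConst_eq hre hτ hη h0, pairingConst, ← h8]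
    ring

lemma conj_kernelConst {τ : ℂ} (hre : τ.re = 0) (hτ : 0 < τ.im) {η : ℂ} (N : ℕ)
    (h : conj η = η ∨ conj η = -η) : conj (kernelConst τ η N) = kernelConst τ η N := by
  have hp := norm_pOf_lt_one hτ
  rw [kernelConst]
  split_ifs with h0
  · simp only [map_div₀, map_mul, map_pow, map_add, conj_qPoch hp, conj_pOf hre,
      conj_pPow hre (c := 1 / 4) (by simp [map_ofNat])]
    simp [map_ofNat]
  · simp only [map_div₀, map_mul, map_pow, conj_theta hre hτ, conj_qPoch hp, conj_pOf hre,
      conj_pPow hre (c := 3 / 8) (by simp [map_ofNat])]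
    simp only [map_ofNat, map_add, map_natCast, map_one]
    rcases h with h | h
    · rw [h]
    · rw [h, mul_neg, mul_neg, theta_neg hτ, neg_mul, neg_mul, neg_div_neg_eq]

lemma evenTheta.const_mul {τ : ℂ} {N : ℕ} {f : ℂ → ℂ} (hf : f ∈ evenTheta τ N) (c : ℂ) :
    (fun u => c * f u) ∈ evenTheta τ N := by
  refine ⟨hf.1.const_mul c, fun x => ?_, fun x => ?_, fun x => ?_⟩
  · simp only [hf.2.1]
  · simp only [hf.2.2.1]; ring
  · simp only [hf.2.2.2]

theorem isReproducingKernel {τ : ℂ} (hre : τ.re = 0) (hτ : 0 < τ.im) {η : ℂ} {N : ℕ}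
    (hη : InRegion τ η N) (h : conj η = η ∨ conj η = -η) :
    IsReproducingKernel τ η N fun v u => (kernelConst τ η N)⁻¹ * kernel τ η N v u := by
  have hP := pPow_ne_zero τ (-1 / 8)
  have hP2 := pPow_ne_zero τ (1 / 2)
  have hR := reproducingConst_ne_zero hre hτ hη
  refine ⟨fun v => ?_, fun f hf v => ?_⟩
  · simp only [kernel_eq]
    exact evenTheta.const_mul (evenTheta.const_mul (thetaKernel_mem_evenTheta hτ η N _) _) _
  have e : metricIntegrand τ η N f (fun u => (kernelConst τ η N)⁻¹ * kernel τ η N v u) =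
      fun u => (reproducingConst τ η N)⁻¹ * pairingIntegrand τ η N f (thetaKernel τ η N v) u := by
    funext u
    have hK := thetaKernel_conj_ne_zero hre hτ hη u
    -- The kernel contributes p^(-N/4) and the denominator of the weight p^(-(N+2)/4). The surplus
    -- p^(1/2) is the ratio of `kernelConst` to `reproducingConst`.
    have h4 : pPow τ (1 / 2) * pPow τ (-1 / 8) ^ 4 = 1 := by
      rw [pPow_pow, ← pPow_add]
      norm_num [pPow]
    rw [metricIntegrand, weight_eq, pairingIntegrand, kernel_eq]
    simp only [map_mul, map_inv₀, conj_kernelConst hre hτ N h, map_pow,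
      conj_pPow hre (c := -1 / 8) (by simp [map_ofNat]), conj_thetaKernel hre hτ, Complex.conj_conj,
      thetaKernel_eq_of_eta h]
    rw [kernelConst_eq hre hτ hη, mul_add, pow_add]
    generalize pPow τ (-1 / 8) = P at hP h4 ⊢
    generalize pPow τ (1 / 2) = P' at hP2 h4 ⊢
    field_simp
    linear_combination (-(f u * thetaKernel τ η N v (conj u) * theta τ (2 * u) *
      theta τ (2 * conj u))) * h4
  rw [metric, e]
  constructor
  · refine (integrableOn_fundDomain τ ?_).const_mul _
    exact continuous_pairingIntegrand hre hτ hη hf.1.continuous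
      (thetaKernel_mem_evenTheta hτ η N v).1.continuous
  · rw [integral_const_mul]
    change _ * pairing τ η N f (thetaKernel τ η N v) = _
    rw [pairing_thetaKernel hre hτ hη hf]
    field_simp

/-! ### Multiplicative notation -/

/-- The exponential map `u ↦ exp(2π i u)`. -/
def eMap (u : ℂ) : ℂ := cexp (2 * Real.pi * I * u)

lemma eMap_ne_zero (u : ℂ) : eMap u ≠ 0 := Complex.exp_ne_zero _

lemma eMap_add (u v : ℂ) : eMap (u + v) = eMap u * eMap v := by
  rw [eMap, mul_add, Complex.exp_add]; rfl

lemma eMap_neg (u : ℂ) : eMap (-u) = (eMap u)⁻¹ := by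
  rw [eMap, mul_neg, Complex.exp_neg]; rfl

lemma exists_eMap_eq {z : ℂ} (hz : z ≠ 0) : ∃ u, eMap u = z := by
  refine ⟨Complex.log z / (2 * Real.pi * I), ?_⟩
  rw [eMap, mul_div_cancel₀ _ Complex.two_pi_I_ne_zero, Complex.exp_log hz]

lemma conj_eMap (u : ℂ) : conj (eMap u) = eMap (-conj u) := by
  rw [eMap, eMap, ← Complex.exp_conj]
  simp [map_ofNat]

lemma norm_eMap (u : ℂ) : ‖eMap u‖ = Real.exp (-(2 * Real.pi * u.im)) := by
  rw [eMap, Complex.norm_exp]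
  simp

lemma mTheta_eq_theta3 {τ : ℂ} (hτ : 0 < τ.im) (x : ℂ) :
    mTheta (pOf τ) (-pPow τ (1 / 2) * eMap x) = theta3 τ x / qPoch (pOf τ) (pOf τ) := by
  have hQ := qPoch_self_ne_zero hτ
  have e : pOf τ / (-pPow τ (1 / 2) * eMap x) =
      -pPow τ (1 / 2) * cexp (-(2 * Real.pi * I * x)) := by
    rw [eMap, Complex.exp_neg, ← pPow_one, show (1 : ℂ) = 1 / 2 + 1 / 2 by norm_num, pPow_add]
    have := pPow_ne_zero τ (1 / 2)
    norm_num
    field_simp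
  rw [mTheta, e, theta3, eMap]
  field_simp

lemma gammaPair_eMap {τ : ℂ} (hτ : 0 < τ.im) (η : ℂ) (m : ℕ) (x : ℂ) :
    gammaPair τ η m (eMap x) = thetaProd τ η m x / qPoch (pOf τ) (pOf τ) ^ m := by
  have e : ∀ k : ℕ, -pPow τ (1 / 2) * qPow η (k - (m - 1) / 2) * eMap x =
      -pPow τ (1 / 2) * eMap (x + (2 * k - m + 1) * η) := fun k => by
    rw [mul_assoc, qPow, eMap, eMap, ← Complex.exp_add]
    ring_nf
  simp only [gammaPair, e, mTheta_eq_theta3 hτ, thetaProd]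
  rw [Finset.prod_div_distrib, Finset.prod_const, Finset.card_range]

lemma gammaQuad_eMap {τ : ℂ} (hτ : 0 < τ.im) (η : ℂ) (m : ℕ) (x y : ℂ) :
    gammaQuad τ η m (eMap x) (eMap y) =
      thetaKernel τ η m y x / qPoch (pOf τ) (pOf τ) ^ (2 * m) := by
  rw [gammaQuad, ← eMap_neg, ← eMap_add, ← eMap_add, gammaPair_eMap hτ, gammaPair_eMap hτ,
    thetaKernel, ← sub_eq_add_neg]
  ring

lemma mTheta_eMap {τ : ℂ} (hτ : 0 < τ.im) (x : ℂ) :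
    mTheta (pOf τ) (eMap x) = theta τ x * cexp (Real.pi * I * x) /
      (I * pPow τ (1 / 8) * qPoch (pOf τ) (pOf τ)) := by
  have hQ := qPoch_self_ne_zero hτ
  have hP := pPow_ne_zero τ (1 / 8)
  have e : cexp (-(Real.pi * I * x)) * cexp (Real.pi * I * x) = 1 := by
    rw [← Complex.exp_add]; simp
  rw [theta_eq, mTheta, div_eq_mul_inv (pOf τ), ← eMap_neg, eMap, eMap, mul_neg,
    eq_div_iff (mul_ne_zero (mul_ne_zero I_ne_zero hP) hQ)]
  linear_combination (-(I * pPow τ (1 / 8) * qPoch (pOf τ) (pOf τ) *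
    (qPoch (cexp (2 * Real.pi * I * x)) (pOf τ) *
      qPoch (pOf τ * cexp (-(2 * Real.pi * I * x))) (pOf τ)))) * e

/-- Of the |z|⁻⁴ in the integrand, half is cancelled by the factor |z|² on the left, which comes
from the Jacobian. The other half is cancelled by the exponentials relating the multiplicative theta
functions of z² and z̄² to θ(2u) and θ(-2ū). -/
lemma pairedIntegrand_eMap {τ : ℂ} (hre : τ.re = 0) (hτ : 0 < τ.im) {η : ℂ} {N : ℕ}
    (hη : InRegion τ η N) {v w a b : ℂ} (hv : eMap a = v) (hw : eMap b = conj w) (u : ℂ) :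
    (‖eMap u‖ : ℂ) ^ 2 * pairedIntegrand τ η N v w (eMap u) =
      pPow τ (-1 / 4) * qPoch (pOf τ) (pOf τ) ^ 2 / qPoch (pOf τ) (pOf τ) ^ (2 * N) *
        pairingIntegrand τ η N (thetaKernel τ η N b) (thetaKernel τ η N a) u := by
  have hQ := qPoch_self_ne_zero hτ
  have hP := pPow_ne_zero τ (1 / 8)
  have hK := thetaKernel_conj_ne_zero hre hτ hη u
  have hn : (‖eMap u‖ : ℂ) ≠ 0 := by exact_mod_cast norm_ne_zero_iff.2 (eMap_ne_zero u)
  have hE : cexp (Real.pi * I * (2 * u)) * cexp (Real.pi * I * (2 * -conj u)) =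
      (‖eMap u‖ : ℂ) ^ 2 := by
    rw [norm_eMap, ← Complex.exp_add, ← Complex.ofReal_pow, ← Real.exp_nat_mul, Complex.ofReal_exp]
    congr 1
    have := Complex.sub_conj u
    push_cast at this ⊢
    linear_combination (2 * Real.pi * I) * this + (4 * Real.pi * u.im) * I_mul_I
  have hp4 : pPow τ (-1 / 4) * pPow τ (1 / 8) ^ 2 = 1 := by
    rw [pPow_pow, ← pPow_add]
    norm_num [pPow]
  have s1 : eMap u ^ 2 = eMap (2 * u) := by rw [two_mul, eMap_add, sq]
  have s2 : eMap (-conj u) ^ 2 = eMap (2 * -conj u) := by rw [two_mul, eMap_add, sq]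
  rw [pairedIntegrand, ← hw, ← hv, conj_eMap, gammaQuad_eMap hτ, gammaQuad_eMap hτ,
    gammaQuad_eMap hτ, s1, s2, mTheta_eMap hτ, mTheta_eMap hτ, pairingIntegrand,
    thetaKernel_neg, thetaKernel_neg, thetaKernel_comm τ η N (conj u) a,
    thetaKernel_comm τ η N u b, mul_neg 2 (conj u), theta_neg hτ]
  rw [mul_neg 2 (conj u)] at hE
  generalize pPow τ (1 / 8) = P at *
  generalize pPow τ (-1 / 4) = P' at *
  generalize qPoch (pOf τ) (pOf τ) = Q at *
  generalize (‖eMap u‖ : ℂ) = n at *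
  generalize theta τ (2 * u) = t1
  generalize theta τ (2 * conj u) = t2
  generalize cexp (Real.pi * I * (2 * u)) = x1 at *
  generalize cexp (Real.pi * I * (-(2 * conj u))) = x2 at *
  rw [mul_add 2 N 2, pow_add]
  have hI : I ^ 2 = -1 := I_sq
  field_simp
  set K := thetaKernel τ η N a (conj u) * thetaKernel τ η N b u * t1 * t2 * Q ^ 4
  linear_combination (-K) * hE - K * n ^ 2 * I ^ 2 * hp4 - K * n ^ 2 * hI

/-- The factor 4π² is the Jacobian constant; the powers of p and (p; p)_∞ come from
`pairedIntegrand_eMap`. -/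
lemma integralConst_eq {τ : ℂ} (hre : τ.re = 0) (hτ : 0 < τ.im) {η : ℂ} {N : ℕ}
    (hη : InRegion τ η N) : integralConst τ η N =
      4 * Real.pi ^ 2 * pPow τ (-1 / 4) * qPoch (pOf τ) (pOf τ) ^ 2 * reproducingConst τ η N := by
  have hQ := qPoch_self_ne_zero hτ
  have hP := pPow_ne_zero τ (1 / 8)
  have hN : (N : ℂ) + 1 ≠ 0 := Nat.cast_add_one_ne_zero N
  have hpi : (Real.pi : ℂ) ≠ 0 := by exact_mod_cast Real.pi_ne_zero
  by_cases h0 : η = 0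
  · subst h0
    have h8 : pPow τ (-1 / 2) * pPow τ (1 / 8) = pPow τ (-1 / 4) * pPow τ (-1 / 8) := by
      rw [← pPow_add, ← pPow_add]; norm_num
    rw [integralConst, if_pos rfl, reproducingConst, mul_zero, dslope_same, deriv_theta_zero hτ]
    generalize pPow τ (1 / 8) = P1 at *
    generalize pPow τ (-1 / 4) = P2 at *
    generalize pPow τ (-1 / 8) = P3 at *
    generalize pPow τ (-1 / 2) = P4 at *
    field_simp
    linear_combination 4 * h8
  · have h8 : pPow τ (-1 / 2) * pPow τ (1 / 8) = pPow τ (-1 / 4) * pPow τ (-1 / 8) := by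
      rw [← pPow_add, ← pPow_add]; norm_num
    have hθ := theta_two_mul_ne_zero hre hτ hη h0
    have e1 : cexp (2 * Real.pi * I * (2 * (N + 1) * η)) = qPow η (N + 1) := by
      rw [qPow]; ring_nf
    have e2 : cexp (-(2 * Real.pi * I * (2 * (N + 1) * η))) = qPow η (-N - 1) := by
      rw [qPow]; ring_nf
    have e3 : qPow η ((N + 1) / 2) * cexp (-(Real.pi * I * (2 * (N + 1) * η))) = 1 := by
      rw [qPow, ← Complex.exp_add, Complex.exp_eq_one_iff]
      exact ⟨0, by push_cast; ring⟩
    rw [integralConst, if_neg h0, ← pairingConst_eq hre hτ hη h0, pairingConst, logQ]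
    rw [theta_eq, e1, e2] at hθ ⊢
    generalize cexp (-(Real.pi * I * (2 * (N + 1) * η))) = E at *
    generalize qPow η ((N + 1) / 2) = E' at *
    have hA := left_ne_zero_of_mul (right_ne_zero_of_mul hθ)
    have hB := right_ne_zero_of_mul (right_ne_zero_of_mul hθ)
    have hE := right_ne_zero_of_mul (left_ne_zero_of_mul (left_ne_zero_of_mul hθ))
    generalize qPoch (qPow η (N + 1)) (pOf τ) = A at *
    generalize qPoch (pOf τ * qPow η (-N - 1)) (pOf τ) = B at *
    generalize pPow τ (1 / 8) = P1 at *
    generalize pPow τ (-1 / 4) = P2 at *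
    generalize pPow τ (-1 / 8) = P3 at *
    generalize pPow τ (-1 / 2) = P4 at *
    generalize qPoch (pOf τ) (pOf τ) = Q at *
    have hI : I ^ 2 = -1 := I_sq
    field_simp
    linear_combination (-(P4 * P1 * E' * E)) * hI + P4 * P1 * e3 + h8

/-! ### The annulus -/

lemma eMap_image_fundDomain (τ : ℂ) :
    eMap '' fundDomain τ = {z : ℂ | ‖pOf τ‖ < ‖z‖ ∧ ‖z‖ ≤ 1} := by
  have hp : ‖pOf τ‖ = Real.exp (-(2 * Real.pi * τ.im)) := norm_eMap τ
  have hpi := Real.two_pi_pos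
  ext z
  constructor
  · rintro ⟨u, ⟨-, -, h1, h2⟩, rfl⟩
    constructor
    · rw [hp, norm_eMap, Real.exp_lt_exp]
      have := mul_lt_mul_of_pos_left h2 hpi
      linarith
    · rw [norm_eMap, Real.exp_le_one_iff]
      have := mul_nonneg hpi.le h1
      linarith
  · rintro ⟨h1, h2⟩
    have hz : z ≠ 0 := norm_pos_iff.1 ((norm_nonneg _).trans_lt h1)
    obtain ⟨u, rfl⟩ := exists_eMap_eq hz
    rw [hp, norm_eMap, Real.exp_lt_exp] at h1
    rw [norm_eMap, Real.exp_le_one_iff] at h2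
    refine ⟨u - ⌊u.re⌋, ⟨?_, ?_, ?_, ?_⟩, ?_⟩
    · simp
    · simpa using Int.fract_lt_one u.re
    · have : 0 ≤ 2 * Real.pi * u.im := by linarith
      simpa using nonneg_of_mul_nonneg_right this hpi
    · have : 2 * Real.pi * u.im < 2 * Real.pi * τ.im := by linarith
      simpa using lt_of_mul_lt_mul_left this hpi.le
    · rw [eMap, eMap, Complex.exp_eq_exp_iff_exists_int]
      exact ⟨-⌊u.re⌋, by push_cast; ring⟩

lemma injOn_eMap (τ : ℂ) : Set.InjOn eMap (fundDomain τ) := by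
  intro u hu v hv h
  obtain ⟨n, hn⟩ := Complex.exp_eq_exp_iff_exists_int.1 h
  have h2 : u = v + n := by
    refine mul_left_cancel₀ Complex.two_pi_I_ne_zero ?_
    rw [hn]; ring
  have hr := congrArg Complex.re h2
  simp at hr
  have h3 : |(n : ℝ)| < 1 := by
    rw [abs_lt]
    constructor <;> linarith [hu.1, hu.2.1, hv.1, hv.2.1]
  have h4 : n = 0 := Int.abs_lt_one_iff.1 (by exact_mod_cast h3)
  simpa [h4] using h2

/-- The half-open cell covers the unit circle but not the inner one, so the sets differ by a circle.
-/
lemma annulus_ae_eq (τ : ℂ) : annulus τ =ᵐ[volume] eMap '' fundDomain τ := by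
  have : annulus τ = eMap '' fundDomain τ \ Metric.sphere 0 1 := by
    rw [eMap_image_fundDomain τ]
    ext z
    simp only [annulus, Set.mem_sdiff, mem_sphere_zero_iff_norm]
    constructor
    · rintro ⟨h1, h2⟩; exact ⟨⟨h1, h2.le⟩, h2.ne⟩
    · rintro ⟨⟨h1, h2⟩, h3⟩; exact ⟨h1, lt_of_le_of_ne h2 h3⟩
  rw [this]
  exact sdiff_null_ae_eq_self (Measure.addHaar_sphere _ _ _)

lemma hasFDerivWithinAt_eMap (s : Set ℂ) (u : ℂ) : HasFDerivWithinAt eMap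
    ((ContinuousLinearMap.toSpanSingleton ℂ (eMap u * (2 * Real.pi * I))).restrictScalars ℝ)
    s u := by
  have : HasDerivAt eMap (eMap u * (2 * Real.pi * I)) u := by
    have : HasDerivAt (fun u : ℂ => 2 * Real.pi * I * u) (2 * Real.pi * I) u := by
      simpa using (hasDerivAt_id u).const_mul (2 * Real.pi * I : ℂ)
    exact this.cexp
  exact (this.hasFDerivAt.restrictScalars ℝ).hasFDerivWithinAt

lemma abs_det_eMap (u : ℂ) :
    |((ContinuousLinearMap.toSpanSingleton ℂ (eMap u * (2 * Real.pi * I))).restrictScalars ℝ).det| =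
      4 * Real.pi ^ 2 * ‖eMap u‖ ^ 2 := by
  simp [ContinuousLinearMap.det, LinearMap.det_restrictScalars, Algebra.norm_complex_eq,
    Complex.normSq_eq_norm_sq, abs_of_pos Real.pi_pos]
  ring

lemma setIntegral_annulus (τ : ℂ) (g : ℂ → ℂ) : ∫ z in annulus τ, g z =
    ∫ u in fundDomain τ, 4 * Real.pi ^ 2 * ((‖eMap u‖ : ℂ) ^ 2 * g (eMap u)) := by
  rw [setIntegral_congr_set (annulus_ae_eq τ),
    integral_image_eq_integral_abs_det_fderiv_smul volume (measurableSet_fundDomain τ)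
      (fun u _ => hasFDerivWithinAt_eMap _ u) (injOn_eMap τ)]
  simp only [abs_det_eMap, Complex.real_smul]
  push_cast
  simp only [mul_assoc]

lemma integrableOn_annulus_iff (τ : ℂ) (g : ℂ → ℂ) :
    IntegrableOn g (annulus τ) ↔
    IntegrableOn (fun u => 4 * Real.pi ^ 2 * ((‖eMap u‖ : ℂ) ^ 2 * g (eMap u)))
      (fundDomain τ) := by
  rw [integrableOn_congr_set_ae (annulus_ae_eq τ),
    integrableOn_image_iff_integrableOn_abs_det_fderiv_smul volume (measurableSet_fundDomain τ)
      (fun u _ => hasFDerivWithinAt_eMap _ u) (injOn_eMap τ)]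
  simp only [abs_det_eMap, Complex.real_smul]
  push_cast
  simp only [mul_assoc]

/-- In the variable u this is the pairing of the kernel at b with the kernel at a, where v =
exp(2πia) and w̄ = exp(2πib); the reproducing property evaluates it. -/
theorem doubleIntegralEvaluation {τ : ℂ} (hre : τ.re = 0) (hτ : 0 < τ.im) {η : ℂ} {N : ℕ}
    (hη : InRegion τ η N) : DoubleIntegralEvaluation τ η N := by
  intro v w hv hw
  obtain ⟨a, ha⟩ := exists_eMap_eq hv
  obtain ⟨b, hb⟩ := exists_eMap_eq (z := conj w) (by simpa using hw)
  have hb' := thetaKernel_mem_evenTheta hτ η N b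
  have ha' := thetaKernel_mem_evenTheta hτ η N a
  rw [integrableOn_annulus_iff τ, setIntegral_annulus τ]
  simp only [pairedIntegrand_eMap hre hτ hη ha hb]
  constructor
  · exact ((integrableOn_fundDomain τ (continuous_pairingIntegrand hre hτ hη hb'.1.continuous
      ha'.1.continuous)).const_mul _).const_mul _
  · rw [integral_const_mul, integral_const_mul]
    change _ * (_ * pairing τ η N (thetaKernel τ η N b) (thetaKernel τ η N a)) = _
    rw [pairing_thetaKernel hre hτ hη hb', integralConst_eq hre hτ hη, ← hb, ← ha,
      gammaQuad_eMap hτ]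
    ring

/-! ### The elliptic gamma function -/

/-- The double shifted factorial `∏_{j,k ≥ 0} (1 - p ^ j q ^ k x)`. -/
def dPoch (p q x : ℂ) : ℂ := ∏' jk : ℕ × ℕ, (1 - p ^ jk.1 * q ^ jk.2 * x)

lemma summable_norm_pow_mul_pow {p q : ℂ} (hp : ‖p‖ < 1) (hq : ‖q‖ < 1) (x : ℂ) :
    Summable fun jk : ℕ × ℕ => ‖-(p ^ jk.1 * q ^ jk.2 * x)‖ := by
  simp only [norm_neg, norm_mul, norm_pow]
  exact ((summable_geometric_of_lt_one (norm_nonneg p) hp).mul_of_nonneg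
    (summable_geometric_of_lt_one (norm_nonneg q) hq) (fun _ => by positivity)
    (fun _ => by positivity)).mul_right _

lemma multipliable_dPoch {p q : ℂ} (hp : ‖p‖ < 1) (hq : ‖q‖ < 1) (x : ℂ) :
    Multipliable fun jk : ℕ × ℕ => (1 - p ^ jk.1 * q ^ jk.2 * x) := by
  simpa [sub_eq_add_neg] using
    multipliable_one_add_of_summable (summable_norm_pow_mul_pow hp hq x)

lemma dPoch_eq_zero_iff {p q : ℂ} (hp : ‖p‖ < 1) (hq : ‖q‖ < 1) (x : ℂ) :
    dPoch p q x = 0 ↔ ∃ j k : ℕ, p ^ j * q ^ k * x = 1 := by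
  constructor
  · intro h
    by_contra! hne
    refine tprod_one_add_ne_zero_of_summable (fun jk : ℕ × ℕ => ?_)
      (summable_norm_pow_mul_pow hp hq x) (by simpa [dPoch, sub_eq_add_neg] using h)
    rw [← sub_eq_add_neg, sub_ne_zero]
    exact (hne jk.1 jk.2).symm
  · rintro ⟨j, k, h⟩
    exact tprod_of_exists_eq_zero ⟨(j, k), by simp [h]⟩

lemma dPoch_eq_mul {p q : ℂ} (hp : ‖p‖ < 1) (hq : ‖q‖ < 1) (x : ℂ) :
    dPoch p q x = qPoch x p * dPoch p q (q * x) := by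
  have key : ∀ y, HasProd (fun k : ℕ => qPoch (q ^ k * y) p) (dPoch p q y) := fun y => by
    have h1 := (Equiv.prodComm ℕ ℕ).hasProd_iff.2 (multipliable_dPoch hp hq y).hasProd
    refine h1.prod_fiberwise fun k => ?_
    refine (multipliable_qPoch hp (q ^ k * y)).hasProd.congr_fun fun j => ?_
    simp only [Function.comp_apply, Equiv.prodComm_apply, Prod.swap_prod_mk]
    ring
  have h2 : ∀ k : ℕ, q ^ (k + 1) * x = q ^ k * (q * x) := fun k => by ring
  rw [← (key x).tprod_eq, tprod_eq_zero_mul' (by simpa only [h2] using (key (q * x)).multipliable)]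
  simp only [h2, (key (q * x)).tprod_eq, pow_zero, one_mul]

lemma dPoch_eq_prod_mul {p q : ℂ} (hp : ‖p‖ < 1) (hq : ‖q‖ < 1) (m : ℕ) (x : ℂ) :
    dPoch p q x = (∏ k ∈ Finset.range m, qPoch (q ^ k * x) p) * dPoch p q (q ^ m * x) := by
  induction m with
  | zero => simp
  | succ m ih =>
    rw [ih, dPoch_eq_mul hp hq (q ^ m * x), Finset.prod_range_succ]
    ring_nf

/-- At a pole both sides are 0: one factor of the product has denominator zero, and so has the
quotient. -/
lemma ellGammaProd_eq {p q : ℂ} (hp : ‖p‖ < 1) (hq : ‖q‖ < 1) (x : ℂ) :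
    ellGammaProd p q x = dPoch p q (p * q / x) / dPoch p q x := by
  by_cases h : dPoch p q x = 0
  · rw [h, div_zero]
    obtain ⟨j, k, hjk⟩ := (dPoch_eq_zero_iff hp hq x).1 h
    exact tprod_of_exists_eq_zero ⟨(j, k), by simp [hjk]⟩
  · rw [dPoch, dPoch, ← Multipliable.tprod_div₀ (multipliable_dPoch hp hq _)
      (multipliable_dPoch hp hq _) h, ellGammaProd]
    congr! 3
    ring

lemma mTheta_div {p x : ℂ} (hp : p ≠ 0) : mTheta p (p / x) = mTheta p x := by
  rw [mTheta, mTheta, div_div_cancel₀ hp, mul_comm]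

lemma ellGammaProd_mul_div {p q x : ℂ} (hp : ‖p‖ < 1) (hq : ‖q‖ < 1) (hp0 : p ≠ 0)
    (h1 : dPoch p q x ≠ 0) (h2 : dPoch p q (p / x) ≠ 0) :
    (ellGammaProd p q x * ellGammaProd p q (p / x))⁻¹ = mTheta p x := by
  have e1 : p * q / x = q * (p / x) := by ring
  have e2 : p * q / (p / x) = q * x := by
    by_cases hx : x = 0
    · simp [hx]
    · field_simp
  rw [ellGammaProd_eq hp hq, ellGammaProd_eq hp hq, e1, e2, mTheta]
  rw [dPoch_eq_mul hp hq] at h1 h2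
  rw [dPoch_eq_mul hp hq x, dPoch_eq_mul hp hq (p / x)]
  have := left_ne_zero_of_mul h1
  have := right_ne_zero_of_mul h1
  have := left_ne_zero_of_mul h2
  have := right_ne_zero_of_mul h2
  generalize qPoch (p / x) p = a at *
  generalize dPoch p q (q * (p / x)) = b at *
  field_simp

/-- The relation between x and y makes pq/x = y/q^m and pq/y = x/q^m. Each numerator thus begins q^m
earlier than the denominator for the other variable, and only m single products survive on each
side. -/
lemma ellGammaProd_mul {p q x y : ℂ} {m : ℕ} (hp : ‖p‖ < 1) (hq : ‖q‖ < 1) (hp0 : p ≠ 0)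
    (hq0 : q ≠ 0) (hxy : x * y = p * q ^ (m + 1)) (h1 : dPoch p q x ≠ 0)
    (h2 : dPoch p q y ≠ 0) : ellGammaProd p q x * ellGammaProd p q y =
      ∏ k ∈ Finset.range m, mTheta p (q ^ k / q ^ m * x) := by
  have h0 : x * y ≠ 0 := hxy ▸ mul_ne_zero hp0 (pow_ne_zero _ hq0)
  have hx := left_ne_zero_of_mul h0
  have hy := right_ne_zero_of_mul h0
  have hqm := pow_ne_zero m hq0
  have e1 : p * q / x = y / q ^ m := by
    rw [div_eq_div_iff hx hqm, mul_comm y x, hxy]; ring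
  have e2 : p * q / y = x / q ^ m := by
    rw [div_eq_div_iff hy hqm, hxy]; ring
  have e3 : ∀ u, q ^ m * (u / q ^ m) = u := fun u => mul_div_cancel₀ u hqm
  have e4 : ∀ k : ℕ, k ∈ Finset.range m →
      p / (q ^ (m - 1 - k) / q ^ m * x) = q ^ k * (y / q ^ m) := fun k hk => by
    have hk' := Finset.mem_range.1 hk
    have h3 : q ^ (m - 1 - k) * q ^ (k + 1) = q ^ m := by
      rw [← pow_add]; congr 1; omega
    have := pow_ne_zero (m - 1 - k) hq0
    rw [div_eq_iff (by positivity)]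
    field_simp
    linear_combination (-p) * q ^ m * h3 - q ^ k * q ^ (m - 1 - k) * hxy
  rw [ellGammaProd_eq hp hq, ellGammaProd_eq hp hq, e1, e2,
    dPoch_eq_prod_mul hp hq m (y / q ^ m), dPoch_eq_prod_mul hp hq m (x / q ^ m), e3, e3]
  simp only [mTheta, Finset.prod_mul_distrib]
  rw [← Finset.prod_range_reflect (fun k => qPoch (p / (q ^ k / q ^ m * x)) p)]
  rw [Finset.prod_congr rfl fun k hk => congrArg (qPoch · p) (e4 k hk),
    Finset.prod_congr rfl fun k _ => congrArg (qPoch · p) (div_mul_comm (q ^ k) (q ^ m) x)]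
  simp only [mul_comm _ (q ^ _)]
  generalize ∏ k ∈ Finset.range m, qPoch (q ^ k * (x / q ^ m)) p = a
  generalize ∏ k ∈ Finset.range m, qPoch (q ^ k * (y / q ^ m)) p = b
  field_simp

lemma ellGamma_of_norm_lt_one {p q : ℂ} (hq : ‖q‖ < 1) (x : ℂ) :
    ellGamma p q x = ellGammaProd p q x := if_pos hq

/-- The reflection formula turns the reciprocal into a value at p/x with nome 1/q, so ‖q‖ > 1
reduces to ‖q‖ < 1 by x ↦ p/x, a symmetry of `mTheta`. -/
lemma ellGamma_of_one_lt_norm {p q : ℂ} (hp : ‖p‖ < 1) (hp0 : p ≠ 0) (hq : 1 < ‖q‖) (x : ℂ) :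
    ellGamma p q x = ellGammaProd p q⁻¹ (p / x) := by
  have hq' : ‖q⁻¹‖ < 1 := by rw [norm_inv]; exact inv_lt_one_of_one_lt₀ hq
  have hq0 : q ≠ 0 := norm_pos_iff.1 (zero_lt_one.trans hq)
  rw [ellGamma, if_neg hq.not_gt, ellGammaProd_eq hp hq', ellGammaProd_eq hp hq', inv_div]
  by_cases hx : x = 0
  · simp [hx]
  · congr 2 <;> field_simp

lemma isEllGammaPole_of_norm_lt_one {p q : ℂ} (hp : ‖p‖ < 1) (hq : ‖q‖ < 1) (x : ℂ) :
    IsEllGammaPole p q x ↔ dPoch p q x = 0 := by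
  rw [IsEllGammaPole, if_pos hq, dPoch_eq_zero_iff hp hq]

lemma isEllGammaPole_of_one_lt_norm {p q x : ℂ} (hp : ‖p‖ < 1) (hp0 : p ≠ 0) (hq : 1 < ‖q‖)
    (hx : x ≠ 0) : IsEllGammaPole p q x ↔ dPoch p q⁻¹ (p / x) = 0 := by
  have hq' : ‖q⁻¹‖ < 1 := by rw [norm_inv]; exact inv_lt_one_of_one_lt₀ hq
  have hq0 : q ≠ 0 := norm_pos_iff.1 (zero_lt_one.trans hq)
  rw [IsEllGammaPole, if_neg hq.not_gt, dPoch_eq_zero_iff hp hq']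
  refine exists_congr fun j => exists_congr fun k => ?_
  have : p ^ j * q⁻¹ ^ k * (p / x) = p ^ (j + 1) / (q ^ k * x) := by
    rw [inv_pow, pow_succ]; field_simp
  rw [this, div_eq_one_iff_eq (mul_ne_zero (pow_ne_zero _ hq0) hx), eq_comm]

lemma ellGamma_mul_div {p q x : ℂ} (hp : ‖p‖ < 1) (hq : ‖q‖ ≠ 1) (hp0 : p ≠ 0) (hx : x ≠ 0)
    (h1 : ¬ IsEllGammaPole p q x) (h2 : ¬ IsEllGammaPole p q (p / x)) :
    (ellGamma p q x * ellGamma p q (p / x))⁻¹ = mTheta p x := by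
  rcases hq.lt_or_gt with hq | hq
  · rw [isEllGammaPole_of_norm_lt_one hp hq] at h1 h2
    rw [ellGamma_of_norm_lt_one hq, ellGamma_of_norm_lt_one hq,
      ellGammaProd_mul_div hp hq hp0 h1 h2]
  · have hq' : ‖q⁻¹‖ < 1 := by rw [norm_inv]; exact inv_lt_one_of_one_lt₀ hq
    rw [isEllGammaPole_of_one_lt_norm hp hp0 hq hx] at h1
    rw [isEllGammaPole_of_one_lt_norm hp hp0 hq (div_ne_zero hp0 hx)] at h2
    rw [ellGamma_of_one_lt_norm hp hp0 hq, ellGamma_of_one_lt_norm hp hp0 hq,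
      ellGammaProd_mul_div hp hq' hp0 h1 h2, mTheta_div hp0]

lemma ellGamma_mul {p q x y : ℂ} {m : ℕ} (hp : ‖p‖ < 1) (hq : ‖q‖ ≠ 1) (hp0 : p ≠ 0)
    (hq0 : q ≠ 0) (hxy : x * y = p * q ^ (m + 1)) (h1 : ¬ IsEllGammaPole p q x)
    (h2 : ¬ IsEllGammaPole p q y) : ellGamma p q x * ellGamma p q y =
      ∏ k ∈ Finset.range m, mTheta p (q ^ k / q ^ m * x) := by
  rcases hq.lt_or_gt with hq | hq
  · rw [isEllGammaPole_of_norm_lt_one hp hq] at h1 h2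
    rw [ellGamma_of_norm_lt_one hq, ellGamma_of_norm_lt_one hq,
      ellGammaProd_mul hp hq hp0 hq0 hxy h1 h2]
  · have hq' : ‖q⁻¹‖ < 1 := by rw [norm_inv]; exact inv_lt_one_of_one_lt₀ hq
    have h0 : x * y ≠ 0 := hxy ▸ mul_ne_zero hp0 (pow_ne_zero _ hq0)
    have hx := left_ne_zero_of_mul h0
    have hy := right_ne_zero_of_mul h0
    rw [isEllGammaPole_of_one_lt_norm hp hp0 hq hx] at h1
    rw [isEllGammaPole_of_one_lt_norm hp hp0 hq hy] at h2
    have hxy' : p / x * (p / y) = p * q⁻¹ ^ (m + 1) := by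
      rw [div_mul_div_comm, hxy, inv_pow]
      field_simp
    rw [ellGamma_of_one_lt_norm hp hp0 hq, ellGamma_of_one_lt_norm hp hp0 hq,
      ellGammaProd_mul hp hq' hp0 (inv_ne_zero hq0) hxy' h1 h2]
    refine Finset.prod_congr rfl fun k _ => ?_
    rw [← mTheta_div hp0]
    congr 1
    simp only [inv_pow]
    field_simp

lemma qOf_ne_zero (η : ℂ) : qOf η ≠ 0 := Complex.exp_ne_zero _

lemma qOf_pow (η : ℂ) (k : ℕ) : qOf η ^ k = qPow η k := by
  rw [qOf, qPow, ← Complex.exp_nat_mul]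
  ring_nf

lemma qPow_ne_zero (η c : ℂ) : qPow η c ≠ 0 := Complex.exp_ne_zero _

lemma qPow_add (η a b : ℂ) : qPow η (a + b) = qPow η a * qPow η b := by
  simp only [qPow, ← Complex.exp_add]
  ring_nf

/-- The prefactor `-p^(1/2) q^((m+1)/2)`. -/
def gammaArg (τ η : ℂ) (m : ℕ) : ℂ := -pPow τ (1 / 2) * qPow η ((m + 1) / 2)

lemma gammaArg_ne_zero (τ η : ℂ) (m : ℕ) : gammaArg τ η m ≠ 0 :=
  mul_ne_zero (neg_ne_zero.2 (pPow_ne_zero _ _)) (qPow_ne_zero _ _)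

lemma gammaArg_sq (τ η : ℂ) (m : ℕ) : gammaArg τ η m ^ 2 = pOf τ * qOf η ^ (m + 1) := by
  rw [gammaArg, mul_pow, neg_sq, sq, sq, ← pPow_add, ← qPow_add, qOf_pow, ← pPow_one]
  push_cast
  ring_nf

lemma ellGamma_mul_eq_gammaPair {τ : ℂ} (hτ : 0 < τ.im) {η : ℂ} (hη : ‖qOf η‖ ≠ 1) (m : ℕ)
    {y : ℂ} (hy : y ≠ 0) (h1 : ¬ IsEllGammaPole (pOf τ) (qOf η) (gammaArg τ η m * y))
    (h2 : ¬ IsEllGammaPole (pOf τ) (qOf η) (gammaArg τ η m * y⁻¹)) :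
    ellGamma (pOf τ) (qOf η) (gammaArg τ η m * y) *
      ellGamma (pOf τ) (qOf η) (gammaArg τ η m * y⁻¹) = gammaPair τ η m y := by
  have hxy : gammaArg τ η m * y * (gammaArg τ η m * y⁻¹) = pOf τ * qOf η ^ (m + 1) := by
    rw [← gammaArg_sq]; field_simp
  rw [ellGamma_mul (norm_pOf_lt_one hτ) hη (pOf_ne_zero τ) (qOf_ne_zero η) hxy h1 h2, gammaPair]
  refine Finset.prod_congr rfl fun k _ => ?_
  have h3 : qOf η ^ k * qPow η ((m + 1) / 2) = qPow η (k - (m - 1) / 2) * qOf η ^ m := by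
    rw [qOf_pow, qOf_pow, ← qPow_add, ← qPow_add]
    ring_nf
  have h4 : qOf η ^ k / qOf η ^ m * gammaArg τ η m =
      -pPow τ (1 / 2) * qPow η (k - (m - 1) / 2) := by
    rw [div_mul_eq_mul_div, div_eq_iff (pow_ne_zero _ (qOf_ne_zero η)), gammaArg]
    linear_combination (-pPow τ (1 / 2)) * h3
  rw [← mul_assoc, h4]

lemma ellGammaQuad_eq_gammaQuad {τ : ℂ} (hτ : 0 < τ.im) {η : ℂ} (hη : ‖qOf η‖ ≠ 1) (m : ℕ)
    {x y : ℂ} (hx : x ≠ 0) (hy : y ≠ 0)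
    (h1 : ¬ IsEllGammaPole (pOf τ) (qOf η) (gammaArg τ η m * x * y))
    (h2 : ¬ IsEllGammaPole (pOf τ) (qOf η) (gammaArg τ η m * x * y⁻¹))
    (h3 : ¬ IsEllGammaPole (pOf τ) (qOf η) (gammaArg τ η m * x⁻¹ * y))
    (h4 : ¬ IsEllGammaPole (pOf τ) (qOf η) (gammaArg τ η m * x⁻¹ * y⁻¹)) :
    ellGammaQuad (pOf τ) (qOf η) (gammaArg τ η m) x y = gammaQuad τ η m x y := by
  have e1 : (x * y)⁻¹ = x⁻¹ * y⁻¹ := mul_inv _ _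
  have e2 : (x * y⁻¹)⁻¹ = x⁻¹ * y := by rw [mul_inv, inv_inv]
  simp only [mul_assoc] at h1 h2 h3 h4
  rw [← e1] at h4
  rw [← e2] at h3
  rw [gammaQuad, ← ellGamma_mul_eq_gammaPair hτ hη m (mul_ne_zero hx hy) h1 h4,
    ← ellGamma_mul_eq_gammaPair hτ hη m (mul_ne_zero hx (inv_ne_zero hy)) h2 h3, ellGammaQuad,
    e1, e2]
  simp only [mul_assoc]
  ring

/-! ### Exceptional sets -/

lemma countable_isEllGammaPole (p : ℂ) {q : ℂ} (hq0 : q ≠ 0) :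
    {x | IsEllGammaPole p q x}.Countable := by
  by_cases hq : ‖q‖ < 1
  · refine (Set.countable_range fun jk : ℕ × ℕ => (p ^ jk.1 * q ^ jk.2)⁻¹).mono fun x hx => ?_
    simp only [Set.mem_ofPred_eq, IsEllGammaPole, if_pos hq] at hx
    obtain ⟨j, k, h⟩ := hx
    exact ⟨(j, k), (eq_inv_of_mul_eq_one_right h).symm⟩
  · refine (Set.countable_range fun jk : ℕ × ℕ => p ^ (jk.1 + 1) / q ^ jk.2).mono fun x hx => ?_
    simp only [Set.mem_ofPred_eq, IsEllGammaPole, if_neg hq] at hx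
    obtain ⟨j, k, h⟩ := hx
    exact ⟨(j, k), by simp [← h, pow_ne_zero _ hq0]⟩

lemma ae_notMem_of_countable {S : Set ℂ} (hS : S.Countable) {F : ℂ → ℂ}
    (hF : ∀ c, volume {z | F z = c} = 0) : ∀ᵐ z, F z ∉ S := by
  rw [ae_iff]
  have : {z | ¬ F z ∉ S} = ⋃ c ∈ S, {z | F z = c} := by
    ext z; simp
  rw [this]
  exact (measure_biUnion_null_iff hS).2 fun c _ => hF c

/-- A nonempty level set lies on a circle, because the norm of F determines that of z. -/
lemma volume_eq_zero_of_norm_eq {F : ℂ → ℂ} {α : ℝ} {k : ℤ} (hα : α ≠ 0) (hk : k ≠ 0)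
    (hF : ∀ z, ‖F z‖ = α * ‖z‖ ^ k) (c : ℂ) : volume {z | F z = c} = 0 := by
  rcases Set.eq_empty_or_nonempty {z | F z = c} with h | ⟨z₀, h₀⟩
  · simp [h]
  · refine measure_mono_null (fun z hz => ?_) (Measure.addHaar_sphere volume (0 : ℂ) ‖z₀‖)
    rw [mem_sphere_zero_iff_norm, ← zpow_left_inj₀ (norm_nonneg _) (norm_nonneg _) hk]
    refine mul_left_cancel₀ hα ?_
    rw [← hF, ← hF, show F z = c from hz, show F z₀ = c from h₀]

/-- The set is a proper real subspace: it cannot contain both 1 and i. It handles the arguments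
proportional to z/z̄ and z̄/z, whose norm does not determine that of z. -/
lemma volume_eq_mul_conj (c : ℂ) : volume {z : ℂ | z = c * conj z} = 0 := by
  let L : ℂ →ₗ[ℝ] ℂ := LinearMap.id - (LinearMap.mulLeft ℝ c) ∘ₗ conjAe.toLinearMap
  have hL : ∀ z, L z = z - c * conj z := fun z => by simp [L]
  have : {z : ℂ | z = c * conj z} = (LinearMap.ker L : Set ℂ) := by
    ext z
    simp [hL, sub_eq_zero]
  rw [this]
  refine Measure.addHaar_submodule _ _ fun h => ?_
  rw [LinearMap.ker_eq_top] at h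
  have h1 : L 1 = 0 := by rw [h]; rfl
  have h2 : L I = 0 := by rw [h]; rfl
  rw [hL] at h1 h2
  simp only [map_one, mul_one, conj_I] at h1 h2
  have : 2 * I = 0 := by linear_combination h2 + I * h1
  simp at this

/-- The poles are countable and each argument, as a function of z, has null level sets. Hence almost
every z avoids all poles, and there the gamma functions pair up. -/
lemma gammaIntegrand_ae_eq {τ : ℂ} (hτ : 0 < τ.im) {η : ℂ} (hη : ‖qOf η‖ ≠ 1) (N : ℕ) {v w : ℂ}
    (hv : v ≠ 0) (hw : w ≠ 0) :
    gammaIntegrand τ η N v w =ᵐ[volume] pairedIntegrand τ η N v w := by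
  have hp0 := pOf_ne_zero τ
  have hw' : conj w ≠ 0 := by simpa using hw
  have hA := norm_ne_zero_iff.2 (gammaArg_ne_zero τ η N)
  have hB := norm_ne_zero_iff.2 (gammaArg_ne_zero τ η (N + 2))
  have hB' := gammaArg_ne_zero τ η (N + 2)
  have hvn := norm_ne_zero_iff.2 hv
  have hwn := norm_ne_zero_iff.2 hw
  have hpn := norm_ne_zero_iff.2 hp0
  have hS := countable_isEllGammaPole (pOf τ) (qOf_ne_zero η)
  have H : ∀ (F : ℂ → ℂ) (α : ℝ) (k : ℤ), α ≠ 0 → k ≠ 0 → (∀ z, ‖F z‖ = α * ‖z‖ ^ k) →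
      ∀ᵐ z, ¬ IsEllGammaPole (pOf τ) (qOf η) (F z) := fun F α k hα hk hF =>
    ae_notMem_of_countable hS (volume_eq_zero_of_norm_eq hα hk hF)
  set A := gammaArg τ η N with hAdef
  set B := gammaArg τ η (N + 2) with hBdef
  have h0 : ∀ᵐ z : ℂ, z ≠ 0 := by simp [ae_iff]
  have hr1 : ∀ᵐ z : ℂ, ¬ IsEllGammaPole (pOf τ) (qOf η) (B * z * (conj z)⁻¹) :=
    ae_notMem_of_countable hS fun c => by
      refine measure_mono_null (fun z hz => ?_) (volume_eq_mul_conj (c / B))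
      have hz : B * z * (conj z)⁻¹ = c := hz
      change z = c / B * conj z
      by_cases hz0 : z = 0
      · simp [hz0]
      · have : conj z ≠ 0 := by simpa using hz0
        rw [← hz]; field_simp
  have hr2 : ∀ᵐ z : ℂ, ¬ IsEllGammaPole (pOf τ) (qOf η) (B * z⁻¹ * conj z) :=
    ae_notMem_of_countable hS fun c => by
      refine measure_mono_null (fun z hz => ?_) (volume_eq_mul_conj (B / c))
      have hz : B * z⁻¹ * conj z = c := hz
      change z = B / c * conj z
      by_cases hz0 : z = 0
      · simp [hz0]
      · have : conj z ≠ 0 := by simpa using hz0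
        rw [← hz]; field_simp
  filter_upwards [h0, hr1, hr2,
    H (fun z => A * v * conj z) (‖A‖ * ‖v‖) 1 (by positivity) (by simp) (by simp),
    H (fun z => A * v * (conj z)⁻¹) (‖A‖ * ‖v‖) (-1) (by positivity) (by simp) (by simp),
    H (fun z => A * v⁻¹ * conj z) (‖A‖ * ‖v‖⁻¹) 1 (by positivity) (by simp) (by simp),
    H (fun z => A * v⁻¹ * (conj z)⁻¹) (‖A‖ * ‖v‖⁻¹) (-1) (by positivity) (by simp) (by simp),
    H (fun z => A * conj w * z) (‖A‖ * ‖w‖) 1 (by positivity) (by simp) (by simp),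
    H (fun z => A * conj w * z⁻¹) (‖A‖ * ‖w‖) (-1) (by positivity) (by simp) (by simp),
    H (fun z => A * (conj w)⁻¹ * z) (‖A‖ * ‖w‖⁻¹) 1 (by positivity) (by simp) (by simp),
    H (fun z => A * (conj w)⁻¹ * z⁻¹) (‖A‖ * ‖w‖⁻¹) (-1) (by positivity) (by simp) (by simp),
    H (fun z => B * z * conj z) ‖B‖ 2 hB (by simp) (fun z => by
      simp [mul_assoc, zpow_ofNat, sq]),
    H (fun z => B * z⁻¹ * (conj z)⁻¹) ‖B‖ (-2) hB (by simp) (fun z => by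
      simp [mul_assoc, zpow_neg, zpow_ofNat, sq]),
    H (fun z => z ^ 2) 1 2 one_ne_zero (by simp) (fun z => by simp [zpow_ofNat]),
    H (fun z => conj z ^ 2) 1 2 one_ne_zero (by simp) (fun z => by simp [zpow_ofNat]),
    H (fun z => pOf τ / z ^ 2) ‖pOf τ‖ (-2) hpn (by simp) (fun z => by
      simp [div_eq_mul_inv, zpow_neg, zpow_ofNat, sq]),
    H (fun z => pOf τ / conj z ^ 2) ‖pOf τ‖ (-2) hpn (by simp) (fun z => by
      simp [div_eq_mul_inv, zpow_neg, zpow_ofNat, sq])]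
    with z hz a1 a2 b1 b2 b3 b4 c1 c2 c3 c4 d1 d2 e1 e2 e3 e4
  have hz' : conj z ≠ 0 := by simpa using hz
  have hBeq : -pPow τ (1 / 2) * qPow η ((N + 3) / 2) = B := by
    rw [hBdef, gammaArg]; push_cast; ring_nf
  have hAeq : -pPow τ (1 / 2) * qPow η ((N + 1) / 2) = A := rfl
  rw [gammaIntegrand, pairedIntegrand, hBeq, hAeq,
    ellGammaQuad_eq_gammaQuad hτ hη N hv hz' b1 b2 b3 b4,
    ellGammaQuad_eq_gammaQuad hτ hη N hw' hz c1 c2 c3 c4,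
    ellGammaQuad_eq_gammaQuad hτ hη (N + 2) hz hz' d1 a1 a2 d2,
    ← ellGamma_mul_div (norm_pOf_lt_one hτ) hη hp0 (pow_ne_zero 2 hz) e1 e3,
    ← ellGamma_mul_div (norm_pOf_lt_one hτ) hη hp0 (pow_ne_zero 2 hz') e2 e4]
  simp only [div_eq_mul_inv, mul_inv]
  ring

theorem gammaIntegral {τ : ℂ} (hre : τ.re = 0) (hτ : 0 < τ.im) {η : ℂ} {N : ℕ}
    (hη : InRegion τ η N) (hq : ‖qOf η‖ ≠ 1) {v w : ℂ} (hv : v ≠ 0) (hw : w ≠ 0)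
    (h : ∀ x ∈ ({gammaArg τ η N * v * conj w, gammaArg τ η N * v * (conj w)⁻¹,
        gammaArg τ η N * v⁻¹ * conj w, gammaArg τ η N * v⁻¹ * (conj w)⁻¹} : Set ℂ),
      ¬ IsEllGammaPole (pOf τ) (qOf η) x) :
    IntegrableOn (gammaIntegrand τ η N v w) (annulus τ) volume ∧
      ∫ z in annulus τ, gammaIntegrand τ η N v w z =
        integralConst τ η N * ellGammaQuad (pOf τ) (qOf η) (gammaArg τ η N) v (conj w) := by
  have hw' : conj w ≠ 0 := by simpa using hw
  have hae : gammaIntegrand τ η N v w =ᵐ[volume.restrict (annulus τ)] pairedIntegrand τ η N v w :=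
    ae_restrict_of_ae (gammaIntegrand_ae_eq hτ hq N hv hw)
  obtain ⟨h1, h2⟩ := doubleIntegralEvaluation hre hτ hη v w hv hw
  refine ⟨h1.congr hae.symm, ?_⟩
  rw [integral_congr_ae hae, h2, ellGammaQuad_eq_gammaQuad hτ hq N hv hw' (h _ (by simp))
    (h _ (by simp)) (h _ (by simp)) (h _ (by simp))]

end SklyaninIntegral

end

theorem mainTheorem6 (τ : ℂ) (hτre : τ.re = 0) (hτim : 0 < τ.im) (N : ℕ) :
    -- the evaluation on the whole parameter region, paired gamma functions
    (∀ η : ℂ, |η.re| < 1 / (2 * ((N : ℝ) + 1)) → |η.im| < τ.im / (2 * ((N : ℝ) + 1)) →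
      SklyaninIntegral.DoubleIntegralEvaluation τ η N) ∧
    -- the same evaluation with elliptic gamma functions, whenever these are defined
    (∀ η : ℂ, |η.re| < 1 / (2 * ((N : ℝ) + 1)) → |η.im| < τ.im / (2 * ((N : ℝ) + 1)) →
      ‖SklyaninIntegral.qOf η‖ ≠ 1 →
      ∀ v w a : ℂ, v ≠ 0 → w ≠ 0 →
        a = -SklyaninIntegral.pPow τ (1 / 2) * SklyaninIntegral.qPow η ((N + 1) / 2) →
        (∀ x ∈ ({a * v * conj w, a * v * (conj w)⁻¹, a * v⁻¹ * conj w,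
            a * v⁻¹ * (conj w)⁻¹} : Set ℂ),
          ¬ SklyaninIntegral.IsEllGammaPole (SklyaninIntegral.pOf τ)
            (SklyaninIntegral.qOf η) x) →
        IntegrableOn (SklyaninIntegral.gammaIntegrand τ η N v w)
            (SklyaninIntegral.annulus τ) volume ∧
          ∫ z in SklyaninIntegral.annulus τ, SklyaninIntegral.gammaIntegrand τ η N v w z =
            SklyaninIntegral.integralConst τ η N *
              SklyaninIntegral.ellGammaQuad (SklyaninIntegral.pOf τ)
                (SklyaninIntegral.qOf η) a v (conj w)) ∧
    -- equivalence with the reproducing kernel formula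
    (∀ η : ℂ,
      (η.im = 0 ∧ |η.re| < 1 / (2 * ((N : ℝ) + 1))) ∨
        (η.re = 0 ∧ |η.im| < τ.im / (2 * ((N : ℝ) + 1))) →
      (SklyaninIntegral.DoubleIntegralEvaluation τ η N ↔
        SklyaninIntegral.IsReproducingKernel τ η N
          (fun v u => (SklyaninIntegral.kernelConst τ η N)⁻¹ *
            SklyaninIntegral.kernel τ η N v u))) := by
  refine ⟨fun η h1 h2 => SklyaninIntegral.doubleIntegralEvaluation hτre hτim ⟨h1, h2⟩,
    fun η h1 h2 hq v w a hv hw ha h => ?_, fun η h => ?_⟩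
  · have ha : a = SklyaninIntegral.gammaArg τ η N := ha
    subst ha
    exact SklyaninIntegral.gammaIntegral hτre hτim ⟨h1, h2⟩ hq hv hw h
  · obtain ⟨hη, hc⟩ : SklyaninIntegral.InRegion τ η N ∧ (conj η = η ∨ conj η = -η) := by
      have hN : (0 : ℝ) < 2 * ((N : ℝ) + 1) := by positivity
      rcases h with ⟨h1, h2⟩ | ⟨h1, h2⟩
      · exact ⟨⟨h2, by rw [h1, abs_zero]; exact div_pos hτim hN⟩,
          Or.inl (Complex.conj_eq_iff_im.2 h1)⟩
      · exact ⟨⟨by rw [h1, abs_zero]; exact div_pos one_pos hN, h2⟩,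
          Or.inr (Complex.ext (by simp [h1]) (by simp))⟩
    -- Both statements hold throughout this parameter range, which gives the equivalence.
    exact iff_of_true (SklyaninIntegral.doubleIntegralEvaluation hτre hτim hη)
      (SklyaninIntegral.isReproducingKernel hτre hτim hη hc)
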